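/- Let $\lambda>\mu$, $R_1>R_2>0$, $R_3>0$, $G$, $K$ be real constants, put $a=R_3^2$, $b=R_1^2-R_2^2$ (so $b>0$), and suppose that the cubic polynomial \[P(\rho)=4b(\lambda-\mu)\rho^3+\big(4(\mu-\lambda)G+4b(\mu-K)-(\lambda-\mu+b-a)^2\big)\rho^2+\big(4(K-\mu)G+2(\lambda-\mu+b-a)(K+G-\mu-a)\big)\rho-(K+G-\mu-a)^2\] has three real roots $\rho_1<\rho_2<\rho_3$, that $K+G-\mu-a\neq0$, $K-G-\lambda+b\neq0$, and $\max(0,\frac{G-a}b)<\min(1,\frac Gb)$. Put \[k=\sqrt{\tfrac{\rho_2-\rho_1}{\rho_3-\rho_1}},\quad p=\sqrt{b(\lambda-\mu)(\rho_3-\rho_1)},\quad \rho(\xi)=\rho_1+(\rho_2-\rho_1)\,\mathrm{sn}^2(p\xi)\ (\text{modulus }k),\] \[\gamma_1=\frac{R_1^2+R_2^2}{b},\qquad \gamma_2=\frac{2\big(R_1^4+R_2^4-(R_1^2+R_2^2)(a+\lambda+\mu)\big)}{b}-\frac{4R_1^2R_2^2(a+\lambda+\mu-2K)}{b^2},\]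 \[K_1=K,\quad K_2=a+\lambda+\mu-K,\quad \alpha=\frac{R_2^2K_1-R_1^2K_2}{R_1^2+R_2^2},\quad Q(\rho)=\frac{2b\rho^2+(\mu-\lambda+a-b-2G)\rho+(K+G-\mu-a)}{2\rho(1-\rho)}-\alpha,\] and, for $(i,j)=(1,2),(2,1)$, \[C_{ij}=\frac2{b^2}\Big((R_j^4+2R_i^2R_j^2-R_i^4)\big((\lambda-\mu)(G-\tfrac b2)+(R_i^2-R_j^2)(\tfrac{\lambda+\mu}2-K_i)-\lambda\mu-\lambda a\big)+4R_1^2R_2^2K_1K_2-\lambda(R_i^2-R_j^2)(R_1^4+R_2^4)-2R_j^4K_i^2\Big).\] For real $x_0,\theta_0$ let $\xi=x+\gamma_1y+\gamma_2t-x_0$, let $\sqrt{P(\rho(\xi))}$ denote $-\rho'(\xi)$, and let \[u=\frac{iR_1R_2}{b}\,\frac{(2K-\lambda-\mu-a+b)\rho(\xi)+(\mu+a-K-G)-i\sqrt{P(\rho(\xi))}}{\sqrt{\rho(\xi)(1-\rho(\xi))}}\,\exp\Big(i\theta_0+i\int_0^\xi Q(\rho(s))\,ds+i\alpha(x-\gamma_1y+\gamma_2t)+i(C_{12}+C_{21})t\Big),\]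 \[v_1=2R_1^2\big((\mu-\lambda)\rho(\xi)+K-\mu\big),\qquad v_2=2R_2^2\big((\lambda-\mu)\rho(\xi)-K+\mu+a\big).\] Consider also, for $\Lambda=\mathrm{diag}(\lambda,\mu)$ and $\Phi_j=(\phi_j,\psi_j)^T:\mathbb R^3\to\mathbb C^2$ ($j=1,2,3$), with $\langle V,W\rangle=V^*W$, the system formed by the constraint $\langle\Phi_1,\Phi_2\rangle=0$, $\langle\Phi_1,\Phi_1\rangle\ne\langle\Phi_2,\Phi_2\rangle$ and the equations \[\Phi_{1,x}=i\Lambda\Phi_1+if\Phi_3,\quad \Phi_{2,x}=i\Lambda\Phi_2+ig\Phi_3,\quad \Phi_{3,x}=i\bar f\Phi_1+i\bar g\Phi_2,\] \[\Phi_{1,y}=i\Lambda\Phi_1+w\Phi_2+if\Phi_3,\quad \Phi_{2,y}=-\bar w\Phi_1-i\Lambda\Phi_2-ig\Phi_3,\quad \Phi_{3,y}=i\bar f\Phi_1-i\bar g\Phi_2,\] \[\Phi_{1,t}=(-2i\Lambda^2+i|w|^2+2i|f|^2)\Phi_1+(-2w\Lambda+iq)\Phi_2+(-2if\Lambda-2f')\Phi_3,\]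 \[\Phi_{2,t}=(2\bar w\Lambda+i\bar q)\Phi_1+(2i\Lambda^2-i|w|^2-2i|g|^2)\Phi_2+(2ig\Lambda-2g')\Phi_3,\] \[\Phi_{3,t}=(-2i\bar f\Lambda+2\bar f')\Phi_1+(2i\bar g\Lambda+2\bar g')\Phi_2-2i(|f|^2-|g|^2)\Phi_3,\] where $\Omega_j=\langle\Phi_j,\Phi_j\rangle$, $f=\langle\Phi_3,\Phi_1\rangle$, $g=\langle\Phi_3,\Phi_2\rangle$, $w=\frac{2i(\langle\Phi_2,\Lambda\Phi_1\rangle+\langle\Phi_2,\Phi_3\rangle\langle\Phi_3,\Phi_1\rangle)}{\Omega_1-\Omega_2}$, $f'=i\langle\Phi_3,\Lambda\Phi_1\rangle+wg+if(\Omega_3-\Omega_1)$, $g'=-i\langle\Phi_3,\Lambda\Phi_2\rangle-\bar wf-ig(\Omega_3-\Omega_2)$ and \[q=\tfrac{2i}{\Omega_1-\Omega_2}\big[2i\langle\Phi_2,\Lambda^2\Phi_1\rangle+2if\langle\Phi_2,\Lambda\Phi_3\rangle+2i\bar g\langle\Phi_3,\Lambda\Phi_1\rangle+if\bar g(2\Omega_3-\Omega_1-\Omega_2)+w(|g|^2-|f|^2)+w(\langle\Phi_2,\Lambda\Phi_2\rangle-\langle\Phi_1,\Lambda\Phi_1\rangle)\big].\]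 Say that $\Phi$ has the integrals $R_j,G,K$ at a point if there $\Omega_j=R_j^2$, $|\phi_1|^2+|\phi_2|^2+|\phi_3|^2-R_2^2=G$ and $(\langle\Phi_1,\Lambda\Phi_1\rangle+\langle\Phi_1,\Phi_3\rangle\langle\Phi_3,\Phi_1\rangle)/R_1^2=K$. (I) If a smooth solution $\Phi$ of this system on $\mathbb R^3$ has the integrals $R_j,G,K$ at the origin, then it has them everywhere, $\max(0,\frac{G-a}b)\le\rho_1$ and $\rho_2\le\min(1,\frac Gb)$, and for some $x_0,\theta_0$ one has $|\phi_1|^2=R_1^2\rho(\xi)$, $w=u$, $2|f|^2=v_1$, $2|g|^2=v_2$. (II) Conversely, suppose $\max(0,\frac{G-a}b)\le\rho_1$ and $\rho_2\le\min(1,\frac Gb)$. Then $0<\rho<1$ and $\rho'^2=P(\rho)$ on $\mathbb R$, and for all $x_0,\theta_0\in\mathbb R$ there is a smooth solution $\Phi$ of the system on $\mathbb R^3$ with the integrals $R_j,G,K$, with $|\phi_1|^2=R_1^2\rho(\xi)$, and with $w=u$, $2|f|^2=v_1$, $2|g|^2=v_2$. The functions $u,v_1,v_2$ have no singularities (they are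 $C^\infty$ on $\mathbb R^3$) and solve the Davey–Stewartson I equation \[-iu_t=u_{xx}+u_{yy}+2|u|^2u+2(v_1+v_2)u,\qquad v_{1,x}-v_{1,y}=v_{2,x}+v_{2,y}=-(|u|^2)_x.\] Moreover, let $T=4\int_0^{\pi/2}(1-k^2\sin^2\theta)^{-1/2}d\theta$ and $A=\frac pT\int_0^{T/p}Q(\rho(s))\,ds$. Then $T$ is the minimal positive period of $\mathrm{sn}$, and: (1) for each $t$, $u$ is a function of $x+\gamma_1y$ and $(A+\alpha)x+(A-\alpha)\gamma_1y$ that has period $T/p$ in the first and $2\pi$ in the second; if $\alpha\ne0$, then $u$ is doubly periodic on the $(x,y)$ plane (it has two linearly independent periods, the same for all $t$); (2) $u$ is periodic in $t$ (there is $\tau>0$ with $u(x,y,t+\tau)=u(x,y,t)$ for all $x,y,t$) if and only if $\gamma_2=0$ or $\dfrac{(C_{12}+C_{21}+A\gamma_2+\alpha\gamma_2)T}{2\pi p\gamma_2}$ is rational; (3) $|u|^2$, $v_1$, $v_2$ are functions of $x+\gamma_1y+\gamma_2t$ only, with period $T/p$; (4) if $(2K-\lambda-\mu-a+b)\big(K_1K_2-\lambda\mu-\lambda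 a+(\lambda-\mu)G\big)\neq(K+G-\mu-a)\,b(\lambda-\mu)$, then $u$ has no zeros and, for all $y,t$, $(\arg u)_x=\mathrm{Im}(u_x/u)$ is not a constant function of $x$. -/

import Mathlib

open scoped ContDiff ComplexConjugate

noncomputable section

/-! ### Jacobi's elliptic sine -/

/-- Incomplete elliptic integral of the first kind with modulus `k`. -/
def ellF (k φ : ℝ) : ℝ := ∫ θ in (0 : ℝ)..φ, 1 / √(1 - k ^ 2 * Real.sin θ ^ 2)

/-- Jacobi amplitude: the inverse of `ellF k`, which is a bijection of `ℝ` for `|k| < 1`. -/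
def jacobiAm (k : ℝ) : ℝ → ℝ := Function.invFun (ellF k)

/-- Jacobi's function `sn` with modulus `k`. -/
def jacobiSn (k x : ℝ) : ℝ := Real.sin (jacobiAm k x)

/-- Four times the complete elliptic integral of the first kind. -/
def snPeriod (k : ℝ) : ℝ := 4 * ellF k (Real.pi / 2)

/-! ### The Davey-Stewartson I equation -/

/-- A smooth complex function `u` and smooth real functions `v₁`, `v₂` of `(x, y, t) ∈ ℝ³`
solve the Davey-Stewartson I equation
`-i u_t = u_xx + u_yy + 2|u|²u + 2(v₁ + v₂)u`, `v₁,x - v₁,y = v₂,x + v₂,y = -(|u|²)_x`. -/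
structure IsDSISolution (u : ℝ → ℝ → ℝ → ℂ) (v₁ v₂ : ℝ → ℝ → ℝ → ℝ) : Prop where
  smooth_u : ContDiff ℝ ∞ (fun w : ℝ × ℝ × ℝ => u w.1 w.2.1 w.2.2)
  smooth_v₁ : ContDiff ℝ ∞ (fun w : ℝ × ℝ × ℝ => v₁ w.1 w.2.1 w.2.2)
  smooth_v₂ : ContDiff ℝ ∞ (fun w : ℝ × ℝ × ℝ => v₂ w.1 w.2.1 w.2.2)
  eq_u : ∀ x y t : ℝ,
    -Complex.I * deriv (fun s => u x y s) t =
      deriv (fun s => deriv (fun r => u r y t) s) x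
        + deriv (fun s => deriv (fun r => u x r t) s) y
        + 2 * (‖u x y t‖ : ℂ) ^ 2 * u x y t
        + 2 * ((v₁ x y t : ℂ) + (v₂ x y t : ℂ)) * u x y t
  eq_v₁ : ∀ x y t : ℝ,
    deriv (fun s => v₁ s y t) x - deriv (fun s => v₁ x s t) y =
      -deriv (fun s => ‖u s y t‖ ^ 2) x
  eq_v₂ : ∀ x y t : ℝ,
    deriv (fun s => v₂ s y t) x + deriv (fun s => v₂ x s t) y =
      -deriv (fun s => ‖u s y t‖ ^ 2) x

/-! ### The finite-dimensional systems

A point of the phase space is `Z = (Φ₁, Φ₂, Φ₃)`, `Φ_j ∈ ℂᴺ`; `Φ_j` is `Z (j - 1)`.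
The eigenvalues are `Λ : Fin N → ℝ`. -/

namespace DSSystem

variable {N : ℕ}

/-- `⟨Φ_i, Λᵐ Φ_j⟩`, conjugate linear in the first slot. -/
def br (Λ : Fin N → ℝ) (Z : Fin 3 → Fin N → ℂ) (i j : Fin 3) (m : ℕ) : ℂ :=
  ∑ k, conj (Z i k) * (Λ k : ℂ) ^ m * Z j k

/-- `f = ⟨Φ₃, Φ₁⟩`. -/
def f (Λ : Fin N → ℝ) (Z : Fin 3 → Fin N → ℂ) : ℂ := br Λ Z 2 0 0

/-- `g = ⟨Φ₃, Φ₂⟩`. -/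
def g (Λ : Fin N → ℝ) (Z : Fin 3 → Fin N → ℂ) : ℂ := br Λ Z 2 1 0

/-- `u = (2i⟨Φ₂, ΛΦ₁⟩ + 2i⟨Φ₂, Φ₃⟩⟨Φ₃, Φ₁⟩) / (⟨Φ₁, Φ₁⟩ - ⟨Φ₂, Φ₂⟩)`. -/
def u (Λ : Fin N → ℝ) (Z : Fin 3 → Fin N → ℂ) : ℂ :=
  (2 * Complex.I * br Λ Z 1 0 1 + 2 * Complex.I * br Λ Z 1 2 0 * br Λ Z 2 0 0)
    / (br Λ Z 0 0 0 - br Λ Z 1 1 0)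

/-- `v₁ = 2|f|²`. -/
def v₁ (Λ : Fin N → ℝ) (Z : Fin 3 → Fin N → ℂ) : ℝ := 2 * ‖f Λ Z‖ ^ 2

/-- `v₂ = 2|g|²`. -/
def v₂ (Λ : Fin N → ℝ) (Z : Fin 3 → Fin N → ℂ) : ℝ := 2 * ‖g Λ Z‖ ^ 2

/-- The expression that replaces `u_y`. -/
def uy (Λ : Fin N → ℝ) (Z : Fin 3 → Fin N → ℂ) : ℂ :=
  2 * Complex.I / (br Λ Z 0 0 0 - br Λ Z 1 1 0) *
    (2 * Complex.I * br Λ Z 1 0 2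
      + 2 * Complex.I * f Λ Z * br Λ Z 1 2 1
      + 2 * Complex.I * conj (g Λ Z) * br Λ Z 2 0 1
      + Complex.I * f Λ Z * conj (g Λ Z) *
          (2 * br Λ Z 2 2 0 - br Λ Z 0 0 0 - br Λ Z 1 1 0)
      + u Λ Z * ((‖g Λ Z‖ : ℂ) ^ 2 - (‖f Λ Z‖ : ℂ) ^ 2)
      + u Λ Z * (br Λ Z 1 1 1 - br Λ Z 0 0 1))

/-- The expression that replaces `f_y`. -/
def fy (Λ : Fin N → ℝ) (Z : Fin 3 → Fin N → ℂ) : ℂ :=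
  Complex.I * br Λ Z 2 0 1 + u Λ Z * g Λ Z
    + Complex.I * f Λ Z * (br Λ Z 2 2 0 - br Λ Z 0 0 0)

/-- The expression that replaces `g_y`. -/
def gy (Λ : Fin N → ℝ) (Z : Fin 3 → Fin N → ℂ) : ℂ :=
  -Complex.I * br Λ Z 2 1 1 - conj (u Λ Z) * f Λ Z
    - Complex.I * g Λ Z * (br Λ Z 2 2 0 - br Λ Z 1 1 0)

/-- Right-hand side of the `x`-system. -/
def fieldX (Λ : Fin N → ℝ) (Z : Fin 3 → Fin N → ℂ) : Fin 3 → Fin N → ℂ :=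
  ![fun k => Complex.I * Λ k * Z 0 k + Complex.I * f Λ Z * Z 2 k,
    fun k => Complex.I * Λ k * Z 1 k + Complex.I * g Λ Z * Z 2 k,
    fun k => Complex.I * conj (f Λ Z) * Z 0 k + Complex.I * conj (g Λ Z) * Z 1 k]

/-- Right-hand side of the `y`-system. -/
def fieldY (Λ : Fin N → ℝ) (Z : Fin 3 → Fin N → ℂ) : Fin 3 → Fin N → ℂ :=
  ![fun k => Complex.I * Λ k * Z 0 k + u Λ Z * Z 1 k + Complex.I * f Λ Z * Z 2 k,
    fun k => -conj (u Λ Z) * Z 0 k - Complex.I * Λ k * Z 1 k - Complex.I * g Λ Z * Z 2 k,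
    fun k => Complex.I * conj (f Λ Z) * Z 0 k - Complex.I * conj (g Λ Z) * Z 1 k]

/-- Right-hand side of the `t`-system. -/
def fieldT (Λ : Fin N → ℝ) (Z : Fin 3 → Fin N → ℂ) : Fin 3 → Fin N → ℂ :=
  ![fun k =>
      (-2 * Complex.I * (Λ k : ℂ) ^ 2 + Complex.I * (‖u Λ Z‖ : ℂ) ^ 2
          + Complex.I * (v₁ Λ Z : ℂ)) * Z 0 k
        + (-2 * u Λ Z * Λ k + Complex.I * uy Λ Z) * Z 1 k
        + (-2 * Complex.I * f Λ Z * Λ k - 2 * fy Λ Z) * Z 2 k,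
    fun k =>
      (2 * conj (u Λ Z) * Λ k + Complex.I * conj (uy Λ Z)) * Z 0 k
        + (2 * Complex.I * (Λ k : ℂ) ^ 2 - Complex.I * (‖u Λ Z‖ : ℂ) ^ 2
          - Complex.I * (v₂ Λ Z : ℂ)) * Z 1 k
        + (2 * Complex.I * g Λ Z * Λ k - 2 * gy Λ Z) * Z 2 k,
    fun k =>
      (-2 * Complex.I * conj (f Λ Z) * Λ k + 2 * conj (fy Λ Z)) * Z 0 k
        + (2 * Complex.I * conj (g Λ Z) * Λ k + 2 * conj (gy Λ Z)) * Z 1 k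
        - 2 * Complex.I * ((‖f Λ Z‖ : ℂ) ^ 2 - (‖g Λ Z‖ : ℂ) ^ 2) * Z 2 k]

/-- `Φ : ℝ³ → ℂ³ᴺ` is a smooth common solution of the `x`-, `y`- and `t`-systems that lies
on the submanifold `⟨Φ₁, Φ₂⟩ = 0`, `⟨Φ₁, Φ₁⟩ ≠ ⟨Φ₂, Φ₂⟩`. -/
structure IsSolution (Λ : Fin N → ℝ) (Φ : ℝ → ℝ → ℝ → Fin 3 → Fin N → ℂ) : Prop where
  smooth : ContDiff ℝ ∞ (fun w : ℝ × ℝ × ℝ => Φ w.1 w.2.1 w.2.2)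
  constraint : ∀ x y t : ℝ, br Λ (Φ x y t) 0 1 0 = 0
  nondegenerate : ∀ x y t : ℝ, br Λ (Φ x y t) 0 0 0 ≠ br Λ (Φ x y t) 1 1 0
  eq_x : ∀ x y t : ℝ, HasDerivAt (fun s => Φ s y t) (fieldX Λ (Φ x y t)) x
  eq_y : ∀ x y t : ℝ, HasDerivAt (fun s => Φ x s t) (fieldY Λ (Φ x y t)) y
  eq_t : ∀ x y t : ℝ, HasDerivAt (fun s => Φ x y s) (fieldT Λ (Φ x y t)) t

end DSSystem

/-! ### The case `N = 2` -/

/-- The constants: the eigenvalues `lam`, `mu`, the values `R₁, R₂, R₃, G, K` of the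
integrals, and `ρ₁, ρ₂, ρ₃` (to be the roots of the cubic `P`). -/
structure DSParam where
  lam : ℝ
  mu : ℝ
  R₁ : ℝ
  R₂ : ℝ
  R₃ : ℝ
  G : ℝ
  K : ℝ
  ρ₁ : ℝ
  ρ₂ : ℝ
  ρ₃ : ℝ

namespace DSParam

variable (c : DSParam)

/-- The two eigenvalues. -/
def eig : Fin 2 → ℝ := ![c.lam, c.mu]

def a : ℝ := c.R₃ ^ 2

def b : ℝ := c.R₁ ^ 2 - c.R₂ ^ 2

/-- At the phase point `Z` the integrals have the values `R_j`, `G`, `K`. -/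
structure IntegralsAt (Z : Fin 3 → Fin 2 → ℂ) : Prop where
  R₁_eq : ‖Z 0 0‖ ^ 2 + ‖Z 0 1‖ ^ 2 = c.R₁ ^ 2
  R₂_eq : ‖Z 1 0‖ ^ 2 + ‖Z 1 1‖ ^ 2 = c.R₂ ^ 2
  R₃_eq : ‖Z 2 0‖ ^ 2 + ‖Z 2 1‖ ^ 2 = c.R₃ ^ 2
  G_eq : ‖Z 0 0‖ ^ 2 + ‖Z 1 0‖ ^ 2 + ‖Z 2 0‖ ^ 2 - c.R₂ ^ 2 = c.G
  K_eq : (DSSystem.br c.eig Z 0 0 1 + DSSystem.br c.eig Z 0 2 0 * DSSystem.br c.eig Z 2 0 0)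
      / (c.R₁ : ℂ) ^ 2 = c.K

/-- The cubic polynomial `P`. -/
def P (r : ℝ) : ℝ :=
  4 * c.b * (c.lam - c.mu) * r ^ 3
    + (4 * (c.mu - c.lam) * c.G + 4 * c.b * (c.mu - c.K)
        - (c.lam - c.mu + c.b - c.a) ^ 2) * r ^ 2
    + (4 * (c.K - c.mu) * c.G
        + 2 * (c.lam - c.mu + c.b - c.a) * (c.K + c.G - c.mu - c.a)) * r
    - (c.K + c.G - c.mu - c.a) ^ 2

/-- The conditions on the constants. -/
structure Admissible : Prop where
  R₁_pos : 0 < c.R₁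
  R₂_pos : 0 < c.R₂
  R₃_pos : 0 < c.R₃
  b_pos : 0 < c.b
  mu_lt_lam : c.mu < c.lam
  ρ₁_lt_ρ₂ : c.ρ₁ < c.ρ₂
  ρ₂_lt_ρ₃ : c.ρ₂ < c.ρ₃
  P_ρ₁ : c.P c.ρ₁ = 0
  P_ρ₂ : c.P c.ρ₂ = 0
  P_ρ₃ : c.P c.ρ₃ = 0
  cond_zero : c.K + c.G - c.mu - c.a ≠ 0
  cond_one : c.K - c.G - c.lam + c.b ≠ 0
  cond_range : max 0 ((c.G - c.a) / c.b) < min 1 (c.G / c.b)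

/-- The roots `ρ₁ < ρ₂` lie in the range of values that `|φ₁|² / R₁²` can take. -/
def RootsInRange : Prop :=
  max 0 ((c.G - c.a) / c.b) ≤ c.ρ₁ ∧ c.ρ₂ ≤ min 1 (c.G / c.b)

/-- The modulus `k`. -/
def k : ℝ := √((c.ρ₂ - c.ρ₁) / (c.ρ₃ - c.ρ₁))

def p : ℝ := √(c.b * (c.lam - c.mu) * (c.ρ₃ - c.ρ₁))

/-- `ρ(ξ) = ρ₁ + (ρ₂ - ρ₁) sn²(pξ)`. -/
def rho (ξ : ℝ) : ℝ := c.ρ₁ + (c.ρ₂ - c.ρ₁) * jacobiSn c.k (c.p * ξ) ^ 2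

/-- The smooth branch of `√P(ρ(ξ))` that is determined by `ρ_ξ = -√P(ρ)`. -/
def sqrtP (ξ : ℝ) : ℝ := -deriv c.rho ξ

def γ₁ : ℝ := (c.R₁ ^ 2 + c.R₂ ^ 2) / (c.R₁ ^ 2 - c.R₂ ^ 2)

def γ₂ : ℝ :=
  2 * (c.R₁ ^ 4 + c.R₂ ^ 4 - (c.R₁ ^ 2 + c.R₂ ^ 2) * (c.R₃ ^ 2 + c.lam + c.mu))
      / (c.R₁ ^ 2 - c.R₂ ^ 2)
    - 4 * c.R₁ ^ 2 * c.R₂ ^ 2 * (c.R₃ ^ 2 + c.lam + c.mu - 2 * c.K)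
      / (c.R₁ ^ 2 - c.R₂ ^ 2) ^ 2

/-- `K₂`, the companion of `K₁ = K`. -/
def K₂ : ℝ := c.R₃ ^ 2 + c.lam + c.mu - c.K

/-- The common form of `C₁₂` (`Ri = R₁`, `Rj = R₂`, `Ki = K`) and `C₂₁`
(`Ri = R₂`, `Rj = R₁`, `Ki = K₂`). -/
def Caux (Ri Rj Ki : ℝ) : ℝ :=
  2 / (c.R₁ ^ 2 - c.R₂ ^ 2) ^ 2 *
    ((Rj ^ 4 + 2 * Ri ^ 2 * Rj ^ 2 - Ri ^ 4) *
        ((c.lam - c.mu) * (c.G - (c.R₁ ^ 2 - c.R₂ ^ 2) / 2)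
          + (Ri ^ 2 - Rj ^ 2) * ((c.lam + c.mu) / 2 - Ki)
          - c.lam * c.mu - c.lam * c.R₃ ^ 2)
      + 4 * c.R₁ ^ 2 * c.R₂ ^ 2 * c.K * (c.R₃ ^ 2 + c.lam + c.mu - c.K)
      - c.lam * (Ri ^ 2 - Rj ^ 2) * (c.R₁ ^ 4 + c.R₂ ^ 4)
      - 2 * Rj ^ 4 * Ki ^ 2)

def C₁₂ : ℝ := c.Caux c.R₁ c.R₂ c.K

def C₂₁ : ℝ := c.Caux c.R₂ c.R₁ c.K₂

def α : ℝ :=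
  (c.R₂ ^ 2 * c.K - c.R₁ ^ 2 * (c.R₃ ^ 2 + c.lam + c.mu - c.K)) / (c.R₁ ^ 2 + c.R₂ ^ 2)

def Q (r : ℝ) : ℝ :=
  (2 * c.b * r ^ 2 + (c.mu - c.lam + c.a - c.b - 2 * c.G) * r
      + (c.K + c.G - c.mu - c.a)) / (2 * r * (1 - r)) - c.α

/-- `ξ = x + γ₁ y + γ₂ t - x₀`. -/
def xi (x₀ x y t : ℝ) : ℝ := x + c.γ₁ * y + c.γ₂ * t - x₀

/-- The explicit `u`. The real number `θ₀` is the constant of integration of `∫ Q(ρ(ξ)) dξ`;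
it also covers a choice of sign in front of `u`. -/
def uSol (x₀ θ₀ x y t : ℝ) : ℂ :=
  let ξ := c.xi x₀ x y t
  Complex.I * c.R₁ * c.R₂ / ((c.R₁ : ℂ) ^ 2 - (c.R₂ : ℂ) ^ 2)
    * (1 / (√(c.rho ξ * (1 - c.rho ξ)) : ℂ))
    * ((((2 * c.K - c.lam - c.mu - c.a + c.b) * c.rho ξ
          + (c.mu + c.a - c.K - c.G) : ℝ) : ℂ) - Complex.I * (c.sqrtP ξ : ℂ))
    * Complex.exp (Complex.I *
        ((θ₀ + (∫ s in (0 : ℝ)..ξ, c.Q (c.rho s)) + c.α * (x - c.γ₁ * y + c.γ₂ * t)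
          + (c.C₁₂ + c.C₂₁) * t : ℝ) : ℂ))

def v₁Sol (x₀ x y t : ℝ) : ℝ :=
  2 * c.R₁ ^ 2 * ((c.mu - c.lam) * c.rho (c.xi x₀ x y t) + c.K - c.mu)

def v₂Sol (x₀ x y t : ℝ) : ℝ :=
  2 * c.R₂ ^ 2 * ((c.lam - c.mu) * c.rho (c.xi x₀ x y t) - c.K + c.mu + c.a)

/-- The minimal positive period `T(k)` of `sn`. -/
def T : ℝ := snPeriod c.k

/-- The mean value of `Q ∘ ρ` over `[0, T(k)/p]`. -/
def A : ℝ := c.p / c.T * ∫ s in (0 : ℝ)..(c.T / c.p), c.Q (c.rho s)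

/-- `|u|² = 4R₁²R₂²/b² · (E - b(λ - μ)ρ)`. -/
def E : ℝ :=
  c.K * (c.a + c.lam + c.mu - c.K) - c.lam * c.mu - c.lam * c.a + (c.lam - c.mu) * c.G

/-- `Φ` is a solution of the systems for `N = 2`, its integrals have the prescribed values,
`|φ₁|² = R₁² ρ(ξ)`, and the solution `(u, v₁, v₂)` of the DSI equation that belongs to it is
the explicit one. -/
structure IsExplicit (Φ : ℝ → ℝ → ℝ → Fin 3 → Fin 2 → ℂ) (x₀ θ₀ : ℝ) : Prop where
  integrals : ∀ x y t : ℝ, c.IntegralsAt (Φ x y t)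
  rho_eq : ∀ x y t : ℝ, ‖Φ x y t 0 0‖ ^ 2 = c.R₁ ^ 2 * c.rho (c.xi x₀ x y t)
  u_eq : ∀ x y t : ℝ, DSSystem.u c.eig (Φ x y t) = c.uSol x₀ θ₀ x y t
  v₁_eq : ∀ x y t : ℝ, DSSystem.v₁ c.eig (Φ x y t) = c.v₁Sol x₀ x y t
  v₂_eq : ∀ x y t : ℝ, DSSystem.v₂ c.eig (Φ x y t) = c.v₂Sol x₀ x y t

end DSParam

end

/-! Let `M = Λ + Φ₃Φ₃*`, a Hermitian 2×2 matrix. The `x`-system says `Φ₁' = iMΦ₁`, `Φ₂' = iMΦ₂`,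
together with an equation for `Φ₃`. On the constraint manifold `Φ₁, Φ₂` is an orthogonal basis of
`ℂ²`. In the corresponding orthonormal basis `M` has the diagonal entries `K` and `K₂` (their sum is
the trace `λ + μ + a`), and its off-diagonal entry is `u` up to a constant. Eliminating `Λ` and `Φ₃`
through this basis shows that the `y`- and `t`-fields are the constants `γ₁`, `γ₂` times the
`x`-field plus infinitesimal phase rotations with constant rates (`OnLevel.fieldY_eq`,
`OnLevel.fieldT_eq`). So up to phases linear in `y` and `t` a solution depends on `ξ` alone.

All squared moduli are affine in `ρ = |φ₁|²/R₁²`. The determinant of `M` gives `|u|²`, its top-left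
entry gives the imaginary part of `u` times the conjugate of `φ₁φ̄₂`, and the real part is `ρ'` up
to a constant; comparing moduli yields `ρ'² = P(ρ)` (`OnLevel.sigAt_sq`). The signs of `P` at the
ends of the possible range of `ρ` confine `ρ` to `[ρ₁, ρ₂]` (`rootsInRange_of_nonneg`), and
uniqueness for the second-order equation identifies it with the elliptic function (`eq_rho_of_ode`).
The product `φ₁φ̄₂` has modulus `R₁R₂√(ρ(1-ρ))`, and its phase is found by integrating its
logarithmic derivative, which is where `Q` comes from; dividing then gives `u`
(`isExplicit_of_initial`).

Conversely, the norms `⟨Φ_j, Φ_j⟩` are conserved, so the `x`-system has global solutions. One that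
starts at a point with `ρ = ρ₁`, composed with `ξ` and rotated by linear phases, solves all three
systems (`isSolution_rotate`).

Along a solution `u` and `φ₁φ̄₂` obey a closed linear system with coefficients depending on `ρ`, so
the DSI equation reduces to three identities between constants. The periodicity claims follow by
splitting `∫Q` into its mean `Aξ` and a periodic part, and claim (4) from `|u|²` and `(arg u)_x`
being rational functions of `ρ` of degree at most one. -/

open scoped ContDiff ComplexConjugate

noncomputable section

/-! ### Jacobi's elliptic sine: derivative, zeros and period. -/

section Jacobi

variable {k : ℝ}

lemma one_sub_sq_mul_sin_sq_pos (hk : k ^ 2 < 1) (θ : ℝ) : 0 < 1 - k ^ 2 * Real.sin θ ^ 2 := by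
  nlinarith [Real.sin_sq_le_one θ, sq_nonneg (Real.sin θ), sq_nonneg k]

lemma continuous_ellF_integrand (hk : k ^ 2 < 1) :
    Continuous fun θ : ℝ => 1 / √(1 - k ^ 2 * Real.sin θ ^ 2) := by
  refine continuous_const.div (by fun_prop) fun θ => ?_
  exact (Real.sqrt_pos.2 (one_sub_sq_mul_sin_sq_pos hk θ)).ne'

lemma one_le_ellF_integrand (hk : k ^ 2 < 1) (θ : ℝ) :
    1 ≤ 1 / √(1 - k ^ 2 * Real.sin θ ^ 2) := by
  have h := Real.sqrt_pos.2 (one_sub_sq_mul_sin_sq_pos hk θ)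
  rw [le_div_iff₀ h, one_mul, Real.sqrt_le_iff]
  refine ⟨zero_le_one, ?_⟩
  nlinarith [mul_nonneg (sq_nonneg k) (sq_nonneg (Real.sin θ))]

lemma hasDerivAt_ellF (hk : k ^ 2 < 1) (φ : ℝ) :
    HasDerivAt (ellF k) (1 / √(1 - k ^ 2 * Real.sin φ ^ 2)) φ :=
  (continuous_ellF_integrand hk).integral_hasStrictDerivAt 0 φ |>.hasDerivAt

@[simp] lemma ellF_zero : ellF k 0 = 0 := by simp [ellF]

/-- The integrand is at least 1. This one comparison with the identity gives both strict
monotonicity and unboundedness in both directions, hence bijectivity. -/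
lemma monotone_ellF_sub_id (hk : k ^ 2 < 1) : Monotone fun φ => ellF k φ - φ := by
  refine monotone_of_hasDerivAt_nonneg (fun φ => (hasDerivAt_ellF hk φ).sub (hasDerivAt_id φ)) ?_
  intro φ
  have := one_le_ellF_integrand hk φ
  simp only [Pi.zero_apply]; linarith

lemma strictMono_ellF (hk : k ^ 2 < 1) : StrictMono (ellF k) := by
  intro x y hxy
  have := monotone_ellF_sub_id hk hxy.le
  simp only at this
  linarith

lemma surjective_ellF (hk : k ^ 2 < 1) : Function.Surjective (ellF k) := by
  have hc : Continuous (ellF k) :=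
    continuous_iff_continuousAt.2 fun φ => (hasDerivAt_ellF hk φ).continuousAt
  refine hc.surjective ?_ ?_
  · refine Filter.tendsto_atTop_mono' _ ?_ Filter.tendsto_id
    filter_upwards [Filter.eventually_ge_atTop 0] with x hx
    have := monotone_ellF_sub_id hk hx
    simp only [ellF_zero] at this
    simp only [id]; linarith
  · refine Filter.tendsto_atBot_mono' _ ?_ Filter.tendsto_id
    filter_upwards [Filter.eventually_le_atBot 0] with x hx
    have := monotone_ellF_sub_id hk hx
    simp only [ellF_zero] at this
    simp only [id]; linarith

lemma ellF_jacobiAm (hk : k ^ 2 < 1) (x : ℝ) : ellF k (jacobiAm k x) = x :=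
  Function.rightInverse_invFun (surjective_ellF hk) x

lemma jacobiAm_ellF (hk : k ^ 2 < 1) (φ : ℝ) : jacobiAm k (ellF k φ) = φ :=
  Function.leftInverse_invFun (strictMono_ellF hk).injective φ

/-- The inverse function rule in one variable only asks for continuity of the inverse, and a
monotone surjection of the line is continuous. -/
lemma hasDerivAt_jacobiAm (hk : k ^ 2 < 1) (x : ℝ) :
    HasDerivAt (jacobiAm k) (√(1 - k ^ 2 * jacobiSn k x ^ 2)) x := by
  have hm : StrictMono (jacobiAm k) := fun x y h => by
    rw [← (strictMono_ellF hk).lt_iff_lt, ellF_jacobiAm hk, ellF_jacobiAm hk]; exact h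
  have hc : Continuous (jacobiAm k) :=
    hm.monotone.continuous_of_surjective fun φ => ⟨ellF k φ, jacobiAm_ellF hk φ⟩
  have h := (hasDerivAt_ellF hk (jacobiAm k x)).of_local_left_inverse hc.continuousAt
    (one_div_ne_zero (Real.sqrt_pos.2 (one_sub_sq_mul_sin_sq_pos hk _)).ne')
    (Filter.Eventually.of_forall (ellF_jacobiAm hk))
  simpa [jacobiSn] using h

lemma hasDerivAt_jacobiSn (hk : k ^ 2 < 1) (x : ℝ) :
    HasDerivAt (jacobiSn k)
      (Real.cos (jacobiAm k x) * √(1 - k ^ 2 * jacobiSn k x ^ 2)) x :=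
  (hasDerivAt_jacobiAm hk x).sin

lemma jacobiAm_zero (hk : k ^ 2 < 1) : jacobiAm k 0 = 0 := by
  simpa using jacobiAm_ellF hk 0

/-- The integrand is symmetric under `θ ↦ π - θ`. -/
lemma ellF_pi (hk : k ^ 2 < 1) : ellF k Real.pi = 2 * ellF k (Real.pi / 2) := by
  have h1 := intervalIntegral.integral_comp_sub_left (a := Real.pi / 2) (b := Real.pi)
    (fun θ : ℝ => 1 / √(1 - k ^ 2 * Real.sin θ ^ 2)) Real.pi
  simp only [Real.sin_pi_sub, sub_self] at h1
  have h2 : Real.pi - Real.pi / 2 = Real.pi / 2 := by ring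
  rw [h2] at h1
  have hi := fun a b => (continuous_ellF_integrand hk).intervalIntegrable (μ := MeasureTheory.volume) a b
  have h3 := intervalIntegral.integral_add_adjacent_intervals (hi 0 (Real.pi / 2))
    (hi (Real.pi / 2) Real.pi)
  rw [h1] at h3
  rw [ellF, ellF, ← h3]; ring

lemma ellF_add_pi (hk : k ^ 2 < 1) (φ : ℝ) :
    ellF k (φ + Real.pi) = ellF k φ + snPeriod k / 2 := by
  have hp : Function.Periodic (fun θ : ℝ => 1 / √(1 - k ^ 2 * Real.sin θ ^ 2)) Real.pi := by
    intro θ; simp [Real.sin_add_pi]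
  have h := hp.intervalIntegral_add_eq φ 0
  have hi := fun a b => (continuous_ellF_integrand hk).intervalIntegrable (μ := MeasureTheory.volume) a b
  rw [ellF, ← intervalIntegral.integral_add_adjacent_intervals (hi 0 φ) (hi φ (φ + Real.pi)), h,
    zero_add]
  change ellF k φ + ellF k Real.pi = _
  rw [ellF_pi hk, snPeriod]; ring

lemma snPeriod_pos (hk : k ^ 2 < 1) : 0 < snPeriod k := by
  have := strictMono_ellF hk (show (0 : ℝ) < Real.pi / 2 by positivity)
  rw [ellF_zero] at this
  rw [snPeriod]; positivity

lemma jacobiAm_add_half_snPeriod (hk : k ^ 2 < 1) (x : ℝ) :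
    jacobiAm k (x + snPeriod k / 2) = jacobiAm k x + Real.pi := by
  rw [← jacobiAm_ellF hk (jacobiAm k x + Real.pi), ellF_add_pi hk, ellF_jacobiAm hk]

lemma jacobiSn_add_half_snPeriod (hk : k ^ 2 < 1) : Function.Antiperiodic (jacobiSn k) (snPeriod k / 2) := by
  intro x
  rw [jacobiSn, jacobiAm_add_half_snPeriod hk, Real.sin_add_pi, jacobiSn]

lemma ellF_int_mul_pi (hk : k ^ 2 < 1) (n : ℤ) : ellF k (n * Real.pi) = n * (snPeriod k / 2) := by
  induction n using Int.induction_on with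
  | zero => simp
  | succ i ih => push_cast at ih ⊢; rw [add_mul, one_mul, ellF_add_pi hk, ih]; ring
  | pred i ih =>
    have := ellF_add_pi hk ((-(i : ℝ) - 1) * Real.pi)
    push_cast at ih ⊢
    rw [show (-(i : ℝ) - 1) * Real.pi + Real.pi = -(i : ℝ) * Real.pi by ring, ih] at this
    linarith

lemma exists_int_of_jacobiSn_eq_zero (hk : k ^ 2 < 1) {x : ℝ} (h : jacobiSn k x = 0) :
    ∃ n : ℤ, x = n * (snPeriod k / 2) := by
  obtain ⟨n, hn⟩ := Real.sin_eq_zero_iff.1 h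
  exact ⟨n, by rw [← ellF_int_mul_pi hk, hn, ellF_jacobiAm hk]⟩

lemma jacobiSn_zero (hk : k ^ 2 < 1) : jacobiSn k 0 = 0 := by
  rw [jacobiSn, jacobiAm_zero hk, Real.sin_zero]

/-- `4 K(k)` is the minimal positive period of `sn`. -/
lemma isLeast_snPeriod (hk : k ^ 2 < 1) :
    IsLeast {τ : ℝ | 0 < τ ∧ Function.Periodic (jacobiSn k) τ} (snPeriod k) := by
  have hT := snPeriod_pos hk
  refine ⟨⟨hT, ?_⟩, ?_⟩
  · have := (jacobiSn_add_half_snPeriod hk).periodic_two_mul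
    rwa [mul_div_cancel₀ _ (two_ne_zero)] at this
  · rintro τ ⟨hτ, hp⟩
    -- A period is a zero of `sn`, because `sn 0 = 0`; the zeros are the multiples of half of
    -- `snPeriod k`.
    obtain ⟨n, rfl⟩ := exists_int_of_jacobiSn_eq_zero hk (by simpa [jacobiSn_zero hk] using hp 0)
    have hn : 0 < n := by
      have : (0 : ℝ) < n := by
        by_contra h
        have := mul_nonpos_of_nonpos_of_nonneg (not_lt.1 h) (half_pos hT).le
        linarith
      exact_mod_cast this
    -- Half of `snPeriod k` is an antiperiod, which is refuted as a period where `sn` takes the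
    -- value 1.
    have hn1 : n ≠ 1 := by
      rintro rfl
      have h1 := hp (ellF k (Real.pi / 2))
      rw [Int.cast_one, one_mul, jacobiSn_add_half_snPeriod hk, jacobiSn, jacobiAm_ellF hk,
        Real.sin_pi_div_two] at h1
      norm_num at h1
    have : (2 : ℝ) ≤ n := by exact_mod_cast (by omega : (2 : ℤ) ≤ n)
    nlinarith

end Jacobi

/-! ### The cubic `P`, its roots, and the elliptic function `ρ`. -/

lemma cubic_eq_mul_of_roots {A B C D x y z : ℝ} (hxy : x ≠ y) (hyz : y ≠ z) (hxz : x ≠ z)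
    (hx : A * x ^ 3 + B * x ^ 2 + C * x + D = 0) (hy : A * y ^ 3 + B * y ^ 2 + C * y + D = 0)
    (hz : A * z ^ 3 + B * z ^ 2 + C * z + D = 0) (r : ℝ) :
    A * r ^ 3 + B * r ^ 2 + C * r + D = A * (r - x) * (r - y) * (r - z) := by
  -- Newton interpolation: `h1` and `h2` are first divided differences of the cubic at pairs of
  -- roots, `h3` is the second one. The leading coefficient may vanish.
  have h1 : A * (x ^ 2 + x * y + y ^ 2) + B * (x + y) + C = 0 :=
    mul_left_cancel₀ (sub_ne_zero.2 hxy) (by linear_combination hx - hy)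
  have h2 : A * (x ^ 2 + x * z + z ^ 2) + B * (x + z) + C = 0 :=
    mul_left_cancel₀ (sub_ne_zero.2 hxz) (by linear_combination hx - hz)
  have h3 : A * (x + y + z) + B = 0 :=
    mul_left_cancel₀ (sub_ne_zero.2 hyz) (by linear_combination h1 - h2)
  linear_combination (r ^ 2 - (x + y) * r + x * y) * h3 + (r - x) * h1 + hx

namespace DSParam

/-- The linear function `Y` of `ρ` whose value is the real part of the factor
`Y(ρ) - i√P(ρ)` of `u`. -/
def Y (c : DSParam) (r : ℝ) : ℝ :=
  (2 * c.K - c.lam - c.mu - c.a + c.b) * r + (c.mu + c.a - c.K - c.G)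

/-- The numerator of `Q + α`. -/
def S (c : DSParam) (r : ℝ) : ℝ :=
  2 * c.b * r ^ 2 + (c.mu - c.lam + c.a - c.b - 2 * c.G) * r + (c.K + c.G - c.mu - c.a)

/-- Half the derivative of `P`. -/
def halfDerivP (c : DSParam) (r : ℝ) : ℝ :=
  2 * (1 - 2 * r) * (c.E - c.b * (c.lam - c.mu) * r)
    - 2 * c.b * (c.lam - c.mu) * (r * (1 - r))
    - (2 * c.K - c.lam - c.mu - c.a + c.b) * c.Y r

/-- `ρ'(ξ)`, written with Jacobi's functions. -/
def rhoD (c : DSParam) (ξ : ℝ) : ℝ :=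
  2 * c.p * (c.ρ₂ - c.ρ₁) * (jacobiSn c.k (c.p * ξ) * Real.cos (jacobiAm c.k (c.p * ξ))
    * √(1 - c.k ^ 2 * jacobiSn c.k (c.p * ξ) ^ 2))

lemma P_eq_sub_Y_sq (c : DSParam) (r : ℝ) :
    c.P r = 4 * (r * (1 - r)) * (c.E - c.b * (c.lam - c.mu) * r) - c.Y r ^ 2 := by
  simp only [P, E, Y]; ring

/-- On a level set the four factors are `|φ₁|²/R₁²`, `|ψ₁|²/R₁²`, `|φ₃|²` and `|ψ₃|²`, and `S` is
the cross term in `|⟨Φ₃, Φ₁⟩|²/R₁²`. This form shows that `P = -S²` wherever one of the factors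
vanishes. -/
lemma P_eq_sub_S_sq (c : DSParam) (r : ℝ) :
    c.P r = 4 * (r * (1 - r)) * ((c.G - c.b * r) * (c.a - c.G + c.b * r)) - c.S r ^ 2 := by
  simp only [P, S]; ring

namespace Admissible

variable {c : DSParam} (hc : c.Admissible)
include hc

lemma R₁_sq_pos : 0 < c.R₁ ^ 2 := pow_pos hc.R₁_pos 2
lemma R₂_sq_pos : 0 < c.R₂ ^ 2 := pow_pos hc.R₂_pos 2
lemma a_pos : 0 < c.a := pow_pos hc.R₃_pos 2
lemma lam_sub_mu_pos : 0 < c.lam - c.mu := sub_pos.2 hc.mu_lt_lam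

lemma P_eq_mul (r : ℝ) :
    c.P r = 4 * c.b * (c.lam - c.mu) * (r - c.ρ₁) * (r - c.ρ₂) * (r - c.ρ₃) :=
  cubic_eq_mul_of_roots hc.ρ₁_lt_ρ₂.ne hc.ρ₂_lt_ρ₃.ne (hc.ρ₁_lt_ρ₂.trans hc.ρ₂_lt_ρ₃).ne
    hc.P_ρ₁ hc.P_ρ₂ hc.P_ρ₃ r

/-- Both sides are `P'/2`, once from the `Y`-form of `P` and once from its factorisation; comparing
derivatives avoids comparing coefficients with the roots. -/
lemma halfDerivP_eq (r : ℝ) :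
    c.halfDerivP r = 2 * c.b * (c.lam - c.mu) * ((r - c.ρ₂) * (r - c.ρ₃)
      + (r - c.ρ₁) * (r - c.ρ₃) + (r - c.ρ₁) * (r - c.ρ₂)) := by
  have h1 : HasDerivAt c.P (2 * c.halfDerivP r) r := by
    have : c.P = fun r => 4 * (r * (1 - r)) * (c.E - c.b * (c.lam - c.mu) * r) - c.Y r ^ 2 :=
      funext c.P_eq_sub_Y_sq
    rw [this]
    simp only [Y, halfDerivP]
    have hid := hasDerivAt_id r
    refine ((((hid.mul (hid.const_sub 1)).const_mul 4).mul
      ((hid.const_mul (c.b * (c.lam - c.mu))).const_sub c.E)).sub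
      (((hid.const_mul (2 * c.K - c.lam - c.mu - c.a + c.b)).add_const
        (c.mu + c.a - c.K - c.G)).pow 2)).congr_deriv ?_
    simp only [id, Pi.mul_apply]; push_cast; ring
  have h2 : HasDerivAt c.P (4 * c.b * (c.lam - c.mu) * ((r - c.ρ₂) * (r - c.ρ₃)
      + (r - c.ρ₁) * (r - c.ρ₃) + (r - c.ρ₁) * (r - c.ρ₂))) r := by
    rw [funext hc.P_eq_mul]
    have hid := hasDerivAt_id r
    refine ((((hid.sub_const c.ρ₁).const_mul (4 * c.b * (c.lam - c.mu))).mul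
      (hid.sub_const c.ρ₂)).mul (hid.sub_const c.ρ₃)).congr_deriv ?_
    simp only [id, Pi.mul_apply]; ring
  linarith [h1.unique h2]

lemma ρ₃_sub_ρ₁_pos : 0 < c.ρ₃ - c.ρ₁ := sub_pos.2 (hc.ρ₁_lt_ρ₂.trans hc.ρ₂_lt_ρ₃)

lemma p_pos : 0 < c.p :=
  Real.sqrt_pos.2 (mul_pos (mul_pos hc.b_pos hc.lam_sub_mu_pos) hc.ρ₃_sub_ρ₁_pos)

lemma p_sq : c.p ^ 2 = c.b * (c.lam - c.mu) * (c.ρ₃ - c.ρ₁) :=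
  Real.sq_sqrt (mul_pos (mul_pos hc.b_pos hc.lam_sub_mu_pos) hc.ρ₃_sub_ρ₁_pos).le

lemma k_sq : c.k ^ 2 = (c.ρ₂ - c.ρ₁) / (c.ρ₃ - c.ρ₁) :=
  Real.sq_sqrt (div_pos (sub_pos.2 hc.ρ₁_lt_ρ₂) hc.ρ₃_sub_ρ₁_pos).le

lemma k_sq_mul : c.k ^ 2 * (c.ρ₃ - c.ρ₁) = c.ρ₂ - c.ρ₁ := by
  rw [hc.k_sq, div_mul_cancel₀ _ hc.ρ₃_sub_ρ₁_pos.ne']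

lemma k_sq_lt_one : c.k ^ 2 < 1 := by
  rw [hc.k_sq, div_lt_one hc.ρ₃_sub_ρ₁_pos]; linarith [hc.ρ₂_lt_ρ₃]

lemma T_pos : 0 < c.T := snPeriod_pos hc.k_sq_lt_one

lemma hasDerivAt_rho (ξ : ℝ) : HasDerivAt c.rho (c.rhoD ξ) ξ := by
  have h1 : HasDerivAt (fun ξ : ℝ => c.p * ξ) c.p ξ := by
    simpa using (hasDerivAt_id ξ).const_mul c.p
  have h2 := (hasDerivAt_jacobiSn hc.k_sq_lt_one (c.p * ξ)).comp ξ h1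
  refine (((h2.pow 2).const_mul (c.ρ₂ - c.ρ₁)).const_add c.ρ₁).congr_deriv ?_
  simp only [rhoD, Function.comp]; push_cast; ring

lemma sqrtP_eq (ξ : ℝ) : c.sqrtP ξ = -c.rhoD ξ := by
  rw [sqrtP, (hc.hasDerivAt_rho ξ).deriv]

/-- With `s = sn(pξ)` one has `ρ - ρ₁ = (ρ₂ - ρ₁)s²`, `ρ₂ - ρ = (ρ₂ - ρ₁)(1 - s²)` and `ρ₃ - ρ = (ρ₃
- ρ₁)(1 - k²s²)`; the choices of `k` and `p` make the product match. -/
lemma rhoD_sq (ξ : ℝ) : c.rhoD ξ ^ 2 = c.P (c.rho ξ) := by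
  rw [hc.P_eq_mul]
  have hd := Real.sq_sqrt (one_sub_sq_mul_sin_sq_pos hc.k_sq_lt_one (jacobiAm c.k (c.p * ξ))).le
  have hcs := Real.sin_sq_add_cos_sq (jacobiAm c.k (c.p * ξ))
  have hp := hc.p_sq
  have hk := hc.k_sq_mul
  simp only [rhoD, rho, jacobiSn]
  set s := Real.sin (jacobiAm c.k (c.p * ξ))
  set q := Real.cos (jacobiAm c.k (c.p * ξ))
  set d := √(1 - c.k ^ 2 * s ^ 2)
  have hq : q ^ 2 = 1 - s ^ 2 := by linarith
  calc (2 * c.p * (c.ρ₂ - c.ρ₁) * (s * q * d)) ^ 2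
      = 4 * c.p ^ 2 * (c.ρ₂ - c.ρ₁) ^ 2 * (s ^ 2 * q ^ 2 * d ^ 2) := by ring
    _ = _ := by
      rw [hd, hq, hp]
      linear_combination
        (-4 * c.b * (c.lam - c.mu) * (c.ρ₂ - c.ρ₁) ^ 2 * s ^ 2 * (1 - s ^ 2) * s ^ 2) * hk

/-- The first-order equation `ρ'² = P(ρ)` does not determine `ρ` at the turning points, where
constants solve it too. The pair `(ρ, ρ')` satisfies a polynomial system, to which uniqueness
applies. -/
lemma hasDerivAt_rhoD (ξ : ℝ) : HasDerivAt c.rhoD (c.halfDerivP (c.rho ξ)) ξ := by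
  rw [hc.halfDerivP_eq]
  have h1 : HasDerivAt (fun ξ : ℝ => c.p * ξ) c.p ξ := by
    simpa using (hasDerivAt_id ξ).const_mul c.p
  have hpos := one_sub_sq_mul_sin_sq_pos hc.k_sq_lt_one (jacobiAm c.k (c.p * ξ))
  have h2 := (hasDerivAt_jacobiSn hc.k_sq_lt_one (c.p * ξ)).comp ξ h1
  have h3 := ((hasDerivAt_jacobiAm hc.k_sq_lt_one (c.p * ξ)).comp ξ h1).cos
  have h4 := (((h2.pow 2).const_mul (c.k ^ 2)).const_sub 1).sqrt hpos.ne'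
  have hd := Real.sq_sqrt hpos.le
  have hd0 := (Real.sqrt_pos.2 hpos).ne'
  have hcs := Real.sin_sq_add_cos_sq (jacobiAm c.k (c.p * ξ))
  have hp := hc.p_sq
  have hk := hc.k_sq_mul
  refine (((h2.mul h3).mul h4).const_mul (2 * c.p * (c.ρ₂ - c.ρ₁))).congr_deriv ?_
  simp only [rho, jacobiSn, Function.comp, Pi.mul_apply, Pi.pow_apply]
  set s := Real.sin (jacobiAm c.k (c.p * ξ))
  set q := Real.cos (jacobiAm c.k (c.p * ξ))
  set d := √(1 - c.k ^ 2 * s ^ 2)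
  have hq : q ^ 2 = 1 - s ^ 2 := by linarith
  have e : 2 * c.p * (c.ρ₂ - c.ρ₁) *
      ((q * d * c.p * q + s * (-s * (d * c.p))) * d
        + s * q * (-(c.k ^ 2 * (2 * s ^ (2 - 1) * (q * d * c.p))) / (2 * d)))
      = 2 * c.p ^ 2 * (c.ρ₂ - c.ρ₁) * (q ^ 2 * d ^ 2 - s ^ 2 * d ^ 2 - c.k ^ 2 * s ^ 2 * q ^ 2) := by
    field_simp
    ring
  push_cast
  rw [e, hd, hq, hp]
  linear_combination (-(2 * c.b * (c.lam - c.mu) * (c.ρ₂ - c.ρ₁) * s ^ 2 * (2 - 3 * s ^ 2))) * hk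

lemma rho_mem_Icc (ξ : ℝ) : c.rho ξ ∈ Set.Icc c.ρ₁ c.ρ₂ := by
  have h1 := Real.sin_sq_le_one (jacobiAm c.k (c.p * ξ))
  have h2 := sq_nonneg (Real.sin (jacobiAm c.k (c.p * ξ)))
  have := hc.ρ₁_lt_ρ₂
  simp only [rho, jacobiSn]
  constructor <;> nlinarith

/-- Squaring removes the sign of the antiperiodic `sn`, so `ρ` has half the period of `sn(pξ)`. This
is why periods of `ρ` are only controlled after doubling. -/
lemma rho_add_half_period (ξ : ℝ) : c.rho (ξ + c.T / c.p / 2) = c.rho ξ := by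
  have hp := hc.p_pos.ne'
  have : c.p * (ξ + c.T / c.p / 2) = c.p * ξ + snPeriod c.k / 2 := by
    rw [T]; field_simp
  rw [rho, this, jacobiSn_add_half_snPeriod hc.k_sq_lt_one, neg_sq, rho]

lemma periodic_rho : Function.Periodic c.rho (c.T / c.p) := by
  intro ξ
  rw [← hc.rho_add_half_period ξ, ← hc.rho_add_half_period (ξ + c.T / c.p / 2)]
  congr 1; ring

lemma periodic_rhoD : Function.Periodic c.rhoD (c.T / c.p) := by
  intro ξ
  have h := (hc.hasDerivAt_rho (ξ + c.T / c.p)).comp_add_const ξ (c.T / c.p)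
  rw [show (fun x => c.rho (x + c.T / c.p)) = c.rho from funext hc.periodic_rho] at h
  exact h.unique (hc.hasDerivAt_rho ξ)

lemma rho_zero : c.rho 0 = c.ρ₁ := by
  simp [rho, jacobiSn_zero hc.k_sq_lt_one]

lemma rhoD_zero : c.rhoD 0 = 0 := by
  simp [rhoD, jacobiSn_zero hc.k_sq_lt_one]

/-- Every period of `ρ` is an integer multiple of `T / (2p)`. -/
lemma exists_int_of_periodic_rho {τ : ℝ} (h : Function.Periodic c.rho τ) :
    ∃ n : ℤ, 2 * τ = n * (c.T / c.p) := by
  have h0 := h 0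
  rw [hc.rho_zero, zero_add, rho, add_eq_left, mul_eq_zero,
    or_iff_right (sub_pos.2 hc.ρ₁_lt_ρ₂).ne', sq_eq_zero_iff] at h0
  obtain ⟨n, hn⟩ := exists_int_of_jacobiSn_eq_zero hc.k_sq_lt_one h0
  refine ⟨n, ?_⟩
  have hp := hc.p_pos.ne'
  rw [T]
  field_simp
  linarith

/-- The curve `(ρ, ρ')` runs through all of `σ² = P(r)`, `ρ₁ ≤ r ≤ ρ₂`. -/
lemma exists_rho_eq {r σ : ℝ} (h1 : c.ρ₁ ≤ r) (h2 : r ≤ c.ρ₂) (hσ : σ ^ 2 = c.P r) :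
    ∃ ξ : ℝ, c.rho ξ = r ∧ c.rhoD ξ = σ := by
  have hp := hc.p_pos.ne'
  have hΔ := sub_pos.2 hc.ρ₁_lt_ρ₂
  have hq0 : 0 ≤ (r - c.ρ₁) / (c.ρ₂ - c.ρ₁) := div_nonneg (by linarith) hΔ.le
  have hq1 : (r - c.ρ₁) / (c.ρ₂ - c.ρ₁) ≤ 1 := by rw [div_le_one hΔ]; linarith
  -- The amplitude where `sn` has the value needed for `ρ = r`. The amplitudes `φ` and `-φ` give the
  -- same `ρ` and opposite `ρ'`, so one of them has the sign of `σ`.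
  set φ := Real.arcsin (√((r - c.ρ₁) / (c.ρ₂ - c.ρ₁))) with hφ
  have hsin : Real.sin φ = √((r - c.ρ₁) / (c.ρ₂ - c.ρ₁)) :=
    Real.sin_arcsin (by linarith [Real.sqrt_nonneg ((r - c.ρ₁) / (c.ρ₂ - c.ρ₁))])
      (Real.sqrt_le_one.2 hq1)
  have ham : ∀ θ : ℝ, jacobiAm c.k (c.p * (ellF c.k θ / c.p)) = θ := fun θ => by
    rw [mul_div_cancel₀ _ hp, jacobiAm_ellF hc.k_sq_lt_one]
  have hr : ∀ θ : ℝ, Real.sin θ ^ 2 = Real.sin φ ^ 2 → c.rho (ellF c.k θ / c.p) = r := by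
    intro θ hθ
    rw [rho, jacobiSn, ham, hθ, hsin, Real.sq_sqrt hq0]
    field_simp; ring
  have hneg : c.rhoD (ellF c.k (-φ) / c.p) = -c.rhoD (ellF c.k φ / c.p) := by
    simp only [rhoD, jacobiSn, ham, Real.sin_neg, Real.cos_neg, neg_sq]; ring
  have hsq : c.rhoD (ellF c.k φ / c.p) ^ 2 = σ ^ 2 := by rw [hc.rhoD_sq, hr φ rfl, hσ]
  rcases sq_eq_sq_iff_eq_or_eq_neg.1 hsq with h | h
  · exact ⟨_, hr φ rfl, h⟩
  · exact ⟨_, hr (-φ) (by rw [Real.sin_neg, neg_sq]), by rw [hneg, h, neg_neg]⟩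

/-- The conditions `cond_zero` and `cond_one` say exactly that `P` is negative at 0 and at 1. They
keep `ρ` away from the zeros of `ρ(1 - ρ)`. -/
lemma P_zero_neg : c.P 0 < 0 := by
  have : c.P 0 = -(c.K + c.G - c.mu - c.a) ^ 2 := by simp [P]
  rw [this]
  have := sq_pos_of_ne_zero hc.cond_zero
  linarith

lemma P_one_neg : c.P 1 < 0 := by
  have : c.P 1 = -(c.K - c.G - c.lam + c.b) ^ 2 := by simp only [P]; ring
  rw [this]
  have := sq_pos_of_ne_zero hc.cond_one
  linarith

lemma ρ₁_pos (h : c.RootsInRange) : 0 < c.ρ₁ := by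
  refine lt_of_le_of_ne ((le_max_left _ _).trans h.1) fun h0 => ?_
  have h1 := hc.P_ρ₁
  rw [← h0] at h1
  linarith [hc.P_zero_neg]

lemma ρ₂_lt_one (h : c.RootsInRange) : c.ρ₂ < 1 := by
  refine lt_of_le_of_ne (h.2.trans (min_le_left _ _)) fun h0 => ?_
  have := hc.P_one_neg
  rw [← h0, hc.P_ρ₂] at this
  exact lt_irrefl _ this

lemma rho_pos (h : c.RootsInRange) (ξ : ℝ) : 0 < c.rho ξ :=
  (hc.ρ₁_pos h).trans_le (hc.rho_mem_Icc ξ).1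

lemma rho_lt_one (h : c.RootsInRange) (ξ : ℝ) : c.rho ξ < 1 :=
  (hc.rho_mem_Icc ξ).2.trans_lt (hc.ρ₂_lt_one h)

/-- The alternating slopes of `P` at its three roots decide which root can coincide with an end of
the range of `ρ`. -/
lemma halfDerivP_ρ₁ : 0 < c.halfDerivP c.ρ₁ := by
  rw [hc.halfDerivP_eq]
  have h1 := mul_pos (sub_pos.2 hc.ρ₁_lt_ρ₂) hc.ρ₃_sub_ρ₁_pos
  have h2 := mul_pos (mul_pos hc.b_pos hc.lam_sub_mu_pos) h1
  linarith

lemma halfDerivP_ρ₂ : c.halfDerivP c.ρ₂ < 0 := by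
  rw [hc.halfDerivP_eq]
  have h1 := mul_pos (sub_pos.2 hc.ρ₁_lt_ρ₂) (sub_pos.2 hc.ρ₂_lt_ρ₃)
  have h2 := mul_pos (mul_pos hc.b_pos hc.lam_sub_mu_pos) h1
  linarith

lemma halfDerivP_ρ₃ : 0 < c.halfDerivP c.ρ₃ := by
  rw [hc.halfDerivP_eq]
  have h1 := mul_pos hc.ρ₃_sub_ρ₁_pos (sub_pos.2 hc.ρ₂_lt_ρ₃)
  have h2 := mul_pos (mul_pos hc.b_pos hc.lam_sub_mu_pos) h1
  linarith

omit hc in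
/-- At a root of `P` where `S` vanishes as well, `P'` is read off from the product. -/
lemma halfDerivP_of_S_eq_zero {r : ℝ} (hS : c.S r = 0) :
    c.halfDerivP r = 2 * (1 - 2 * r) * ((c.G - c.b * r) * (c.a - c.G + c.b * r))
      + 2 * (r * (1 - r)) * (c.b * (c.G - c.b * r) - c.b * (c.a - c.G + c.b * r)) := by
  have : c.halfDerivP r = 2 * (1 - 2 * r) * ((c.G - c.b * r) * (c.a - c.G + c.b * r))
      + 2 * (r * (1 - r)) * (c.b * (c.G - c.b * r) - c.b * (c.a - c.G + c.b * r))
      - c.S r * (4 * c.b * r + (c.mu - c.lam + c.a - c.b - 2 * c.G)) := by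
    simp only [halfDerivP, S, Y, E]; ring
  rw [this, hS]; ring

/-- If `P` is nonnegative somewhere in the admissible range of `ρ`, then the roots `ρ₁, ρ₂` lie
in this range, and the point lies between them. -/
lemma rootsInRange_of_nonneg {r : ℝ} (h0 : 0 ≤ r) (h1 : r ≤ 1) (hG : 0 ≤ c.G - c.b * r)
    (ha : 0 ≤ c.a - c.G + c.b * r) (hP : 0 ≤ c.P r) :
    c.RootsInRange ∧ c.ρ₁ ≤ r ∧ r ≤ c.ρ₂ := by
  have hb := hc.b_pos
  have hab := hc.a_pos
  have hbl := mul_pos hb hc.lam_sub_mu_pos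
  have h12 := hc.ρ₁_lt_ρ₂
  have h23 := hc.ρ₂_lt_ρ₃
  have hrange := hc.cond_range
  set m := max 0 ((c.G - c.a) / c.b) with hm
  set M := min 1 (c.G / c.b) with hM
  have hmr : m ≤ r := max_le h0 (by rw [div_le_iff₀ hb]; linarith)
  have hrM : r ≤ M := le_min h1 (by rw [le_div_iff₀ hb]; linarith)
  have hm0 : 0 ≤ m := le_max_left _ _
  have hM1 : M ≤ 1 := min_le_left _ _
  -- the endpoints
  have hPm : c.P m < 0 ∨ (c.P m ≤ 0 ∧ (c.P m = 0 → 0 < c.halfDerivP m)) := by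
    rcases le_total ((c.G - c.a) / c.b) 0 with h | h
    · left; rw [hm, max_eq_left h]; exact hc.P_zero_neg
    · right
      -- At this end `|ψ₃|²` would vanish, so `P m = -S m ^ 2`. If that is zero, half the slope of
      -- `P` there is `2m(1 - m)ab > 0`. At the other end, `bM = G`, the sign is reversed.
      have hme : c.b * m = c.G - c.a := by rw [hm, max_eq_right h]; field_simp
      have hPS : c.P m = -c.S m ^ 2 := by
        rw [c.P_eq_sub_S_sq, hme]; ring
      refine ⟨by rw [hPS]; linarith [sq_nonneg (c.S m)], fun hz => ?_⟩
      have hS : c.S m = 0 := by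
        rw [hPS] at hz; exact pow_eq_zero_iff two_ne_zero |>.1 (by linarith)
      have hmpos : 0 < m := lt_of_le_of_ne hm0 fun h' => by
        have h0 := hc.P_zero_neg; rw [← h'] at hz; linarith
      rw [halfDerivP_of_S_eq_zero hS, hme]
      have := mul_pos (mul_pos hmpos (sub_pos.2 (hrange.trans_le hM1))) (mul_pos hb hab)
      linarith
  have hPM : c.P M < 0 ∨ (c.P M ≤ 0 ∧ (c.P M = 0 → c.halfDerivP M < 0)) := by
    rcases le_total 1 (c.G / c.b) with h | h
    · left; rw [hM, min_eq_left h]; exact hc.P_one_neg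
    · right
      have hMe : c.b * M = c.G := by rw [hM, min_eq_right h]; field_simp
      have hPS : c.P M = -c.S M ^ 2 := by
        rw [c.P_eq_sub_S_sq, hMe]; ring
      refine ⟨by rw [hPS]; linarith [sq_nonneg (c.S M)], fun hz => ?_⟩
      have hS : c.S M = 0 := by
        rw [hPS] at hz; exact pow_eq_zero_iff two_ne_zero |>.1 (by linarith)
      have hM1' : M < 1 := lt_of_le_of_ne hM1 fun h' => by
        have := hc.P_one_neg; rw [← h', hz] at this; exact lt_irrefl _ this
      rw [halfDerivP_of_S_eq_zero hS, hMe]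
      have := mul_pos (mul_pos (hm0.trans_lt hrange) (sub_pos.2 hM1')) (mul_pos hb hab)
      linarith
  have hPm' : c.P m ≤ 0 := hPm.elim le_of_lt And.left
  have hPM' : c.P M ≤ 0 := hPM.elim le_of_lt And.left
  -- The slopes at the ends exclude the roots where `P` has the opposite slope.
  have hm2 : m ≠ c.ρ₂ := fun h => by
    rcases hPm with h' | ⟨-, h'⟩
    · rw [h, hc.P_ρ₂] at h'; exact lt_irrefl _ h'
    · have := h' (by rw [h, hc.P_ρ₂]); rw [h] at this; linarith [hc.halfDerivP_ρ₂]
  have hM13 : M ≠ c.ρ₁ ∧ M ≠ c.ρ₃ := by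
    constructor <;> intro h <;> rcases hPM with h' | ⟨-, h'⟩
    · rw [h, hc.P_ρ₁] at h'; exact lt_irrefl _ h'
    · have := h' (by rw [h, hc.P_ρ₁]); rw [h] at this; linarith [hc.halfDerivP_ρ₁]
    · rw [h, hc.P_ρ₃] at h'; exact lt_irrefl _ h'
    · have := h' (by rw [h, hc.P_ρ₃]); rw [h] at this; linarith [hc.halfDerivP_ρ₃]
  -- the sign of `P` between and beyond its roots
  have hneg : ∀ s, s < c.ρ₁ → c.P s < 0 := fun s hs => by
    have h := mul_pos (mul_pos (sub_pos.2 hs) (sub_pos.2 (hs.trans h12)))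
      (sub_pos.2 (hs.trans (h12.trans h23)))
    have := mul_pos hbl h
    rw [hc.P_eq_mul]; nlinarith
  have hpos : ∀ s, c.ρ₁ < s → s < c.ρ₂ → 0 < c.P s := fun s hs hs' => by
    have h := mul_pos (mul_pos (sub_pos.2 hs) (sub_pos.2 hs')) (sub_pos.2 (hs'.trans h23))
    have := mul_pos hbl h
    rw [hc.P_eq_mul]; nlinarith
  have hneg' : ∀ s, c.ρ₂ < s → s < c.ρ₃ → c.P s < 0 := fun s hs hs' => by
    have h := mul_pos (mul_pos (sub_pos.2 (h12.trans hs)) (sub_pos.2 hs)) (sub_pos.2 hs')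
    have := mul_pos hbl h
    rw [hc.P_eq_mul]; nlinarith
  have hpos' : ∀ s, c.ρ₃ < s → 0 < c.P s := fun s hs => by
    have h := mul_pos (mul_pos (sub_pos.2 ((h12.trans h23).trans hs)) (sub_pos.2 (h23.trans hs)))
      (sub_pos.2 hs)
    have := mul_pos hbl h
    rw [hc.P_eq_mul]; nlinarith
  have hr1 : c.ρ₁ ≤ r := by
    by_contra h; exact absurd (hneg r (not_le.1 h)) (not_lt.2 hP)
  -- Since `P M ≤ 0`, the whole range lies to the left of `ρ₃`; hence `P r ≥ 0` can only occur in
  -- `[ρ₁, ρ₂]`.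
  have hM3 : M < c.ρ₃ := by
    by_contra h
    exact absurd (hpos' M (lt_of_le_of_ne (not_lt.1 h) hM13.2.symm)) (not_lt.2 hPM')
  have hr2 : r ≤ c.ρ₂ := by
    by_contra h; exact absurd (hneg' r (not_le.1 h) (hrM.trans_lt hM3)) (not_lt.2 hP)
  refine ⟨⟨?_, ?_⟩, hr1, hr2⟩
  · by_contra h
    exact absurd (hpos m (not_le.1 h) (lt_of_le_of_ne (hmr.trans hr2) hm2)) (not_lt.2 hPm')
  · by_contra h
    exact absurd (hpos M (lt_of_le_of_ne (hr1.trans hrM) hM13.1.symm) (not_le.1 h))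
      (not_lt.2 hPM')

end Admissible
end DSParam

/-! ### Conservation of the norms of `Φ₁`, `Φ₂`, `Φ₃`. -/

namespace DSSystem

open Complex

variable {Λ : Fin 2 → ℝ} {Z : Fin 3 → Fin 2 → ℂ}

lemma br_two (Λ : Fin 2 → ℝ) (Z : Fin 3 → Fin 2 → ℂ) (i j : Fin 3) (m : ℕ) :
    br Λ Z i j m = conj (Z i 0) * (Λ 0 : ℂ) ^ m * Z j 0 + conj (Z i 1) * (Λ 1 : ℂ) ^ m * Z j 1 := by
  simp [br, Fin.sum_univ_two]

lemma conj_br (Λ : Fin 2 → ℝ) (Z : Fin 3 → Fin 2 → ℂ) (i j : Fin 3) (m : ℕ) :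
    conj (br Λ Z i j m) = br Λ Z j i m := by
  simp [br_two]; ring

lemma ofReal_norm_sq (z : ℂ) : (‖z‖ : ℂ) ^ 2 = z * conj z := (Complex.mul_conj' z).symm

/-- `⟨Φ₂, (Λ + Φ₃Φ₃*) Φ₁⟩`, which is `(⟨Φ₁, Φ₁⟩ - ⟨Φ₂, Φ₂⟩) u / 2i`. -/
def cross (Λ : Fin 2 → ℝ) (Z : Fin 3 → Fin 2 → ℂ) : ℂ :=
  br Λ Z 1 0 1 + br Λ Z 1 2 0 * br Λ Z 2 0 0

lemma u_eq_cross (Λ : Fin 2 → ℝ) (Z : Fin 3 → Fin 2 → ℂ) :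
    u Λ Z = 2 * I * cross Λ Z / (br Λ Z 0 0 0 - br Λ Z 1 1 0) := by
  rw [u, cross]; ring

/-- The `x`-, `y`- and `t`-systems preserve `⟨Φ_j, Φ_j⟩`. -/
lemma inner_fieldX (Λ : Fin 2 → ℝ) (Z : Fin 3 → Fin 2 → ℂ) (j : Fin 3) :
    ∑ k, (Z j k * conj (fieldX Λ Z j k) + conj (Z j k) * fieldX Λ Z j k) = 0 := by
  fin_cases j <;>
  · simp [fieldX, f, g, br_two, Fin.sum_univ_two]
    ring

lemma inner_fieldY (h : br Λ Z 0 1 0 = 0) (j : Fin 3) :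
    ∑ k, (Z j k * conj (fieldY Λ Z j k) + conj (Z j k) * fieldY Λ Z j k) = 0 := by
  have h' : br Λ Z 1 0 0 = 0 := by rw [← conj_br, h, map_zero]
  simp only [br_two, pow_zero, mul_one] at h h'
  fin_cases j
  · simp [fieldY, f, g, br_two, Fin.sum_univ_two]
    linear_combination u Λ Z * h + conj (u Λ Z) * h'
  · simp [fieldY, f, g, br_two, Fin.sum_univ_two]
    linear_combination - u Λ Z * h - conj (u Λ Z) * h'
  · simp [fieldY, f, g, br_two, Fin.sum_univ_two]
    ring

/-- `uy` only occurs multiplied by `⟨Φ₁, Φ₂⟩` or its conjugate, so its form is irrelevant. The terms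
with `u` cancel by the definition of `u`, cleared of its denominator in `hu` and `hu'`. -/
lemma inner_fieldT (h : br Λ Z 0 1 0 = 0) (hne : br Λ Z 0 0 0 ≠ br Λ Z 1 1 0) (j : Fin 3) :
    ∑ k, (Z j k * conj (fieldT Λ Z j k) + conj (Z j k) * fieldT Λ Z j k) = 0 := by
  have h' : br Λ Z 1 0 0 = 0 := by rw [← conj_br, h, map_zero]
  have hD := sub_ne_zero.2 hne
  have hu : I * (u Λ Z * (br Λ Z 0 0 0 - br Λ Z 1 1 0))
      = -2 * (br Λ Z 1 0 1 + br Λ Z 1 2 0 * br Λ Z 2 0 0) := by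
    rw [u_eq_cross, div_mul_cancel₀ _ hD, cross]
    linear_combination 2 * (br Λ Z 1 0 1 + br Λ Z 1 2 0 * br Λ Z 2 0 0) * I_sq
  have hu' : I * (conj (u Λ Z) * (br Λ Z 0 0 0 - br Λ Z 1 1 0))
      = 2 * (br Λ Z 0 1 1 + br Λ Z 2 1 0 * br Λ Z 0 2 0) := by
    have := congrArg conj hu
    simp only [map_mul, map_sub, map_add, map_neg, conj_br, conj_I, conj_ofNat] at this
    linear_combination -this
  simp only [br_two, pow_zero, pow_one, mul_one] at h h' hu hu'
  have hf0 : f Λ Z = conj (Z 2 0) * Z 0 0 + conj (Z 2 1) * Z 0 1 := by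
    simp [f, br_two]
  have hg0 : g Λ Z = conj (Z 2 0) * Z 1 0 + conj (Z 2 1) * Z 1 1 := by
    simp [g, br_two]
  fin_cases j
  · simp [fieldT, fy, gy, v₁, v₂, ofReal_norm_sq, conj_ofNat, Fin.sum_univ_two, hf0, hg0, br_two]
    generalize u Λ Z = w at *
    generalize uy Λ Z = w' at *
    linear_combination (I * w' ) * h - I * conj w' * h' + w * hu' - conj w * hu
  · simp [fieldT, fy, gy, v₁, v₂, ofReal_norm_sq, conj_ofNat, Fin.sum_univ_two, hf0, hg0, br_two]
    generalize u Λ Z = w at *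
    generalize uy Λ Z = w' at *
    linear_combination (-I * w' ) * h + I * conj w' * h' - w * hu' + conj w * hu
  · simp [fieldT, fy, gy, v₁, v₂, ofReal_norm_sq, conj_ofNat, Fin.sum_univ_two, hf0, hg0, br_two]
    ring

end DSSystem

/-! ### The `y`- and `t`-fields as multiples of the `x`-field up to phases. -/

namespace DSParam

open Complex DSSystem

/-- Rates of the phases of `Φ_j` in the `y`-direction. -/
def phaseY (c : DSParam) : Fin 3 → ℝ :=
  ![-2 * c.R₂ ^ 2 * c.K / c.b, -2 * c.R₁ ^ 2 * c.K₂ / c.b, -2 * c.R₁ ^ 2 * c.R₂ ^ 2 / c.b]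

/-- Rate of the phases in the `t`-direction that is proportional to the eigenvalue. -/
def phaseEig (c : DSParam) : ℝ := -(2 / c.b) * (c.R₁ ^ 4 + c.R₂ ^ 4)

/-- The part of the rates of the phases of `Φ_j` in the `t`-direction that does not depend on
the eigenvalue. -/
def phaseT (c : DSParam) : Fin 3 → ℝ :=
  let w₀ := -2 * c.K ^ 2 - c.γ₂ * c.K
    + 2 / c.b ^ 2 * (c.R₂ ^ 4 + 2 * c.R₁ ^ 2 * c.R₂ ^ 2 - c.R₁ ^ 4)
      * (c.E + c.b * c.mu - c.b * c.K)
    + 2 / c.b * (c.R₁ ^ 4 + c.R₂ ^ 4) * c.K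
  ![w₀, w₀ - (c.C₁₂ + c.C₂₁),
    c.R₁ ^ 2 * (2 * c.R₁ ^ 2 - 4 * c.K - c.γ₂) + c.phaseEig * (c.a - c.K)]

/-- The `Φ₁`-component of the reduction of the `t`-field. Here `r, q` stand for `R₁, R₂`; `x, y, s`
for `f`, `g`, `cross`; primes for conjugates, treated as independent; `l` for an eigenvalue and `z₀,
z₁, z₂` for the components of `Φ₁, Φ₂, Φ₃`. The relations `e1` and `e2` lower the degree in `l`,
`e3` removes `z₂`, and the coefficients of `z₀` and `z₁` then agree. -/
lemma fieldT_algebra₁ {r q K K₂ x x' y y' s s' l z₀ z₁ z₂ : ℂ} (hr : r ≠ 0) (hq : q ≠ 0)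
    (hb : r ^ 2 - q ^ 2 ≠ 0)
    (e1 : q ^ 2 * (l * z₀ + x * z₂) = q ^ 2 * K * z₀ + s * z₁)
    (e2 : r ^ 2 * (l * z₁ + y * z₂) = s' * z₀ + r ^ 2 * K₂ * z₁)
    (e3 : r ^ 2 * q ^ 2 * z₂ = q ^ 2 * x' * z₀ + r ^ 2 * y' * z₁)
    {γ β α : ℂ} (hγ : γ = 2 * (r ^ 4 + q ^ 4 - (r ^ 2 + q ^ 2) * (K + K₂)) / (r ^ 2 - q ^ 2)
      - 4 * r ^ 2 * q ^ 2 * (K₂ - K) / (r ^ 2 - q ^ 2) ^ 2)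
    (hβ : β = -(2 / (r ^ 2 - q ^ 2)) * (r ^ 4 + q ^ 4))
    (hα : α = -2 * K ^ 2 - γ * K + 2 / (r ^ 2 - q ^ 2) ^ 2 * (q ^ 4 + 2 * r ^ 2 * q ^ 2 - r ^ 4)
        * (s * s' / (r ^ 2 * q ^ 2) - (r ^ 2 - q ^ 2) * (x * x') / r ^ 2)
      + 2 / (r ^ 2 - q ^ 2) * (r ^ 4 + q ^ 4) * K) :
    (-2 * I * l ^ 2 + I * (4 * (s * s') / (r ^ 2 - q ^ 2) ^ 2) + I * (2 * (x * x'))) * z₀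
      + (-2 * (2 * I * s / (r ^ 2 - q ^ 2)) * l
        + I * (2 / (r ^ 2 - q ^ 2) * ((r ^ 2 + q ^ 2) * x * y'
          - 2 * s / (r ^ 2 - q ^ 2) * (r ^ 2 * K₂ - q ^ 2 * K)))) * z₁
      + (-2 * I * x * l - 2 * (I * (K * x + (r ^ 2 + q ^ 2) / (r ^ 2 - q ^ 2) * s * y / q ^ 2
        - r ^ 2 * x))) * z₂
    = γ * (I * l * z₀ + I * x * z₂) + I * (α + β * l) * z₀ := by
  linear_combination (norm := skip) ((-2 * I * l - 2 * I * K - γ * I - I * β) / q ^ 2) * e1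
    - (2 * I * s * ((r ^ 2 + q ^ 2) / (r ^ 2 - q ^ 2)) / q ^ 2 / r ^ 2) * e2
    + (I * x * (β + 2 * r ^ 2) / (r ^ 2 * q ^ 2)) * e3
  rw [hα, hβ, hγ]
  field_simp
  ring

lemma fieldT_algebra₂ {r q K K₂ x x' y y' s s' l z₀ z₁ z₂ : ℂ} (hr : r ≠ 0) (hq : q ≠ 0)
    (hb : r ^ 2 - q ^ 2 ≠ 0)
    (e1 : q ^ 2 * (l * z₀ + x * z₂) = q ^ 2 * K * z₀ + s * z₁)
    (e2 : r ^ 2 * (l * z₁ + y * z₂) = s' * z₀ + r ^ 2 * K₂ * z₁)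
    (e3 : r ^ 2 * q ^ 2 * z₂ = q ^ 2 * x' * z₀ + r ^ 2 * y' * z₁)
    {γ β α C w : ℂ} (hγ : γ = 2 * (r ^ 4 + q ^ 4 - (r ^ 2 + q ^ 2) * (K + K₂)) / (r ^ 2 - q ^ 2)
      - 4 * r ^ 2 * q ^ 2 * (K₂ - K) / (r ^ 2 - q ^ 2) ^ 2)
    (hβ : β = -(2 / (r ^ 2 - q ^ 2)) * (r ^ 4 + q ^ 4))
    (hw : w = s * s' / (r ^ 2 * q ^ 2) - (r ^ 2 - q ^ 2) * (x * x') / r ^ 2)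
    (hα : α = -2 * K ^ 2 - γ * K + 2 / (r ^ 2 - q ^ 2) ^ 2 * (q ^ 4 + 2 * r ^ 2 * q ^ 2 - r ^ 4)
        * w + 2 / (r ^ 2 - q ^ 2) * (r ^ 4 + q ^ 4) * K)
    (hC : C = 2 / (r ^ 2 - q ^ 2) ^ 2 * ((q ^ 4 + 2 * r ^ 2 * q ^ 2 - r ^ 4) * (w - K * K₂)
        + (r ^ 4 + 2 * r ^ 2 * q ^ 2 - q ^ 4)
          * (w - K * K₂ + (r ^ 2 - q ^ 2) * (x * x' / r ^ 2 + y * y' / q ^ 2))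
        + 8 * r ^ 2 * q ^ 2 * K * K₂ - 2 * q ^ 4 * K ^ 2 - 2 * r ^ 4 * K₂ ^ 2)) :
    (2 * (-2 * I * s' / (r ^ 2 - q ^ 2)) * l
        + I * (2 / (r ^ 2 - q ^ 2) * ((r ^ 2 + q ^ 2) * x' * y
          - 2 * s' / (r ^ 2 - q ^ 2) * (r ^ 2 * K₂ - q ^ 2 * K)))) * z₀
      + (2 * I * l ^ 2 - I * (4 * (s * s') / (r ^ 2 - q ^ 2) ^ 2) - I * (2 * (y * y'))) * z₁
      + (2 * I * y * l - 2 * (I * ((r ^ 2 + q ^ 2) / (r ^ 2 - q ^ 2) * s' * x / r ^ 2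
        - K₂ * y + q ^ 2 * y))) * z₂
    = γ * (I * l * z₁ + I * y * z₂) + I * (α - C + β * l) * z₁ := by
  linear_combination (norm := skip) ((2 * I * l + 2 * I * K₂ - γ * I - I * β) / r ^ 2) * e2
    - (2 * I * s' * ((r ^ 2 + q ^ 2) / (r ^ 2 - q ^ 2)) / r ^ 2 / q ^ 2) * e1
    + (I * y * (β - 2 * q ^ 2) / (r ^ 2 * q ^ 2)) * e3
  rw [hα, hC, hw, hβ, hγ]
  field_simp
  ring

lemma fieldT_algebra₃ {r q K K₂ x x' y y' s s' l z₀ z₁ z₂ : ℂ} (hr : r ≠ 0) (hq : q ≠ 0)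
    (hb : r ^ 2 - q ^ 2 ≠ 0)
    (e1 : q ^ 2 * (l * z₀ + x * z₂) = q ^ 2 * K * z₀ + s * z₁)
    (e2 : r ^ 2 * (l * z₁ + y * z₂) = s' * z₀ + r ^ 2 * K₂ * z₁)
    (e3 : r ^ 2 * q ^ 2 * z₂ = q ^ 2 * x' * z₀ + r ^ 2 * y' * z₁)
    {γ β α : ℂ} (hγ : γ = 2 * (r ^ 4 + q ^ 4 - (r ^ 2 + q ^ 2) * (K + K₂)) / (r ^ 2 - q ^ 2)
      - 4 * r ^ 2 * q ^ 2 * (K₂ - K) / (r ^ 2 - q ^ 2) ^ 2)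
    (hβ : β = -(2 / (r ^ 2 - q ^ 2)) * (r ^ 4 + q ^ 4))
    (hα : α = r ^ 2 * (2 * r ^ 2 - 4 * K - γ) + β * (x * x' / r ^ 2 + y * y' / q ^ 2 - K)) :
    (-2 * I * x' * l + 2 * (-I * (K * x' + (r ^ 2 + q ^ 2) / (r ^ 2 - q ^ 2) * s' * y' / q ^ 2
        - r ^ 2 * x'))) * z₀
      + (2 * I * y' * l + 2 * (-I * ((r ^ 2 + q ^ 2) / (r ^ 2 - q ^ 2) * s * x' / r ^ 2
        - K₂ * y' + q ^ 2 * y'))) * z₁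
      - 2 * I * (x * x' - y * y') * z₂
    = γ * (I * x' * z₀ + I * y' * z₁) + I * (α + β * l) * z₂ := by
  linear_combination (norm := skip) ((-2 * I * x' - I * β * x' / r ^ 2) / q ^ 2) * e1
    + ((2 * I * y' - I * β * y' / q ^ 2) / r ^ 2) * e2
    + ((-I * α + I * β * (x * x' / r ^ 2 + y * y' / q ^ 2) - I * β * l) / (r ^ 2 * q ^ 2)) * e3
  rw [hα, hβ, hγ]
  field_simp
  ring

/-- The phase point `Z` satisfies the constraint and lies on the common level set of the
integrals. -/
structure OnLevel (c : DSParam) (Z : Fin 3 → Fin 2 → ℂ) : Prop where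
  R₁_ne : c.R₁ ≠ 0
  R₂_ne : c.R₂ ≠ 0
  b_ne : c.b ≠ 0
  orth : br c.eig Z 0 1 0 = 0
  integrals : c.IntegralsAt Z

namespace OnLevel

variable {c : DSParam} {Z : Fin 3 → Fin 2 → ℂ} (h : c.OnLevel Z)
include h

lemma r₁_ne : (c.R₁ : ℂ) ^ 2 ≠ 0 := pow_ne_zero 2 (ofReal_ne_zero.2 h.R₁_ne)
lemma r₂_ne : (c.R₂ : ℂ) ^ 2 ≠ 0 := pow_ne_zero 2 (ofReal_ne_zero.2 h.R₂_ne)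
lemma R₁_ne' : (c.R₁ : ℂ) ≠ 0 := ofReal_ne_zero.2 h.R₁_ne
lemma R₂_ne' : (c.R₂ : ℂ) ≠ 0 := ofReal_ne_zero.2 h.R₂_ne
lemma b_ne' : (c.b : ℂ) ≠ 0 := ofReal_ne_zero.2 h.b_ne

omit h in
lemma b_eq : (c.b : ℂ) = (c.R₁ : ℂ) ^ 2 - (c.R₂ : ℂ) ^ 2 := by simp [b]

lemma br00 : br c.eig Z 0 0 0 = (c.R₁ : ℂ) ^ 2 := by
  have := congrArg (fun x : ℝ => (x : ℂ)) h.integrals.R₁_eq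
  push_cast [ofReal_norm_sq] at this
  rw [br_two, ← this]; ring

lemma br11 : br c.eig Z 1 1 0 = (c.R₂ : ℂ) ^ 2 := by
  have := congrArg (fun x : ℝ => (x : ℂ)) h.integrals.R₂_eq
  push_cast [ofReal_norm_sq] at this
  rw [br_two, ← this]; ring

lemma br22 : br c.eig Z 2 2 0 = (c.a : ℂ) := by
  have := congrArg (fun x : ℝ => (x : ℂ)) h.integrals.R₃_eq
  push_cast [ofReal_norm_sq] at this
  rw [br_two, a, ofReal_pow, ← this]; ring

lemma orth' : br c.eig Z 1 0 0 = 0 := by rw [← conj_br, h.orth, map_zero]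

lemma br_sub : br c.eig Z 0 0 0 - br c.eig Z 1 1 0 = c.b := by
  rw [h.br00, h.br11, b_eq]

lemma u_eq : u c.eig Z = 2 * I * cross c.eig Z / c.b := by rw [u_eq_cross, h.br_sub]

lemma conj_u_eq : conj (u c.eig Z) = -2 * I * conj (cross c.eig Z) / c.b := by
  rw [h.u_eq]; simp [conj_ofNat]

/-- Expansion of a vector in the orthogonal basis `Φ₁, Φ₂`. -/
lemma expand (X : Fin 2 → ℂ) (k : Fin 2) :
    (c.R₁ : ℂ) ^ 2 * (c.R₂ : ℂ) ^ 2 * X k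
      = (c.R₂ : ℂ) ^ 2 * (conj (Z 0 0) * X 0 + conj (Z 0 1) * X 1) * Z 0 k
        + (c.R₁ : ℂ) ^ 2 * (conj (Z 1 0) * X 0 + conj (Z 1 1) * X 1) * Z 1 k := by
  have o := h.orth
  have o' := h.orth'
  rw [← h.br00, ← h.br11]
  simp only [br_two, pow_zero, mul_one] at o o' ⊢
  fin_cases k
  · simp only [Fin.zero_eta]
    linear_combination (-X 0 * conj (Z 1 0) * Z 0 0 - X 1 * conj (Z 1 1) * Z 0 0) * o
      + (X 0 * conj (Z 0 1) * Z 1 1 - X 1 * conj (Z 0 1) * Z 1 0) * o'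
  · simp only [Fin.mk_one]
    linear_combination (-X 1 * conj (Z 1 1) * Z 0 1 - X 0 * conj (Z 1 0) * Z 0 1) * o
      + (X 1 * conj (Z 0 0) * Z 1 0 - X 0 * conj (Z 0 0) * Z 1 1) * o'

lemma br001 : br c.eig Z 0 0 1 + conj (f c.eig Z) * f c.eig Z = c.K * (c.R₁ : ℂ) ^ 2 := by
  have := h.integrals.K_eq
  rw [div_eq_iff h.r₁_ne] at this
  rw [f, conj_br, this]

/-- Parseval's identity for `Φ₃` in the basis `Φ₁, Φ₂`. -/
lemma a_eq : (c.R₁ : ℂ) ^ 2 * (c.R₂ : ℂ) ^ 2 * c.a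
    = (c.R₂ : ℂ) ^ 2 * (f c.eig Z * conj (f c.eig Z))
      + (c.R₁ : ℂ) ^ 2 * (g c.eig Z * conj (g c.eig Z)) := by
  have e0 := h.expand (Z 2) 0
  have e1 := h.expand (Z 2) 1
  rw [← h.br22]
  simp only [f, g, conj_br]
  simp only [br_two, pow_zero, mul_one]
  linear_combination conj (Z 2 0) * e0 + conj (Z 2 1) * e1

lemma Φ₃_eq (k : Fin 2) : (c.R₁ : ℂ) ^ 2 * (c.R₂ : ℂ) ^ 2 * Z 2 k
    = (c.R₂ : ℂ) ^ 2 * conj (f c.eig Z) * Z 0 k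
      + (c.R₁ : ℂ) ^ 2 * conj (g c.eig Z) * Z 1 k := by
  rw [h.expand (Z 2) k]
  simp only [f, g, conj_br]
  simp only [br_two, pow_zero, mul_one]

/-- This is `MΦ₁` for `M = Λ + Φ₃Φ₃*`, expanded in `Φ₁, Φ₂`: the diagonal coefficient is the
integral `K`, the other one is `cross`. -/
lemma ΛΦ₁_eq (k : Fin 2) : (c.R₂ : ℂ) ^ 2 * (c.eig k * Z 0 k + f c.eig Z * Z 2 k)
    = (c.R₂ : ℂ) ^ 2 * c.K * Z 0 k + cross c.eig Z * Z 1 k := by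
  refine mul_left_cancel₀ h.r₁_ne ?_
  have e := h.expand (fun k => c.eig k * Z 0 k + f c.eig Z * Z 2 k) k
  have hK := h.br001
  rw [show (c.R₁ : ℂ) ^ 2 * ((c.R₂ : ℂ) ^ 2 * (c.eig k * Z 0 k + f c.eig Z * Z 2 k))
    = (c.R₁ : ℂ) ^ 2 * (c.R₂ : ℂ) ^ 2 * (c.eig k * Z 0 k + f c.eig Z * Z 2 k) by ring, e]
  rw [cross]
  simp only [f, conj_br] at hK ⊢
  simp only [br_two, pow_zero, pow_one, mul_one] at hK ⊢
  linear_combination (c.R₂ : ℂ) ^ 2 * Z 0 k * hK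

/-- The second diagonal entry of `M` follows from the first by the trace `λ + μ + a`; `e0` and `e1`
compute the trace of `Λ` in the basis `Φ₁, Φ₂`. -/
lemma br111 : br c.eig Z 1 1 1 + conj (g c.eig Z) * g c.eig Z = c.K₂ * (c.R₂ : ℂ) ^ 2 := by
  refine mul_left_cancel₀ h.r₁_ne ?_
  have e0 := h.expand (fun k => c.eig k * (if k = 0 then 1 else 0)) 0
  have e1 := h.expand (fun k => c.eig k * (if k = 1 then 1 else 0)) 1
  have hK := h.br001
  have ha := h.a_eq
  rw [K₂]
  simp only [eig, a, br_two, pow_one, Matrix.cons_val_zero, Matrix.cons_val_one, if_true,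
    one_ne_zero, zero_ne_one, if_false, mul_one, mul_zero, add_zero, zero_add] at *
  push_cast at *
  linear_combination -e0 - e1 - (c.R₂ : ℂ) ^ 2 * hK - ha

lemma ΛΦ₂_eq (k : Fin 2) : (c.R₁ : ℂ) ^ 2 * (c.eig k * Z 1 k + g c.eig Z * Z 2 k)
    = conj (cross c.eig Z) * Z 0 k + (c.R₁ : ℂ) ^ 2 * c.K₂ * Z 1 k := by
  refine mul_left_cancel₀ h.r₂_ne ?_
  have e := h.expand (fun k => c.eig k * Z 1 k + g c.eig Z * Z 2 k) k
  have hK := h.br111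
  rw [show (c.R₂ : ℂ) ^ 2 * ((c.R₁ : ℂ) ^ 2 * (c.eig k * Z 1 k + g c.eig Z * Z 2 k))
    = (c.R₁ : ℂ) ^ 2 * (c.R₂ : ℂ) ^ 2 * (c.eig k * Z 1 k + g c.eig Z * Z 2 k) by ring, e]
  rw [cross]
  simp only [map_add, map_mul, g, conj_br] at hK ⊢
  simp only [br_two, pow_zero, pow_one, mul_one] at hK ⊢
  linear_combination (c.R₁ : ℂ) ^ 2 * Z 1 k * hK

omit h in
lemma br101 : br c.eig Z 1 0 1 = cross c.eig Z - conj (g c.eig Z) * f c.eig Z := by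
  rw [cross, g, f, conj_br]; ring

/-- Pair the expansion of `MΦ₁` with `Φ₃`. The moments in the next two lemmas come from pairing
`MΦ₂` with `Φ₃` and `MΦ₁` with `ΛΦ₂`. -/
lemma br201 : (c.R₂ : ℂ) ^ 2 * br c.eig Z 2 0 1 = (c.R₂ : ℂ) ^ 2 * c.K * f c.eig Z
    + cross c.eig Z * g c.eig Z - (c.R₂ : ℂ) ^ 2 * c.a * f c.eig Z := by
  have e0 := h.ΛΦ₁_eq 0
  have e1 := h.ΛΦ₁_eq 1
  rw [← h.br22]
  generalize cross c.eig Z = s at *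
  simp only [g, f, br_two, pow_zero, pow_one, mul_one] at *
  linear_combination conj (Z 2 0) * e0 + conj (Z 2 1) * e1

lemma br211 : (c.R₁ : ℂ) ^ 2 * br c.eig Z 2 1 1 = conj (cross c.eig Z) * f c.eig Z
    + (c.R₁ : ℂ) ^ 2 * c.K₂ * g c.eig Z - (c.R₁ : ℂ) ^ 2 * c.a * g c.eig Z := by
  have e0 := h.ΛΦ₂_eq 0
  have e1 := h.ΛΦ₂_eq 1
  rw [← h.br22]
  generalize cross c.eig Z = s at *
  simp only [g, f, br_two, pow_zero, pow_one, mul_one] at *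
  linear_combination conj (Z 2 0) * e0 + conj (Z 2 1) * e1

lemma br102 : (c.R₂ : ℂ) ^ 2 * (br c.eig Z 1 0 2 + f c.eig Z * br c.eig Z 1 2 1)
    = (c.R₂ : ℂ) ^ 2 * c.K * br c.eig Z 1 0 1 + cross c.eig Z * br c.eig Z 1 1 1 := by
  have e0 := h.ΛΦ₁_eq 0
  have e1 := h.ΛΦ₁_eq 1
  generalize cross c.eig Z = s at *
  generalize f c.eig Z = w at *
  simp only [br_two, pow_one] at *
  linear_combination conj (Z 1 0) * c.eig 0 * e0 + conj (Z 1 1) * c.eig 1 * e1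

/-- After removal of all moments of `Λ` the substitute for `u_y`, like those for `f_y` and `g_y`
below, involves only `f`, `g`, `cross` and constants. This is the form that the algebraic lemmas on
the `t`-field consume. -/
lemma uy_eq : uy c.eig Z = 2 / c.b * (((c.R₁ : ℂ) ^ 2 + (c.R₂ : ℂ) ^ 2) * f c.eig Z
      * conj (g c.eig Z)
    - 2 * cross c.eig Z / c.b * ((c.R₁ : ℂ) ^ 2 * c.K₂ - (c.R₂ : ℂ) ^ 2 * c.K)) := by
  have hb := h.b_ne'
  have h1 := h.br102
  have h2 := h.br201
  have h3 := h.br111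
  have h4 := h.br001
  have h5 := br101 (c := c) (Z := Z)
  have hr := h.R₂_ne'
  rw [uy, h.br_sub, h.br22, h.br00, h.br11, h.u_eq, ofReal_norm_sq, ofReal_norm_sq]
  have e1 : br c.eig Z 1 0 2 = c.K * br c.eig Z 1 0 1
      + cross c.eig Z * br c.eig Z 1 1 1 / (c.R₂ : ℂ) ^ 2 - f c.eig Z * br c.eig Z 1 2 1 := by
    field_simp; linear_combination h1
  have e2 : br c.eig Z 2 0 1 = c.K * f c.eig Z
    + cross c.eig Z * g c.eig Z / (c.R₂ : ℂ) ^ 2 - c.a * f c.eig Z := by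
    field_simp; linear_combination h2
  rw [e1, h5, e2, eq_sub_of_add_eq h3, eq_sub_of_add_eq h4]
  generalize cross c.eig Z = s
  generalize f c.eig Z = w
  generalize g c.eig Z = w'
  rw [b_eq] at *
  field_simp
  ring_nf
  simp only [I_sq]
  ring

lemma fy_eq : fy c.eig Z = I * (c.K * f c.eig Z + c.γ₁ * cross c.eig Z * g c.eig Z / (c.R₂ : ℂ) ^ 2
    - (c.R₁ : ℂ) ^ 2 * f c.eig Z) := by
  have hb := h.b_ne'
  have hr := h.R₂_ne'
  have e2 : br c.eig Z 2 0 1 = c.K * f c.eig Z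
    + cross c.eig Z * g c.eig Z / (c.R₂ : ℂ) ^ 2 - c.a * f c.eig Z := by
    field_simp; linear_combination h.br201
  rw [fy, e2, h.u_eq, h.br22, h.br00, γ₁]
  push_cast
  rw [b_eq] at *
  field_simp
  ring

lemma gy_eq : gy c.eig Z = I * (c.γ₁ * conj (cross c.eig Z) * f c.eig Z / (c.R₁ : ℂ) ^ 2
    - c.K₂ * g c.eig Z + (c.R₂ : ℂ) ^ 2 * g c.eig Z) := by
  have hb := h.b_ne'
  have hr := h.R₁_ne'
  have e2 : br c.eig Z 2 1 1 = conj (cross c.eig Z) * f c.eig Z / (c.R₁ : ℂ) ^ 2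
    + c.K₂ * g c.eig Z - c.a * g c.eig Z := by
    field_simp; linear_combination h.br211
  rw [gy, e2, h.conj_u_eq, h.br22, h.br11, γ₁]
  push_cast
  rw [b_eq] at *
  field_simp
  ring


/-- `(⟨Φ₁,Φ₁⟩⟨Φ₂,Φ₂⟩ - ⟨Φ₂,Φ₂⟩ |φ₁|²) = ⟨Φ₁,Φ₁⟩ |φ₂|²`. -/
lemma φ₂_sq : (c.R₁ : ℂ) ^ 2 * (Z 1 0 * conj (Z 1 0))
    = (c.R₂ : ℂ) ^ 2 * ((c.R₁ : ℂ) ^ 2 - Z 0 0 * conj (Z 0 0)) := by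
  have e := h.expand (fun k => if k = 0 then 1 else 0) 0
  simp only [if_true, one_ne_zero, if_false, mul_one, mul_zero, add_zero] at e
  linear_combination -e

/-- Like the next three quantities, this one is affine in `|φ₁|²`; that is why a single scalar `ρ`
governs all moduli. -/
lemma φ₃_sq : (c.R₁ : ℂ) ^ 2 * (Z 2 0 * conj (Z 2 0))
    = (c.R₁ : ℂ) ^ 2 * c.G - c.b * (Z 0 0 * conj (Z 0 0)) := by
  have e := h.φ₂_sq
  have hG := congrArg (fun x : ℝ => (x : ℂ)) h.integrals.G_eq
  push_cast [ofReal_norm_sq] at hG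
  rw [b_eq]
  linear_combination (c.R₁ : ℂ) ^ 2 * hG - e

lemma f_sq : f c.eig Z * conj (f c.eig Z) = (c.R₁ : ℂ) ^ 2 * (c.K - c.mu)
    - (c.lam - c.mu) * (Z 0 0 * conj (Z 0 0)) := by
  have hK := h.br001
  have h1 := h.br00
  generalize f c.eig Z = w at *
  simp only [br_two, eig, pow_one, pow_zero, mul_one, Matrix.cons_val_zero,
    Matrix.cons_val_one] at hK h1
  linear_combination hK - c.mu * h1

lemma g_sq : (c.R₁ : ℂ) ^ 2 * (g c.eig Z * conj (g c.eig Z)) = (c.R₂ : ℂ) ^ 2 *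
    ((c.R₁ : ℂ) ^ 2 * (c.a - c.K + c.mu) + (c.lam - c.mu) * (Z 0 0 * conj (Z 0 0))) := by
  linear_combination (c.R₂ : ℂ) ^ 2 * (-h.f_sq) - h.a_eq

/-- In the normalised basis the off-diagonal entry of `M` satisfies `|M₁₂|² = KK₂ - det M`, and `det
M = λμ + λ|ψ₃|² + μ|φ₃|²` is affine in `|φ₃|²`. -/
lemma cross_sq : cross c.eig Z * conj (cross c.eig Z) = (c.R₂ : ℂ) ^ 2 *
    ((c.R₁ : ℂ) ^ 2 * c.E - c.b * (c.lam - c.mu) * (Z 0 0 * conj (Z 0 0))) := by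
  have e10 := h.ΛΦ₁_eq 0
  have e11 := h.ΛΦ₁_eq 1
  have e20 := h.ΛΦ₂_eq 0
  have e21 := h.ΛΦ₂_eq 1
  have h1 := h.br00
  have h2 := h.br11
  have h3 := h.br22
  have hp := h.φ₃_sq
  -- By orthogonality the squared modulus of this determinant is `R₁²R₂²`.
  have hdet : Z 0 0 * Z 1 1 - Z 0 1 * Z 1 0 ≠ 0 := by
    intro hd
    have hd' := congrArg conj hd
    have o := h.orth
    refine mul_ne_zero h.r₁_ne h.r₂_ne ?_
    rw [← h1, ← h2]
    simp only [br_two, pow_zero, mul_one, map_sub, map_mul, map_zero] at o hd' ⊢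
    linear_combination (Z 0 0 * Z 1 1 - Z 0 1 * Z 1 0) * hd'
      + (Z 0 0 * conj (Z 1 0) + Z 0 1 * conj (Z 1 1)) * o
  -- `det M` in the standard basis and in the basis `Φ₁, Φ₂`, compared through `det(MΦ₁, MΦ₂) = det
  -- M · det(Φ₁, Φ₂)`.
  have hM : (c.R₁ : ℂ) ^ 2 * (c.R₂ : ℂ) ^ 2 * (c.lam * c.mu
        + c.lam * (Z 2 1 * conj (Z 2 1)) + c.mu * (Z 2 0 * conj (Z 2 0)))
      = (c.R₁ : ℂ) ^ 2 * (c.R₂ : ℂ) ^ 2 * c.K * c.K₂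
        - cross c.eig Z * conj (cross c.eig Z) := by
    refine mul_right_cancel₀ hdet ?_
    generalize cross c.eig Z = s at *
    simp only [eig, Matrix.cons_val_zero, Matrix.cons_val_one] at e10 e11 e20 e21
    have hx : (c.lam * c.mu + c.lam * (Z 2 1 * conj (Z 2 1)) + c.mu * (Z 2 0 * conj (Z 2 0)))
        * (Z 0 0 * Z 1 1 - Z 0 1 * Z 1 0)
        = (c.lam * Z 0 0 + f c.eig Z * Z 2 0) * (c.mu * Z 1 1 + g c.eig Z * Z 2 1)
          - (c.mu * Z 0 1 + f c.eig Z * Z 2 1) * (c.lam * Z 1 0 + g c.eig Z * Z 2 0) := by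
      simp only [f, g, br_two, pow_zero, mul_one]; ring
    simp only [eig] at hx
    generalize f ![c.lam, c.mu] Z = w at *
    generalize g ![c.lam, c.mu] Z = w' at *
    linear_combination (c.R₁ : ℂ) ^ 2 * (c.R₂ : ℂ) ^ 2 * hx
      + (c.R₁ : ℂ) ^ 2 * (c.mu * Z 1 1 + w' * Z 2 1) * e10
      + ((c.R₂ : ℂ) ^ 2 * c.K * Z 0 0 + s * Z 1 0) * e21
      - (c.R₁ : ℂ) ^ 2 * (c.lam * Z 1 0 + w' * Z 2 0) * e11
      - ((c.R₂ : ℂ) ^ 2 * c.K * Z 0 1 + s * Z 1 1) * e20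
  simp only [br_two, pow_zero, mul_one, K₂, E, a] at h3 hM ⊢
  push_cast at h3 hM ⊢
  linear_combination hM - (c.R₁ : ℂ) ^ 2 * (c.R₂ : ℂ) ^ 2 * c.lam * h3
    + (c.R₂ : ℂ) ^ 2 * (c.lam - c.mu) * hp

/-- The first component of the field is `iMΦ₁ + uΦ₂`, and the expansion of `MΦ₁` makes `uΦ₂` equal
to `(2R₂²/b)(iMΦ₁ - iKΦ₁)`. Hence the factor is `1 + 2R₂²/b = γ₁`, and the rest is a phase rotation.
The other components are similar. -/
lemma fieldY_eq (j : Fin 3) (k : Fin 2) :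
    fieldY c.eig Z j k = c.γ₁ * fieldX c.eig Z j k + I * c.phaseY j * Z j k := by
  have hb := h.b_ne'
  have hr₁ := h.R₁_ne'
  have hr₂ := h.R₂_ne'
  have e1 := h.ΛΦ₁_eq k
  have e2 := h.ΛΦ₂_eq k
  have e3 := h.Φ₃_eq k
  have hγ : (c.γ₁ : ℂ) = ((c.R₁ : ℂ) ^ 2 + (c.R₂ : ℂ) ^ 2) / c.b := by
    rw [b_eq, γ₁]; push_cast; rfl
  rw [hγ]
  fin_cases j
  · simp [fieldX, fieldY, phaseY, h.u_eq]
    rw [b_eq] at *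
    linear_combination (norm := (field_simp; ring))
      (-2 * I / ((c.R₁ : ℂ) ^ 2 - (c.R₂ : ℂ) ^ 2)) * e1
  · simp [fieldX, fieldY, phaseY, h.u_eq, conj_ofNat]
    rw [b_eq] at *
    linear_combination (norm := (field_simp; ring))
      (-2 * I / ((c.R₁ : ℂ) ^ 2 - (c.R₂ : ℂ) ^ 2)) * e2
  · simp [fieldX, fieldY, phaseY]
    rw [b_eq] at *
    linear_combination (norm := (field_simp; ring))
      (2 * I / ((c.R₁ : ℂ) ^ 2 - (c.R₂ : ℂ) ^ 2)) * e3


omit h in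
lemma γ₂_eq : (c.γ₂ : ℂ) = 2 * ((c.R₁ : ℂ) ^ 4 + (c.R₂ : ℂ) ^ 4
      - ((c.R₁ : ℂ) ^ 2 + (c.R₂ : ℂ) ^ 2) * (c.K + c.K₂)) / c.b
    - 4 * (c.R₁ : ℂ) ^ 2 * (c.R₂ : ℂ) ^ 2 * (c.K₂ - c.K) / (c.b : ℂ) ^ 2 := by
  rw [b_eq, γ₂, K₂]; push_cast; ring

omit h in
lemma C₁₂_add_C₂₁_eq : c.C₁₂ + c.C₂₁ = 2 / c.b ^ 2 *
    ((c.R₂ ^ 4 + 2 * c.R₁ ^ 2 * c.R₂ ^ 2 - c.R₁ ^ 4)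
        * (c.E + c.b * c.mu - c.K * c.K₂ - c.b * c.K)
      + (c.R₁ ^ 4 + 2 * c.R₁ ^ 2 * c.R₂ ^ 2 - c.R₂ ^ 4)
        * (c.E + c.b * c.mu - c.K * c.K₂ - c.b * c.K + c.b * c.a)
      + 8 * c.R₁ ^ 2 * c.R₂ ^ 2 * c.K * c.K₂ - 2 * c.R₂ ^ 4 * c.K ^ 2
      - 2 * c.R₁ ^ 4 * c.K₂ ^ 2) := by
  simp only [C₁₂, C₂₁, Caux, E, K₂, a, b]; ring

/-- The `|φ₁|²`-terms of `cross_sq` and `f_sq` cancel in this combination. It trades the constant in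
the `t`-phases for field variables. -/
lemma E_eq : (c.E : ℂ) + c.b * c.mu - c.b * c.K
    = cross c.eig Z * conj (cross c.eig Z) / ((c.R₁ : ℂ) ^ 2 * (c.R₂ : ℂ) ^ 2)
      - c.b * (f c.eig Z * conj (f c.eig Z)) / (c.R₁ : ℂ) ^ 2 := by
  have hr₁ := h.R₁_ne'
  have hr₂ := h.R₂_ne'
  rw [h.cross_sq, h.f_sq]
  field_simp; ring

lemma fieldT_eq (j : Fin 3) (k : Fin 2) :
    fieldT c.eig Z j k = c.γ₂ * fieldX c.eig Z j k
      + I * (c.phaseT j + c.phaseEig * c.eig k) * Z j k := by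
  have hb := h.b_ne'
  have hr₁ := h.R₁_ne'
  have hr₂ := h.R₂_ne'
  have e1 := h.ΛΦ₁_eq k
  have e2 := h.ΛΦ₂_eq k
  have e3 := h.Φ₃_eq k
  have hu : (‖u c.eig Z‖ : ℂ) ^ 2 = 4 * (cross c.eig Z * conj (cross c.eig Z)) / (c.b : ℂ) ^ 2 := by
    rw [ofReal_norm_sq, h.u_eq]
    simp only [map_div₀, map_mul, conj_ofNat, conj_I, conj_ofReal]
    linear_combination (-4 * (cross c.eig Z * conj (cross c.eig Z)) / (c.b : ℂ) ^ 2) * I_sq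
  have hv₁ : (v₁ c.eig Z : ℂ) = 2 * (f c.eig Z * conj (f c.eig Z)) := by
    rw [v₁]; push_cast; rw [ofReal_norm_sq]
  have hv₂ : (v₂ c.eig Z : ℂ) = 2 * (g c.eig Z * conj (g c.eig Z)) := by
    rw [v₂]; push_cast; rw [ofReal_norm_sq]
  have hγ : (c.γ₁ : ℂ) = ((c.R₁ : ℂ) ^ 2 + (c.R₂ : ℂ) ^ 2) / c.b := by
    rw [b_eq, γ₁]; push_cast; rfl
  have ha : (c.a : ℂ) = f c.eig Z * conj (f c.eig Z) / (c.R₁ : ℂ) ^ 2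
      + g c.eig Z * conj (g c.eig Z) / (c.R₂ : ℂ) ^ 2 := by
    field_simp; linear_combination h.a_eq
  have hE := h.E_eq
  have hp₀ : (c.phaseT 0 : ℂ) = -2 * (c.K : ℂ) ^ 2 - c.γ₂ * c.K
      + 2 / (c.b : ℂ) ^ 2 * ((c.R₂ : ℂ) ^ 4 + 2 * (c.R₁ : ℂ) ^ 2 * (c.R₂ : ℂ) ^ 2 - (c.R₁ : ℂ) ^ 4)
        * (c.E + c.b * c.mu - c.b * c.K)
      + 2 / c.b * ((c.R₁ : ℂ) ^ 4 + (c.R₂ : ℂ) ^ 4) * c.K := by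
    simp [phaseT]
  have hp₁ : (c.phaseT 1 : ℂ) = c.phaseT 0 - 2 / (c.b : ℂ) ^ 2 *
      (((c.R₂ : ℂ) ^ 4 + 2 * (c.R₁ : ℂ) ^ 2 * (c.R₂ : ℂ) ^ 2 - (c.R₁ : ℂ) ^ 4)
          * (c.E + c.b * c.mu - c.b * c.K - c.K * c.K₂)
        + ((c.R₁ : ℂ) ^ 4 + 2 * (c.R₁ : ℂ) ^ 2 * (c.R₂ : ℂ) ^ 2 - (c.R₂ : ℂ) ^ 4)
          * (c.E + c.b * c.mu - c.b * c.K - c.K * c.K₂ + c.b * c.a)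
        + 8 * (c.R₁ : ℂ) ^ 2 * (c.R₂ : ℂ) ^ 2 * c.K * c.K₂ - 2 * (c.R₂ : ℂ) ^ 4 * (c.K : ℂ) ^ 2
        - 2 * (c.R₁ : ℂ) ^ 4 * (c.K₂ : ℂ) ^ 2) := by
    have : c.phaseT 1 = c.phaseT 0 - (c.C₁₂ + c.C₂₁) := rfl
    rw [this, C₁₂_add_C₂₁_eq]; push_cast; ring
  have hp₂ : (c.phaseT 2 : ℂ) = (c.R₁ : ℂ) ^ 2 * (2 * (c.R₁ : ℂ) ^ 2 - 4 * c.K - c.γ₂)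
      + c.phaseEig * (c.a - c.K) := by
    simp [phaseT]
  have hβ : (c.phaseEig : ℂ) = -(2 / c.b) * ((c.R₁ : ℂ) ^ 4 + (c.R₂ : ℂ) ^ 4) := by
    simp [phaseEig]
  have hfy := h.fy_eq
  have hgy := h.gy_eq
  have hfy' := congrArg conj hfy
  have hgy' := congrArg conj hgy
  have huy := h.uy_eq
  have huy' := congrArg conj huy
  have hu₀ := h.u_eq
  have hu₁ := h.conj_u_eq
  simp only [map_mul, map_add, map_sub, map_div₀, map_pow, conj_I, conj_ofReal, conj_ofNat,
    Complex.conj_conj] at hfy' hgy' huy'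
  rw [hE] at hp₀ hp₁
  rw [hγ] at hfy hgy hfy' hgy'
  rw [γ₂_eq] at hp₀ hp₂ ⊢
  fin_cases j
  · simp only [fieldT, fieldX, Fin.zero_eta, Matrix.cons_val_zero]
    rw [hu, hv₁, huy, hfy, hu₀, hp₀, hβ]
    rw [b_eq] at *
    exact fieldT_algebra₁ hr₁ hr₂ hb e1 e2 e3 rfl rfl rfl
  · simp only [fieldT, fieldX, Fin.mk_one, Matrix.cons_val_one, Matrix.cons_val_zero]
    rw [hu, hv₂, huy', hgy, hu₁, hp₁, hp₀, hβ, ha]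
    rw [b_eq] at *
    exact fieldT_algebra₂ hr₁ hr₂ hb e1 e2 e3 rfl rfl rfl rfl rfl
  · simp only [fieldT, fieldX, Fin.reduceFinMk, Matrix.cons_val]
    rw [hfy', hgy', hp₂, hβ, ha, ofReal_norm_sq, ofReal_norm_sq]
    rw [b_eq] at *
    exact fieldT_algebra₃ hr₁ hr₂ hb e1 e2 e3 rfl rfl rfl

end OnLevel
end DSParam

/-! ### Derivatives of the brackets along the flow with phase rotations. -/

namespace DSSystem

open Complex

/-- The derivative of `⟨Φ_i, Λᵐ Φ_j⟩` in the direction `V`. -/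
def brD (Λ : Fin 2 → ℝ) (Z V : Fin 3 → Fin 2 → ℂ) (i j : Fin 3) (m : ℕ) : ℂ :=
  conj (V i 0) * (Λ 0 : ℂ) ^ m * Z j 0 + conj (Z i 0) * (Λ 0 : ℂ) ^ m * V j 0
    + (conj (V i 1) * (Λ 1 : ℂ) ^ m * Z j 1 + conj (Z i 1) * (Λ 1 : ℂ) ^ m * V j 1)

/-- The vector field of the `x`-system, multiplied by `κ`, plus infinitesimal phase rotations. -/
def flowField (Λ : Fin 2 → ℝ) (κ : ℝ) (A : Fin 3 → ℝ) (B : ℝ) (Z : Fin 3 → Fin 2 → ℂ) :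
    Fin 3 → Fin 2 → ℂ :=
  fun j k => κ * fieldX Λ Z j k + I * (A j + B * Λ k) * Z j k

lemma _root_.HasDerivAt.complex_conj {z : ℝ → ℂ} {z' : ℂ} {s : ℝ} (h : HasDerivAt z z' s) :
    HasDerivAt (fun s => conj (z s)) (conj z') s := h.star

lemma hasDerivAt_br {Λ : Fin 2 → ℝ} {z : ℝ → Fin 3 → Fin 2 → ℂ} {V : Fin 3 → Fin 2 → ℂ} {s : ℝ}
    (hz : ∀ j k, HasDerivAt (fun s => z s j k) (V j k) s) (i j : Fin 3) (m : ℕ) :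
    HasDerivAt (fun s => br Λ (z s) i j m) (brD Λ (z s) V i j m) s := by
  simp only [br_two]
  have h := fun k => (((hz i k).complex_conj).mul_const ((Λ k : ℂ) ^ m)).mul (hz j k)
  exact ((h 0).add (h 1)).congr_deriv (by simp only [brD])

variable {Λ : Fin 2 → ℝ} {Z : Fin 3 → Fin 2 → ℂ} (κ : ℝ) (A : Fin 3 → ℝ) (B : ℝ)

lemma brD_self (j : Fin 3) : brD Λ Z (flowField Λ κ A B Z) j j 0 = 0 := by
  have h := inner_fieldX Λ Z j
  simp only [Fin.sum_univ_two] at h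
  simp only [brD, flowField, map_add, map_mul, conj_ofReal, conj_I, pow_zero, mul_one]
  linear_combination κ * h

lemma brD_orth : brD Λ Z (flowField Λ κ A B Z) 0 1 0 = I * (A 1 - A 0) * br Λ Z 0 1 0 := by
  simp [brD, flowField, fieldX, f, g, br_two]
  ring

/-- For each eigenvalue the `x`-system acts on the triple of components by `i` times a Hermitian
matrix, and the phase rotations are diagonal. This makes `G` an integral. -/
lemma brD_column : ∑ j, (conj (flowField Λ κ A B Z j 0) * Z j 0
    + conj (Z j 0) * flowField Λ κ A B Z j 0) = 0 := by
  simp [Fin.sum_univ_three, flowField, fieldX, f, g, br_two]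
  ring

/-- This makes `K` an integral: in general the rate of change is a combination of `⟨Φ₁, Φ₂⟩` and its
conjugate, which vanish. -/
lemma brD_energy (h : br Λ Z 0 1 0 = 0) :
    brD Λ Z (flowField Λ κ A B Z) 0 0 1
      + (brD Λ Z (flowField Λ κ A B Z) 0 2 0 * br Λ Z 2 0 0
        + br Λ Z 0 2 0 * brD Λ Z (flowField Λ κ A B Z) 2 0 0) = 0 := by
  have h' : br Λ Z 1 0 0 = 0 := by rw [← conj_br, h, map_zero]
  have e : brD Λ Z (flowField Λ κ A B Z) 0 0 1
      + (brD Λ Z (flowField Λ κ A B Z) 0 2 0 * br Λ Z 2 0 0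
        + br Λ Z 0 2 0 * brD Λ Z (flowField Λ κ A B Z) 2 0 0)
      = κ * I * (br Λ Z 2 0 0 * br Λ Z 1 2 0) * br Λ Z 0 1 0
        - κ * I * (br Λ Z 0 2 0 * br Λ Z 2 1 0) * br Λ Z 1 0 0 := by
    simp [brD, flowField, fieldX, f, g, br_two]
    ring
  rw [e, h, h']; ring

lemma brD_cross (h : br Λ Z 0 1 0 = 0) :
    brD Λ Z (flowField Λ κ A B Z) 1 0 1
      + (brD Λ Z (flowField Λ κ A B Z) 1 2 0 * br Λ Z 2 0 0
        + br Λ Z 1 2 0 * brD Λ Z (flowField Λ κ A B Z) 2 0 0)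
      = -κ * I * (br Λ Z 0 0 0 - br Λ Z 1 1 0) * (br Λ Z 1 2 0 * br Λ Z 2 0 0)
        + I * (A 0 - A 1) * cross Λ Z := by
  have h' : br Λ Z 1 0 0 = 0 := by rw [← conj_br, h, map_zero]
  have e : brD Λ Z (flowField Λ κ A B Z) 1 0 1
      + (brD Λ Z (flowField Λ κ A B Z) 1 2 0 * br Λ Z 2 0 0
        + br Λ Z 1 2 0 * brD Λ Z (flowField Λ κ A B Z) 2 0 0)
      = -κ * I * (br Λ Z 0 0 0 - br Λ Z 1 1 0) * (br Λ Z 1 2 0 * br Λ Z 2 0 0)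
        + I * (A 0 - A 1) * cross Λ Z
        + κ * I * (br Λ Z 2 0 0 * br Λ Z 0 2 0 - br Λ Z 2 1 0 * br Λ Z 1 2 0) * br Λ Z 1 0 0 := by
    simp [brD, flowField, fieldX, f, g, br_two, cross]
    ring
  rw [e, h']; ring

end DSSystem

/-! ### Conservation of the integrals; the variables `ρ`, `σ` and `φ₁φ̄₂` on a level set. -/

namespace DSParam

open Complex DSSystem

variable {c : DSParam} {Z : Fin 3 → Fin 2 → ℂ}

lemma integralsAt_of_complex (hR : c.R₁ ≠ 0) (h1 : br c.eig Z 0 0 0 = (c.R₁ : ℂ) ^ 2)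
    (h2 : br c.eig Z 1 1 0 = (c.R₂ : ℂ) ^ 2) (h3 : br c.eig Z 2 2 0 = (c.R₃ : ℂ) ^ 2)
    (hG : ∑ j, conj (Z j 0) * Z j 0 = c.G + (c.R₂ : ℂ) ^ 2)
    (hK : br c.eig Z 0 0 1 + br c.eig Z 0 2 0 * br c.eig Z 2 0 0 = c.K * (c.R₁ : ℂ) ^ 2) :
    c.IntegralsAt Z where
  R₁_eq := by
    rw [← ofReal_inj]; push_cast [ofReal_norm_sq]; rw [← h1, br_two]; ring
  R₂_eq := by
    rw [← ofReal_inj]; push_cast [ofReal_norm_sq]; rw [← h2, br_two]; ring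
  R₃_eq := by
    rw [← ofReal_inj]; push_cast [ofReal_norm_sq]; rw [← h3, br_two]; ring
  G_eq := by
    rw [Fin.sum_univ_three] at hG
    rw [← ofReal_inj]; push_cast [ofReal_norm_sq]; linear_combination hG
  K_eq := by
    rw [div_eq_iff (pow_ne_zero 2 (ofReal_ne_zero.2 hR)), hK]

lemma IntegralsAt.column (h : c.IntegralsAt Z) :
    ∑ j, conj (Z j 0) * Z j 0 = c.G + (c.R₂ : ℂ) ^ 2 := by
  have hG := congrArg (fun x : ℝ => (x : ℂ)) h.G_eq
  push_cast [ofReal_norm_sq] at hG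
  rw [Fin.sum_univ_three]; linear_combination hG

/-- `G` and `K` are constant along curves that are tangent to the `x`-field up to phase
rotations. -/
lemma integralsAt_of_flow {z : ℝ → Fin 3 → Fin 2 → ℂ} (hR : c.R₁ ≠ 0)
    (hz : ∀ s, ∃ κ A B, ∀ j k,
      HasDerivAt (fun s => z s j k) (flowField c.eig κ A B (z s) j k) s)
    (ho : ∀ s, br c.eig (z s) 0 1 0 = 0) (h0 : c.IntegralsAt (z 0)) (s : ℝ) :
    c.IntegralsAt (z s) := by
  have hconst : ∀ F : ℝ → ℂ, (∀ s, HasDerivAt F 0 s) → F s = F 0 := fun F hF =>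
    is_const_of_deriv_eq_zero (fun s => (hF s).differentiableAt) (fun s => (hF s).deriv) s 0
  have hself : ∀ j, br c.eig (z s) j j 0 = br c.eig (z 0) j j 0 := fun j =>
    hconst (fun s => br c.eig (z s) j j 0) fun s => by
      obtain ⟨κ, A, B, h⟩ := hz s
      exact (hasDerivAt_br h j j 0).congr_deriv (brD_self κ A B j)
  have h1 : br c.eig (z 0) 0 0 0 = (c.R₁ : ℂ) ^ 2 := by
    have := congrArg (fun x : ℝ => (x : ℂ)) h0.R₁_eq
    push_cast [ofReal_norm_sq] at this
    rw [br_two, ← this]; ring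
  have h2 : br c.eig (z 0) 1 1 0 = (c.R₂ : ℂ) ^ 2 := by
    have := congrArg (fun x : ℝ => (x : ℂ)) h0.R₂_eq
    push_cast [ofReal_norm_sq] at this
    rw [br_two, ← this]; ring
  have h3 : br c.eig (z 0) 2 2 0 = (c.R₃ : ℂ) ^ 2 := by
    have := congrArg (fun x : ℝ => (x : ℂ)) h0.R₃_eq
    push_cast [ofReal_norm_sq] at this
    rw [br_two, ← this]; ring
  refine integralsAt_of_complex hR ((hself 0).trans h1) ((hself 1).trans h2)
    ((hself 2).trans h3) ?_ ?_
  · rw [← h0.column]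
    refine hconst (fun s => ∑ j, conj (z s j 0) * z s j 0) fun s => ?_
    obtain ⟨κ, A, B, h⟩ := hz s
    refine (HasDerivAt.fun_sum fun j _ => (h j 0).complex_conj.mul (h j 0)).congr_deriv ?_
    exact brD_column κ A B
  · have := h0.K_eq
    rw [div_eq_iff (pow_ne_zero 2 (ofReal_ne_zero.2 hR))] at this
    rw [← this]
    refine hconst (fun s => br c.eig (z s) 0 0 1 + br c.eig (z s) 0 2 0 * br c.eig (z s) 2 0 0)
      fun s => ?_
    obtain ⟨κ, A, B, h⟩ := hz s
    exact ((hasDerivAt_br h 0 0 1).add ((hasDerivAt_br h 0 2 0).mul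
      (hasDerivAt_br h 2 0 0))).congr_deriv (brD_energy κ A B (ho s))

/-- `φ₁ φ̄₂`. -/
def prodφ (Z : Fin 3 → Fin 2 → ℂ) : ℂ := Z 0 0 * conj (Z 1 0)

/-- `ρ = |φ₁|² / R₁²`. -/
def rhoAt (c : DSParam) (Z : Fin 3 → Fin 2 → ℂ) : ℝ := ‖Z 0 0‖ ^ 2 / c.R₁ ^ 2

/-- The value of `ρ_x`. -/
def sigAt (c : DSParam) (Z : Fin 3 → Fin 2 → ℂ) : ℝ :=
  c.b / (c.R₁ ^ 2 * c.R₂ ^ 2) * (u c.eig Z * conj (prodφ Z)).re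

namespace OnLevel

variable (h : c.OnLevel Z)
include h

lemma R₁_sq_pos : 0 < c.R₁ ^ 2 := sq_pos_of_ne_zero h.R₁_ne
lemma R₂_sq_pos : 0 < c.R₂ ^ 2 := sq_pos_of_ne_zero h.R₂_ne

lemma φ₁_norm_sq : ‖Z 0 0‖ ^ 2 = c.R₁ ^ 2 * c.rhoAt Z := by
  rw [rhoAt, mul_div_cancel₀ _ h.R₁_sq_pos.ne']

lemma φ₁_mul_conj : Z 0 0 * conj (Z 0 0) = (c.R₁ : ℂ) ^ 2 * c.rhoAt Z := by
  rw [← ofReal_norm_sq]; exact_mod_cast congrArg (fun x : ℝ => (x : ℂ)) h.φ₁_norm_sq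

lemma φ₂_mul_conj : Z 1 0 * conj (Z 1 0) = (c.R₂ : ℂ) ^ 2 * (1 - c.rhoAt Z) := by
  refine mul_left_cancel₀ h.r₁_ne ?_
  rw [h.φ₂_sq, h.φ₁_mul_conj]; ring

lemma φ₃_mul_conj : Z 2 0 * conj (Z 2 0) = c.G - c.b * c.rhoAt Z := by
  refine mul_left_cancel₀ h.r₁_ne ?_
  rw [h.φ₃_sq, h.φ₁_mul_conj]; ring

lemma φ₂_norm_sq : ‖Z 1 0‖ ^ 2 = c.R₂ ^ 2 * (1 - c.rhoAt Z) := by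
  rw [← ofReal_inj]; push_cast; rw [ofReal_norm_sq, h.φ₂_mul_conj]

lemma φ₃_norm_sq : ‖Z 2 0‖ ^ 2 = c.G - c.b * c.rhoAt Z := by
  rw [← ofReal_inj]; push_cast; rw [ofReal_norm_sq, h.φ₃_mul_conj]

omit h in
lemma rhoAt_nonneg : 0 ≤ c.rhoAt Z := div_nonneg (sq_nonneg _) (sq_nonneg _)

lemma rhoAt_le_one : c.rhoAt Z ≤ 1 := by
  have := h.φ₂_norm_sq
  by_contra hlt
  have := mul_neg_of_pos_of_neg h.R₂_sq_pos (sub_neg.2 (not_le.1 hlt))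
  linarith [sq_nonneg ‖Z 1 0‖]

lemma G_sub_nonneg : 0 ≤ c.G - c.b * c.rhoAt Z := h.φ₃_norm_sq ▸ sq_nonneg _

lemma a_sub_G_add_nonneg : 0 ≤ c.a - c.G + c.b * c.rhoAt Z := by
  have h1 := h.integrals.R₃_eq
  have h2 := h.φ₃_norm_sq
  rw [a]; linarith [sq_nonneg ‖Z 2 1‖]

lemma v₁_eq : v₁ c.eig Z = 2 * c.R₁ ^ 2 * ((c.mu - c.lam) * c.rhoAt Z + c.K - c.mu) := by
  rw [v₁, ← ofReal_inj]; push_cast; rw [ofReal_norm_sq, h.f_sq, h.φ₁_mul_conj]; ring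

lemma v₂_eq : v₂ c.eig Z = 2 * c.R₂ ^ 2 * ((c.lam - c.mu) * c.rhoAt Z - c.K + c.mu + c.a) := by
  rw [v₂, ← ofReal_inj]; push_cast; rw [ofReal_norm_sq]
  refine mul_left_cancel₀ h.r₁_ne ?_
  linear_combination 2 * h.g_sq + 2 * (c.R₂ : ℂ) ^ 2 * (c.lam - c.mu) * h.φ₁_mul_conj

lemma u_mul_conj : u c.eig Z * conj (u c.eig Z)
    = 4 * (c.R₁ : ℂ) ^ 2 * (c.R₂ : ℂ) ^ 2 / (c.b : ℂ) ^ 2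
      * (c.E - c.b * (c.lam - c.mu) * c.rhoAt Z) := by
  have hb := h.b_ne'
  have hs := h.cross_sq
  rw [h.φ₁_mul_conj] at hs
  rw [h.conj_u_eq, h.u_eq]
  field_simp
  linear_combination (-4 * cross c.eig Z * conj (cross c.eig Z)) * I_sq + 4 * hs

lemma u_norm_sq : ‖u c.eig Z‖ ^ 2
    = 4 * c.R₁ ^ 2 * c.R₂ ^ 2 / c.b ^ 2 * (c.E - c.b * (c.lam - c.mu) * c.rhoAt Z) := by
  rw [← ofReal_inj]; push_cast; rw [ofReal_norm_sq, h.u_mul_conj]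

lemma prodφ_mul_conj : prodφ Z * conj (prodφ Z)
    = (c.R₁ : ℂ) ^ 2 * (c.R₂ : ℂ) ^ 2 * (c.rhoAt Z * (1 - c.rhoAt Z)) := by
  rw [prodφ, map_mul, Complex.conj_conj]
  linear_combination Z 1 0 * conj (Z 1 0) * h.φ₁_mul_conj
    + (c.R₁ : ℂ) ^ 2 * c.rhoAt Z * h.φ₂_mul_conj

/-- The top-left entry of `M` in two ways: it is `λ + |φ₃|²`, and the expansions of `MΦ₁` and `MΦ₂`
give `Kρ + K₂(1 - ρ)` plus the left side divided by `R₁²R₂²`. -/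
lemma cross_mul_conj_prodφ : cross c.eig Z * conj (prodφ Z) + conj (cross c.eig Z) * prodφ Z
    = -(c.R₁ : ℂ) ^ 2 * (c.R₂ : ℂ) ^ 2 * c.Y (c.rhoAt Z) := by
  have e1 := h.ΛΦ₁_eq 0
  have e2 := h.ΛΦ₂_eq 0
  have e3 := congrArg conj (h.Φ₃_eq 0)
  have p1 := h.φ₁_mul_conj
  have p2 := h.φ₂_mul_conj
  have p3 := h.φ₃_mul_conj
  simp only [map_mul, map_add, map_pow, conj_ofReal, Complex.conj_conj, eig, Matrix.cons_val_zero]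
    at e1 e2 e3
  simp only [prodφ, map_mul, Complex.conj_conj, Y, eig, K₂] at *
  generalize cross ![c.lam, c.mu] Z = s at *
  generalize f ![c.lam, c.mu] Z = x at *
  generalize g ![c.lam, c.mu] Z = y at *
  simp only [a, b] at *
  push_cast at *
  linear_combination -conj (Z 0 0) * e1 - conj (Z 1 0) * e2 - Z 2 0 * e3
    + (c.R₂ : ℂ) ^ 2 * (c.lam - c.K) * p1
    + (c.R₁ : ℂ) ^ 2 * (c.lam - (c.R₃ ^ 2 + c.lam + c.mu - c.K)) * p2
    + (c.R₁ : ℂ) ^ 2 * (c.R₂ : ℂ) ^ 2 * p3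

/-- The real part is the definition of `sigAt`, the imaginary part comes from
`cross_mul_conj_prodφ`. Divided by `|φ₁φ̄₂|²`, this becomes the factor `Y - i√P` of the explicit
`u`. -/
lemma u_mul_conj_prodφ : u c.eig Z * conj (prodφ Z)
    = (c.R₁ : ℂ) ^ 2 * (c.R₂ : ℂ) ^ 2 / c.b * (c.sigAt Z - I * c.Y (c.rhoAt Z)) := by
  have hb := h.b_ne
  have h1 := h.R₁_ne
  have h2 := h.R₂_ne
  have hre : (u c.eig Z * conj (prodφ Z)).re = c.R₁ ^ 2 * c.R₂ ^ 2 / c.b * c.sigAt Z := by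
    rw [sigAt]; field_simp
  have him : (u c.eig Z * conj (prodφ Z)).im = -(c.R₁ ^ 2 * c.R₂ ^ 2 / c.b * c.Y (c.rhoAt Z)) := by
    have e := h.cross_mul_conj_prodφ
    have e' : cross c.eig Z * conj (prodφ Z) + conj (cross c.eig Z) * prodφ Z
        = ((2 * (cross c.eig Z * conj (prodφ Z)).re : ℝ) : ℂ) := by
      rw [← Complex.add_conj, map_mul, Complex.conj_conj]
    rw [e'] at e
    have e2 : 2 * (cross c.eig Z * conj (prodφ Z)).re
        = -c.R₁ ^ 2 * c.R₂ ^ 2 * c.Y (c.rhoAt Z) := by exact_mod_cast e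
    have e3 : u c.eig Z * conj (prodφ Z)
        = ((2 / c.b : ℝ) : ℂ) * (I * (cross c.eig Z * conj (prodφ Z))) := by
      rw [h.u_eq]; push_cast; ring
    rw [e3, Complex.im_ofReal_mul, Complex.I_mul_im]
    field_simp
    linear_combination e2
  apply Complex.ext
  · rw [hre]
    rw [show (c.R₁ : ℂ) ^ 2 * (c.R₂ : ℂ) ^ 2 / c.b * (c.sigAt Z - I * c.Y (c.rhoAt Z))
      = ((c.R₁ ^ 2 * c.R₂ ^ 2 / c.b : ℝ) : ℂ) * (c.sigAt Z - I * c.Y (c.rhoAt Z)) by push_cast; ring,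
      Complex.re_ofReal_mul]
    simp
  · rw [him]
    rw [show (c.R₁ : ℂ) ^ 2 * (c.R₂ : ℂ) ^ 2 / c.b * (c.sigAt Z - I * c.Y (c.rhoAt Z))
      = ((c.R₁ ^ 2 * c.R₂ ^ 2 / c.b : ℝ) : ℂ) * (c.sigAt Z - I * c.Y (c.rhoAt Z)) by push_cast; ring,
      Complex.im_ofReal_mul]
    simp

/-- Take squared moduli in `u_mul_conj_prodφ` and insert `|u|²` and `|φ₁φ̄₂|²`; the `Y`-form of `P`
appears. -/
lemma sigAt_sq : c.sigAt Z ^ 2 = c.P (c.rhoAt Z) := by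
  have e := h.u_mul_conj_prodφ
  have e' := congrArg conj e
  have h1 := h.u_mul_conj
  have h2 := h.prodφ_mul_conj
  have hb := h.b_ne'
  simp only [map_mul, map_sub, map_div₀, map_pow, conj_ofReal, conj_I, Complex.conj_conj] at e'
  have key : (c.b : ℂ) ^ 2 * ((u c.eig Z * conj (prodφ Z)) * (conj (u c.eig Z) * prodφ Z))
      = (c.R₁ : ℂ) ^ 4 * (c.R₂ : ℂ) ^ 4 * (4 * (c.rhoAt Z * (1 - c.rhoAt Z))
        * (c.E - c.b * (c.lam - c.mu) * c.rhoAt Z)) := by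
    rw [show (u c.eig Z * conj (prodφ Z)) * (conj (u c.eig Z) * prodφ Z)
      = (u c.eig Z * conj (u c.eig Z)) * (prodφ Z * conj (prodφ Z)) by ring, h1, h2]
    field_simp
  rw [e, e'] at key
  have hne : (c.R₁ : ℂ) ^ 4 * (c.R₂ : ℂ) ^ 4 ≠ 0 :=
    mul_ne_zero (pow_ne_zero 4 h.R₁_ne') (pow_ne_zero 4 h.R₂_ne')
  have : ((c.sigAt Z : ℂ)) ^ 2 = ((c.P (c.rhoAt Z) : ℝ) : ℂ) := by
    refine mul_left_cancel₀ hne ?_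
    rw [P_eq_sub_Y_sq]
    push_cast
    field_simp at key
    linear_combination key + ((c.R₁ : ℂ) ^ 4 * (c.R₂ : ℂ) ^ 4 * (c.Y (c.rhoAt Z)) ^ 2) * I_sq
  exact_mod_cast this

end OnLevel
end DSParam

/-! ### Differential equations for `u`, `φ₁φ̄₂`, `ρ` and `σ` along curves. -/

namespace DSParam

open Complex DSSystem

variable {c : DSParam}

namespace OnLevel

variable {Z : Fin 3 → Fin 2 → ℂ} (h : c.OnLevel Z)
include h

lemma fieldX_zero (k : Fin 2) : fieldX c.eig Z 0 k
    = I * c.K * Z 0 k + c.b / (2 * (c.R₂ : ℂ) ^ 2) * u c.eig Z * Z 1 k := by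
  have hr := h.R₂_ne'
  have hb := h.b_ne'
  have e := h.ΛΦ₁_eq k
  rw [h.u_eq]
  simp only [fieldX, Matrix.cons_val_zero]
  linear_combination (norm := (field_simp; ring)) I / (c.R₂ : ℂ) ^ 2 * e

lemma fieldX_one (k : Fin 2) : fieldX c.eig Z 1 k
    = I * c.K₂ * Z 1 k - c.b / (2 * (c.R₁ : ℂ) ^ 2) * conj (u c.eig Z) * Z 0 k := by
  have hr := h.R₁_ne'
  have hb := h.b_ne'
  have e := h.ΛΦ₂_eq k
  rw [h.conj_u_eq]
  simp only [fieldX, Matrix.cons_val_one, Matrix.cons_val_zero]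
  linear_combination (norm := (field_simp; ring)) I / (c.R₁ : ℂ) ^ 2 * e

/-- `⟨Φ₂, ΛΦ₁⟩` reduces to `(λ - μ)φ₁φ̄₂` after subtracting `μ⟨Φ₂, Φ₁⟩ = 0`. -/
lemma mul_conj_eq : br c.eig Z 1 2 0 * br c.eig Z 2 0 0
    = cross c.eig Z - (c.lam - c.mu) * prodφ Z := by
  have o := h.orth'
  rw [cross]
  simp only [br_two, eig, pow_one, pow_zero, mul_one, Matrix.cons_val_zero, Matrix.cons_val_one,
    prodφ] at *
  linear_combination -c.mu * o

end OnLevel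

section Curve

variable {z : ℝ → Fin 3 → Fin 2 → ℂ} {s κ B : ℝ} {A : Fin 3 → ℝ}
  (hl : ∀ s, c.OnLevel (z s))
  (hz : ∀ j k, HasDerivAt (fun s => z s j k) (flowField c.eig κ A B (z s) j k) s)
include hl hz

/-- Together with the next lemma this is a closed linear system for `u` and `φ₁φ̄₂`, whose only
variable coefficient is `1 - 2ρ`. Both quantities rotate with the same phase rate `A 0 - A 1`. -/
lemma hasDerivAt_u_curve : HasDerivAt (fun s => u c.eig (z s))
    (κ * (-I * c.b * u c.eig (z s) - 2 * (c.lam - c.mu) * prodφ (z s))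
      + I * (A 0 - A 1) * u c.eig (z s)) s := by
  have e : (fun s => u c.eig (z s)) = fun s => 2 * I / c.b * (br c.eig (z s) 1 0 1
      + br c.eig (z s) 1 2 0 * br c.eig (z s) 2 0 0) := by
    funext s; rw [(hl s).u_eq, cross]; ring
  rw [e]
  refine (((hasDerivAt_br hz 1 0 1).add ((hasDerivAt_br hz 1 2 0).mul
    (hasDerivAt_br hz 2 0 0))).const_mul (2 * I / c.b : ℂ)).congr_deriv ?_
  rw [brD_cross κ A B (hl s).orth, (hl s).br_sub, (hl s).mul_conj_eq, (hl s).u_eq]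
  have hb := (hl s).b_ne'
  field_simp
  linear_combination κ * (c.b : ℂ) * (c.lam - c.mu) * prodφ (z s) * I_sq

lemma hasDerivAt_prodφ_curve : HasDerivAt (fun s => prodφ (z s))
    (κ * (I * (c.K - c.K₂) * prodφ (z s)
        + c.b / 2 * (1 - 2 * c.rhoAt (z s)) * u c.eig (z s))
      + I * (A 0 - A 1) * prodφ (z s)) s := by
  refine ((hz 0 0).mul (hz 1 0).complex_conj).congr_deriv ?_
  have h1 := (hl s).R₁_ne'
  have h2 := (hl s).R₂_ne'
  have p1 := (hl s).φ₁_mul_conj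
  have p2 := (hl s).φ₂_mul_conj
  simp only [flowField]
  rw [(hl s).fieldX_zero, (hl s).fieldX_one]
  simp only [prodφ, map_add, map_sub, map_mul, map_div₀, map_pow, conj_ofReal, conj_I,
    Complex.conj_conj, conj_ofNat]
  linear_combination (norm := (field_simp; ring))
    κ * c.b / (2 * (c.R₂ : ℂ) ^ 2) * u c.eig (z s) * p2
      - κ * c.b / (2 * (c.R₁ : ℂ) ^ 2) * u c.eig (z s) * p1

lemma hasDerivAt_rhoAt_curve : HasDerivAt (fun s => c.rhoAt (z s)) (κ * c.sigAt (z s)) s := by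
  have h1 := (hl s).R₁_ne
  have h2 := (hl s).R₂_ne
  have e : (fun s => c.rhoAt (z s)) = fun s => (z s 0 0 * conj (z s 0 0)).re / c.R₁ ^ 2 := by
    funext s; rw [rhoAt, ← ofReal_norm_sq]; norm_cast
  rw [e]
  have hd := ((hz 0 0).mul (hz 0 0).complex_conj)
  refine ((Complex.reCLM.hasFDerivAt.comp_hasDerivAt s hd).div_const (c.R₁ ^ 2)).congr_deriv ?_
  have e2 : flowField c.eig κ A B (z s) 0 0 * conj (z s 0 0)
      + z s 0 0 * conj (flowField c.eig κ A B (z s) 0 0)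
      = ((κ * (c.b / (2 * c.R₂ ^ 2) * (2 * (u c.eig (z s) * conj (prodφ (z s))).re)) : ℝ) : ℂ) := by
    push_cast
    rw [← Complex.ofReal_ofNat, ← Complex.ofReal_mul, ← Complex.add_conj]
    simp only [flowField]
    rw [(hl s).fieldX_zero]
    simp only [prodφ, map_add, map_mul, map_div₀, map_pow, conj_ofReal, conj_I,
      Complex.conj_conj, conj_ofNat]
    push_cast
    ring
  rw [e2, Complex.reCLM_apply, Complex.ofReal_re, sigAt]
  field_simp

lemma hasDerivAt_sigAt_curve :
    HasDerivAt (fun s => c.sigAt (z s)) (κ * c.halfDerivP (c.rhoAt (z s))) s := by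
  have h1 := (hl s).R₁_ne
  have h2 := (hl s).R₂_ne
  have hb := (hl s).b_ne
  have hd := (hasDerivAt_u_curve hl hz).mul (hasDerivAt_prodφ_curve hl hz).complex_conj
  refine ((Complex.reCLM.hasFDerivAt.comp_hasDerivAt s hd).const_mul
    (c.b / (c.R₁ ^ 2 * c.R₂ ^ 2))).congr_deriv ?_
  have hu := (hl s).u_mul_conj
  have hp := (hl s).prodφ_mul_conj
  have hup := (hl s).u_mul_conj_prodφ
  have hb' := (hl s).b_ne'
  set r := c.rhoAt (z s)
  set Y₁ := 2 * c.K - c.lam - c.mu - c.a + c.b with hY₁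
  -- The phase rates cancel in the product. It is split into real and imaginary parts, and only the
  -- real part enters `σ'`.
  have e : (κ * (-I * c.b * u c.eig (z s) - 2 * (c.lam - c.mu) * prodφ (z s))
        + I * (A 0 - A 1) * u c.eig (z s)) * conj (prodφ (z s))
      + u c.eig (z s) * conj (κ * (I * (c.K - c.K₂) * prodφ (z s)
        + c.b / 2 * (1 - 2 * r) * u c.eig (z s)) + I * (A 0 - A 1) * prodφ (z s))
      = ((κ * (-2 * (c.lam - c.mu) * (c.R₁ ^ 2 * c.R₂ ^ 2 * (r * (1 - r)))
          - Y₁ * (c.R₁ ^ 2 * c.R₂ ^ 2 / c.b) * c.Y r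
          + c.b / 2 * (1 - 2 * r) * (4 * c.R₁ ^ 2 * c.R₂ ^ 2 / c.b ^ 2
            * (c.E - c.b * (c.lam - c.mu) * r))) : ℝ) : ℂ)
        + I * ((-κ * Y₁ * (c.R₁ ^ 2 * c.R₂ ^ 2 / c.b) * c.sigAt (z s) : ℝ) : ℂ) := by
    simp only [map_add, map_sub, map_mul, map_div₀, map_one, conj_ofReal, conj_I,
      conj_ofNat, hY₁, K₂, a]
    push_cast
    linear_combination (-2 * κ * (c.lam - c.mu) : ℂ) * hp
      + (κ * (-I * (2 * c.K - c.lam - c.mu - c.R₃ ^ 2 + c.b)) : ℂ) * hup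
      + (κ * (c.b / 2 * (1 - 2 * r)) : ℂ) * hu
      + (κ * (2 * c.K - c.lam - c.mu - c.R₃ ^ 2 + c.b) * (c.R₁ ^ 2 * c.R₂ ^ 2 / c.b)
        * c.Y r : ℂ) * I_sq
  rw [e, Complex.reCLM_apply, Complex.add_re, Complex.ofReal_re, Complex.I_mul_re,
    Complex.ofReal_im, halfDerivP]
  field_simp
  ring

end Curve
end DSParam

/-! ### Solutions restricted to rays from the origin. -/

namespace DSSystem

open Complex

variable {Λ : Fin 2 → ℝ} {Φ : ℝ → ℝ → ℝ → Fin 3 → Fin 2 → ℂ}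

/-- The derivative of a solution along a line through the origin. -/
lemma IsSolution.hasDerivAt_ray (h : IsSolution Λ Φ) (x y t s : ℝ) :
    HasDerivAt (fun s => Φ (s * x) (s * y) (s * t))
      (x • fieldX Λ (Φ (s * x) (s * y) (s * t)) + y • fieldY Λ (Φ (s * x) (s * y) (s * t))
        + t • fieldT Λ (Φ (s * x) (s * y) (s * t))) s := by
  set F : ℝ × ℝ × ℝ → Fin 3 → Fin 2 → ℂ := fun w => Φ w.1 w.2.1 w.2.2
  have hF : HasFDerivAt F (fderiv ℝ F (s * x, s * y, s * t)) (s * x, s * y, s * t) :=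
    (h.smooth.differentiable (by simp)).differentiableAt.hasFDerivAt
  set L := fderiv ℝ F (s * x, s * y, s * t)
  have hX : L (1, 0, 0) = fieldX Λ (Φ (s * x) (s * y) (s * t)) := by
    have hc : HasDerivAt (fun r : ℝ => (r, s * y, s * t)) ((1 : ℝ), (0 : ℝ), (0 : ℝ)) (s * x) :=
      (hasDerivAt_id _).prodMk (hasDerivAt_const _ _)
    have hd : HasDerivAt (fun r => Φ r (s * y) (s * t)) (L (1, 0, 0)) (s * x) :=
      HasFDerivAt.comp_hasDerivAt (l := F) (s * x) hF hc
    exact hd.unique (h.eq_x _ _ _)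
  have hY : L (0, 1, 0) = fieldY Λ (Φ (s * x) (s * y) (s * t)) := by
    have hc : HasDerivAt (fun r : ℝ => (s * x, r, s * t)) ((0 : ℝ), (1 : ℝ), (0 : ℝ)) (s * y) :=
      (hasDerivAt_const _ _).prodMk ((hasDerivAt_id _).prodMk (hasDerivAt_const _ _))
    have hd : HasDerivAt (fun r => Φ (s * x) r (s * t)) (L (0, 1, 0)) (s * y) :=
      HasFDerivAt.comp_hasDerivAt (l := F) (s * y) hF hc
    exact hd.unique (h.eq_y _ _ _)
  have hT : L (0, 0, 1) = fieldT Λ (Φ (s * x) (s * y) (s * t)) := by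
    have hc : HasDerivAt (fun r : ℝ => (s * x, s * y, r)) ((0 : ℝ), (0 : ℝ), (1 : ℝ)) (s * t) :=
      (hasDerivAt_const _ _).prodMk ((hasDerivAt_const _ _).prodMk (hasDerivAt_id _))
    have hd : HasDerivAt (fun r => Φ (s * x) (s * y) r) (L (0, 0, 1)) (s * t) :=
      HasFDerivAt.comp_hasDerivAt (l := F) (s * t) hF hc
    exact hd.unique (h.eq_t _ _ _)
  have hc : HasDerivAt (fun s : ℝ => (s * x, s * y, s * t)) (x, y, t) s := by
    refine HasDerivAt.prodMk ?_ (HasDerivAt.prodMk ?_ ?_)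
    · simpa using (hasDerivAt_id s).mul_const x
    · simpa using (hasDerivAt_id s).mul_const y
    · simpa using (hasDerivAt_id s).mul_const t
  refine (hF.comp_hasDerivAt s hc).congr_deriv ?_
  rw [← hX, ← hY, ← hT, ← map_smul, ← map_smul, ← map_smul, ← map_add, ← map_add]
  simp

/-- `⟨Φ_j, Φ_j⟩` is constant along solutions. -/
lemma IsSolution.br_self_const (h : IsSolution Λ Φ) (x y t : ℝ) (j : Fin 3) :
    br Λ (Φ x y t) j j 0 = br Λ (Φ 0 0 0) j j 0 := by
  set z : ℝ → Fin 3 → Fin 2 → ℂ := fun s => Φ (s * x) (s * y) (s * t) with hz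
  have hd : ∀ s, HasDerivAt (fun s => br Λ (z s) j j 0) 0 s := fun s => by
    have hc := fun j k => hasDerivAt_pi.1 (hasDerivAt_pi.1 (h.hasDerivAt_ray x y t s) j) k
    refine (hasDerivAt_br hc j j 0).congr_deriv ?_
    have h1 := inner_fieldX Λ (z s) j
    have h2 := inner_fieldY (h.constraint (s * x) (s * y) (s * t)) j
    have h3 := inner_fieldT (h.constraint (s * x) (s * y) (s * t))
      (h.nondegenerate (s * x) (s * y) (s * t)) j
    simp only [Fin.sum_univ_two, hz] at h1 h2 h3
    simp only [brD, Pi.add_apply, Pi.smul_apply, real_smul, map_add, map_mul, conj_ofReal,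
      pow_zero, mul_one]
    linear_combination (x : ℂ) * h1 + (y : ℂ) * h2 + (t : ℂ) * h3
  have := is_const_of_deriv_eq_zero (fun s => (hd s).differentiableAt) (fun s => (hd s).deriv) 1 0
  simpa [hz] using this

end DSSystem

namespace DSParam

open Complex DSSystem

variable {c : DSParam}

lemma OnLevel.field_eq_flowField {Z : Fin 3 → Fin 2 → ℂ} (h : c.OnLevel Z) (x y t : ℝ) :
    x • fieldX c.eig Z + y • fieldY c.eig Z + t • fieldT c.eig Z
      = flowField c.eig (x + c.γ₁ * y + c.γ₂ * t) (fun j => y * c.phaseY j + t * c.phaseT j)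
        (t * c.phaseEig) Z := by
  funext j k
  simp only [Pi.add_apply, Pi.smul_apply, real_smul, h.fieldY_eq, h.fieldT_eq, flowField]
  push_cast
  ring

/-- Every phase point lies on some level of `G` and `K`. -/
lemma exists_onLevel (hR₁ : c.R₁ ≠ 0) (hR₂ : c.R₂ ≠ 0) (hb : c.b ≠ 0) {Z : Fin 3 → Fin 2 → ℂ}
    (ho : br c.eig Z 0 1 0 = 0) (h1 : br c.eig Z 0 0 0 = (c.R₁ : ℂ) ^ 2)
    (h2 : br c.eig Z 1 1 0 = (c.R₂ : ℂ) ^ 2) (h3 : br c.eig Z 2 2 0 = (c.R₃ : ℂ) ^ 2) :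
    ∃ G K : ℝ, ({ c with G := G, K := K } : DSParam).OnLevel Z := by
  refine ⟨‖Z 0 0‖ ^ 2 + ‖Z 1 0‖ ^ 2 + ‖Z 2 0‖ ^ 2 - c.R₂ ^ 2,
    (br c.eig Z 0 0 1 + br c.eig Z 0 2 0 * br c.eig Z 2 0 0).re / c.R₁ ^ 2,
    hR₁, hR₂, hb, ho, ?_⟩
  refine integralsAt_of_complex hR₁ h1 h2 h3 ?_ ?_
  · push_cast [ofReal_norm_sq]
    rw [Fin.sum_univ_three]; ring
  · have hr : conj (br c.eig Z 0 0 1 + br c.eig Z 0 2 0 * br c.eig Z 2 0 0)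
        = br c.eig Z 0 0 1 + br c.eig Z 0 2 0 * br c.eig Z 2 0 0 := by
      rw [map_add, map_mul, conj_br, conj_br, conj_br]; ring
    have hne : (c.R₁ : ℂ) ≠ 0 := ofReal_ne_zero.2 hR₁
    change br c.eig Z 0 0 1 + br c.eig Z 0 2 0 * br c.eig Z 2 0 0 = _
    rw [← conj_eq_iff_re.1 hr]
    push_cast
    field_simp
    rw [Complex.ofReal_re]

variable (hc : c.Admissible) {Φ : ℝ → ℝ → ℝ → Fin 3 → Fin 2 → ℂ}
  (hΦ : IsSolution c.eig Φ) (h0 : c.IntegralsAt (Φ 0 0 0))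
include hc

lemma Admissible.onLevel {Z : Fin 3 → Fin 2 → ℂ} (ho : br c.eig Z 0 1 0 = 0)
    (h : c.IntegralsAt Z) : c.OnLevel Z :=
  ⟨hc.R₁_pos.ne', hc.R₂_pos.ne', hc.b_pos.ne', ho, h⟩

include hΦ h0

/-- The integrals are constant along solutions. -/
lemma onLevel_of_isSolution (x y t : ℝ) : c.OnLevel (Φ x y t) := by
  have hl := hc.onLevel (hΦ.constraint 0 0 0) h0
  refine hc.onLevel (hΦ.constraint x y t) ?_
  have key := integralsAt_of_flow (c := c) (z := fun s => Φ (s * x) (s * y) (s * t))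
    hc.R₁_pos.ne' (fun s => ?_) (fun s => hΦ.constraint _ _ _) (by simpa using h0) 1
  · simpa using key
  · have hb3 : br c.eig (Φ 0 0 0) 2 2 0 = (c.R₃ : ℂ) ^ 2 := by rw [hl.br22, a]; push_cast; rfl
    -- Before conservation is known, the point lies on a level with its own `G` and `K`, so the
    -- multiplier and the phase rates may depend on `s`. The velocity is still the `x`-field up to
    -- phases, and this suffices for conservation.
    obtain ⟨G, K, hl'⟩ := exists_onLevel hl.R₁_ne hl.R₂_ne hl.b_ne
      (hΦ.constraint (s * x) (s * y) (s * t))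
      ((hΦ.br_self_const _ _ _ 0).trans hl.br00) ((hΦ.br_self_const _ _ _ 1).trans hl.br11)
      ((hΦ.br_self_const _ _ _ 2).trans hb3)
    have hd := (hΦ.hasDerivAt_ray x y t s).congr_deriv (hl'.field_eq_flowField x y t)
    exact ⟨_, _, _, fun j k => hasDerivAt_pi.1 (hasDerivAt_pi.1 hd j) k⟩

lemma hasDerivAt_ray_flowField (x y t s : ℝ) (j : Fin 3) (k : Fin 2) :
    HasDerivAt (fun s => Φ (s * x) (s * y) (s * t) j k)
      (flowField c.eig (x + c.γ₁ * y + c.γ₂ * t) (fun j => y * c.phaseY j + t * c.phaseT j)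
        (t * c.phaseEig) (Φ (s * x) (s * y) (s * t)) j k) s := by
  have hd := hΦ.hasDerivAt_ray x y t s
  rw [(onLevel_of_isSolution hc hΦ h0 (s * x) (s * y) (s * t)).field_eq_flowField x y t] at hd
  exact hasDerivAt_pi.1 (hasDerivAt_pi.1 hd j) k

end DSParam

/-! ### Uniqueness: from the data at the origin to the explicit formulas. -/

namespace DSParam

open Complex DSSystem

variable {c : DSParam}

namespace Admissible

variable (hc : c.Admissible)
include hc

lemma halfDerivP_sub (r r' : ℝ) : c.halfDerivP r - c.halfDerivP r'
    = 2 * c.b * (c.lam - c.mu) * (3 * (r + r') - 2 * (c.ρ₁ + c.ρ₂ + c.ρ₃)) * (r - r') := by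
  rw [hc.halfDerivP_eq, hc.halfDerivP_eq]; ring

/-- Uniqueness for the system `r' = κσ`, `σ' = κP'(r)/2`. -/
lemma eq_rho_of_ode {r σ : ℝ → ℝ} {κ ξ₀ : ℝ} (hr : ∀ s, HasDerivAt r (κ * σ s) s)
    (hσ : ∀ s, HasDerivAt σ (κ * c.halfDerivP (r s)) s) (hmem : ∀ s, r s ∈ Set.Icc c.ρ₁ c.ρ₂)
    (h0 : r 0 = c.rho ξ₀) (h1 : σ 0 = c.rhoD ξ₀) (s : ℝ) :
    r s = c.rho (κ * s + ξ₀) ∧ σ s = c.rhoD (κ * s + ξ₀) := by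
  set v : ℝ → ℝ × ℝ → ℝ × ℝ := fun _ w => (κ * w.2, κ * c.halfDerivP w.1)
  -- A bound for the difference quotient of `halfDerivP` in `halfDerivP_sub`, for arguments in `[ρ₁,
  -- ρ₂]`, where the modulus is at most `|ρ₁| + |ρ₂|`.
  set M : ℝ := 2 * c.b * (c.lam - c.mu)
    * (3 * (2 * (|c.ρ₁| + |c.ρ₂|)) + 2 * |c.ρ₁ + c.ρ₂ + c.ρ₃|)
  have hbl := mul_pos hc.b_pos hc.lam_sub_mu_pos
  have hM : 0 ≤ M := by
    have : 0 ≤ 3 * (2 * (|c.ρ₁| + |c.ρ₂|)) + 2 * |c.ρ₁ + c.ρ₂ + c.ρ₃| := by positivity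
    simp only [M]
    nlinarith
  have hv : ∀ t, LipschitzOnWith (Real.toNNReal (|κ| * (1 + M))) (v t)
      (Set.Icc c.ρ₁ c.ρ₂ ×ˢ Set.univ) := by
    intro t
    refine LipschitzOnWith.of_dist_le_mul ?_
    rintro ⟨a, b⟩ ⟨ha, -⟩ ⟨a', b'⟩ ⟨ha', -⟩
    rw [Real.coe_toNNReal _ (by positivity)]
    simp only [v, Prod.dist_eq, Real.dist_eq]
    simp only at ha ha'
    have hA : |a| ≤ |c.ρ₁| + |c.ρ₂| := by
      rw [abs_le]; constructor
      · linarith [ha.1, neg_abs_le c.ρ₁, abs_nonneg c.ρ₂]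
      · linarith [ha.2, le_abs_self c.ρ₂, abs_nonneg c.ρ₁]
    have hA' : |a'| ≤ |c.ρ₁| + |c.ρ₂| := by
      rw [abs_le]; constructor
      · linarith [ha'.1, neg_abs_le c.ρ₁, abs_nonneg c.ρ₂]
      · linarith [ha'.2, le_abs_self c.ρ₂, abs_nonneg c.ρ₁]
    refine max_le ?_ ?_
    · rw [← mul_sub, abs_mul, mul_assoc]
      refine mul_le_mul_of_nonneg_left ?_ (abs_nonneg κ)
      have := le_max_right |a - a'| |b - b'|
      have h' : 0 ≤ max |a - a'| |b - b'| := (abs_nonneg _).trans this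
      nlinarith
    · rw [← mul_sub, abs_mul, mul_assoc, hc.halfDerivP_sub, abs_mul]
      refine mul_le_mul_of_nonneg_left ?_ (abs_nonneg κ)
      refine mul_le_mul ?_ (le_max_left _ _) (abs_nonneg _) (by linarith)
      rw [abs_mul, abs_of_pos (by linarith : 0 < 2 * c.b * (c.lam - c.mu))]
      have : |3 * (a + a') - 2 * (c.ρ₁ + c.ρ₂ + c.ρ₃)|
          ≤ 3 * (2 * (|c.ρ₁| + |c.ρ₂|)) + 2 * |c.ρ₁ + c.ρ₂ + c.ρ₃| := by
        refine (abs_sub _ _).trans ?_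
        rw [abs_mul, abs_mul, abs_of_pos (by norm_num : (0 : ℝ) < 3),
          abs_of_pos (by norm_num : (0 : ℝ) < 2)]
        have := abs_add_le a a'
        linarith
      have := mul_le_mul_of_nonneg_left this (by linarith : 0 ≤ 2 * c.b * (c.lam - c.mu))
      simp only [M]
      linarith
  have hlin : ∀ s, HasDerivAt (fun s => κ * s + ξ₀) κ s := fun s => by
    simpa using ((hasDerivAt_id s).const_mul κ).add_const ξ₀
  have key := ODE_solution_unique_univ (f := fun s => (r s, σ s))
    (g := fun s => (c.rho (κ * s + ξ₀), c.rhoD (κ * s + ξ₀))) (t₀ := 0) hv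
    (fun s => ⟨(hr s).prodMk (hσ s), hmem s, trivial⟩)
    (fun s => ⟨by
      refine (((hc.hasDerivAt_rho (κ * s + ξ₀)).comp s (hlin s)).prodMk
        ((hc.hasDerivAt_rhoD (κ * s + ξ₀)).comp s (hlin s))).congr_deriv ?_
      simp only [v]
      exact Prod.ext (mul_comm _ _) (mul_comm _ _), hc.rho_mem_Icc _, trivial⟩)
    (by simp [h0, h1])
  have := congrFun key s
  simpa using this

lemma continuous_rho : Continuous c.rho :=
  continuous_iff_continuousAt.2 fun ξ => (hc.hasDerivAt_rho ξ).continuousAt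

lemma continuous_Q_rho (h : c.RootsInRange) : Continuous fun s => c.Q (c.rho s) := by
  have hr := hc.continuous_rho
  refine Continuous.sub (Continuous.div (by fun_prop) (by fun_prop) fun s => ?_) continuous_const
  have h1 := hc.rho_pos h s
  have h2 := sub_pos.2 (hc.rho_lt_one h s)
  positivity

lemma hasDerivAt_integral_Q (h : c.RootsInRange) (ξ : ℝ) :
    HasDerivAt (fun ξ => ∫ s in (0 : ℝ)..ξ, c.Q (c.rho s)) (c.Q (c.rho ξ)) ξ :=
  ((hc.continuous_Q_rho h).integral_hasStrictDerivAt 0 ξ).hasDerivAt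

/-- The right side is the imaginary part of the logarithmic `x`-derivative of `φ₁φ̄₂`. -/
lemma Q_add_α (h : c.RootsInRange) (ξ : ℝ) : c.Q (c.rho ξ) + c.α = c.K - c.K₂
    - (1 - 2 * c.rho ξ) * c.Y (c.rho ξ) / (2 * (c.rho ξ * (1 - c.rho ξ))) := by
  have h1 := (hc.rho_pos h ξ).ne'
  have h2 := (sub_pos.2 (hc.rho_lt_one h ξ)).ne'
  simp only [Q, Y, K₂, a]
  field_simp
  ring

/-- This determines `α`: the `y`-rate of the phase must be `γ₁(Q + α)` plus `phaseY 0 - phaseY 1`,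
while the ansatz with `α(x - γ₁y + γ₂t)` has `γ₁(Q - α)`. -/
lemma γ₁_mul_α : -2 * c.γ₁ * c.α = c.phaseY 0 - c.phaseY 1 := by
  have hb := hc.b_pos.ne'
  have hs : c.R₁ ^ 2 + c.R₂ ^ 2 ≠ 0 := (add_pos hc.R₁_sq_pos hc.R₂_sq_pos).ne'
  simp only [γ₁, α, phaseY, K₂, b, Matrix.cons_val_zero, Matrix.cons_val_one] at *
  field_simp
  ring

end Admissible

lemma hasDerivAt_sqrt_mul_cexp {r θ : ℝ → ℝ} {r' θ' s : ℝ} (R : ℝ) (hr : HasDerivAt r r' s)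
    (hθ : HasDerivAt θ θ' s) (hpos : 0 < r s * (1 - r s)) :
    HasDerivAt (fun s => -(R * √(r s * (1 - r s)) : ℝ) * cexp (I * (θ s : ℝ)))
      ((((1 - 2 * r s) * r' / (2 * (r s * (1 - r s))) : ℝ) + I * (θ' : ℝ))
        * (-(R * √(r s * (1 - r s)) : ℝ) * cexp (I * (θ s : ℝ)))) s := by
  have h1 := ((hr.mul (hr.const_sub 1)).sqrt hpos.ne').const_mul R
  have h2 := (h1.ofReal_comp.neg).mul ((hθ.ofReal_comp.const_mul I).cexp)
  refine h2.congr_deriv ?_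
  have hq := Real.sqrt_pos.2 hpos
  have e : R * ((r' * (1 - r s) + r s * -r') / (2 * √(r s * (1 - r s))))
      = (1 - 2 * r s) * r' / (2 * (r s * (1 - r s))) * (R * √(r s * (1 - r s))) := by
    nth_rw 2 [← Real.sq_sqrt hpos.le]
    field_simp
    ring
  simp only [Pi.mul_apply, Pi.neg_apply]
  rw [e]
  push_cast
  ring

/-- The phase of `u`. -/
def phase (c : DSParam) (x₀ θ₀ x y t : ℝ) : ℝ :=
  θ₀ + (∫ s in (0 : ℝ)..c.xi x₀ x y t, c.Q (c.rho s)) + c.α * (x - c.γ₁ * y + c.γ₂ * t)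
    + (c.C₁₂ + c.C₂₁) * t

/-- A solution whose data at the origin match those of the explicit functions is explicit. -/
lemma isExplicit_of_initial (hc : c.Admissible) (hroots : c.RootsInRange)
    {Φ : ℝ → ℝ → ℝ → Fin 3 → Fin 2 → ℂ} (hΦ : IsSolution c.eig Φ)
    (h0 : c.IntegralsAt (Φ 0 0 0)) {x₀ θ₀ : ℝ} (hρ : c.rhoAt (Φ 0 0 0) = c.rho (-x₀))
    (hσ : c.sigAt (Φ 0 0 0) = c.rhoD (-x₀))
    (he : prodφ (Φ 0 0 0) = -(c.R₁ * c.R₂ * √(c.rho (-x₀) * (1 - c.rho (-x₀))) : ℝ)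
      * cexp (I * (c.phase x₀ θ₀ 0 0 0 : ℝ))) :
    c.IsExplicit Φ x₀ θ₀ := by
  have hl := onLevel_of_isSolution hc hΦ h0
  have hflow := hasDerivAt_ray_flowField hc hΦ h0
  -- `P(ρ) = σ²` is nonnegative, which confines `ρ` to `[ρ₁, ρ₂]`.
  have hmem : ∀ x y t, c.rhoAt (Φ x y t) ∈ Set.Icc c.ρ₁ c.ρ₂ := fun x y t => by
    have h := hl x y t
    exact (hc.rootsInRange_of_nonneg OnLevel.rhoAt_nonneg h.rhoAt_le_one h.G_sub_nonneg
      h.a_sub_G_add_nonneg (h.sigAt_sq ▸ sq_nonneg _)).2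
  have hray : ∀ x y t s, c.rhoAt (Φ (s * x) (s * y) (s * t)) = c.rho (c.xi x₀ (s * x) (s * y) (s * t))
      ∧ c.sigAt (Φ (s * x) (s * y) (s * t)) = c.rhoD (c.xi x₀ (s * x) (s * y) (s * t)) := by
    intro x y t s
    have := hc.eq_rho_of_ode (κ := x + c.γ₁ * y + c.γ₂ * t) (ξ₀ := -x₀)
      (r := fun s => c.rhoAt (Φ (s * x) (s * y) (s * t)))
      (σ := fun s => c.sigAt (Φ (s * x) (s * y) (s * t)))
      (fun s => hasDerivAt_rhoAt_curve (z := fun s => Φ (s * x) (s * y) (s * t))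
        (fun s => hl _ _ _) (hflow x y t s))
      (fun s => hasDerivAt_sigAt_curve (z := fun s => Φ (s * x) (s * y) (s * t))
        (fun s => hl _ _ _) (hflow x y t s))
      (fun s => hmem _ _ _) (by simpa using hρ) (by simpa using hσ) s
    have e : (x + c.γ₁ * y + c.γ₂ * t) * s + -x₀ = c.xi x₀ (s * x) (s * y) (s * t) := by
      rw [xi]; ring
    rwa [e] at this
  have hR : ∀ x y t, c.rhoAt (Φ x y t) = c.rho (c.xi x₀ x y t) := fun x y t => by
    simpa using (hray x y t 1).1
  have hS : ∀ x y t, c.sigAt (Φ x y t) = c.rhoD (c.xi x₀ x y t) := fun x y t => by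
    simpa using (hray x y t 1).2
  have hR₁ := hc.R₁_pos
  have hR₂ := hc.R₂_pos
  have hb := hc.b_pos.ne'
  have hu : ∀ x y t, u c.eig (Φ x y t) = prodφ (Φ x y t) *
      ((c.rhoD (c.xi x₀ x y t) - I * c.Y (c.rho (c.xi x₀ x y t)))
        / (c.b * (c.rho (c.xi x₀ x y t) * (1 - c.rho (c.xi x₀ x y t))))) := by
    intro x y t
    have h1 := (hl x y t).u_mul_conj_prodφ
    have h2 := (hl x y t).prodφ_mul_conj
    rw [hR, hS] at h1
    rw [hR] at h2
    have hb' := (hl x y t).b_ne'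
    have hr1 := (hl x y t).R₁_ne'
    have hr2 := (hl x y t).R₂_ne'
    have hn1 : (c.rho (c.xi x₀ x y t) : ℂ) ≠ 0 := ofReal_ne_zero.2 (hc.rho_pos hroots _).ne'
    have hn2 : (1 - c.rho (c.xi x₀ x y t) : ℂ) ≠ 0 := by
      exact_mod_cast (sub_pos.2 (hc.rho_lt_one hroots (c.xi x₀ x y t))).ne'
    have hne : prodφ (Φ x y t) * conj (prodφ (Φ x y t)) ≠ 0 := by
      rw [h2]; positivity
    have hne' : conj (prodφ (Φ x y t)) ≠ 0 := right_ne_zero_of_mul hne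
    refine mul_right_cancel₀ hne' ?_
    rw [h1, mul_right_comm, h2]
    field_simp
  -- Along a ray both sides solve the same linear equation with logarithmic derivative `m` and agree
  -- at the origin, so their quotient is constantly 1.
  have hE : ∀ x y t, prodφ (Φ x y t)
      = -(c.R₁ * c.R₂ * √(c.rho (c.xi x₀ x y t) * (1 - c.rho (c.xi x₀ x y t))) : ℝ)
        * cexp (I * (c.phase x₀ θ₀ x y t : ℝ)) := by
    intro x y t
    set κ := x + c.γ₁ * y + c.γ₂ * t with hκ
    set ξ : ℝ → ℝ := fun s => c.xi x₀ (s * x) (s * y) (s * t) with hξ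
    have hξd : ∀ s, HasDerivAt ξ κ s := fun s => by
      have : ξ = fun s => κ * s + -x₀ := by funext s; simp only [hξ, hκ, xi]; ring
      rw [this]
      simpa using ((hasDerivAt_id s).const_mul κ).add_const (-x₀)
    -- The part of the phase rate along the ray that does not come from the motion of `ξ`.
    set w : ℝ := y * (c.phaseY 0 - c.phaseY 1) + t * (c.C₁₂ + c.C₂₁) with hw
    set θ : ℝ → ℝ := fun s => c.phase x₀ θ₀ (s * x) (s * y) (s * t) with hθ
    have hθd : ∀ s, HasDerivAt θ (κ * (c.Q (c.rho (ξ s)) + c.α) + w) s := fun s => by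
      have h1 := (hc.hasDerivAt_integral_Q hroots (ξ s)).comp s (hξd s)
      have h2 : HasDerivAt (fun s : ℝ => s * (c.α * (x - c.γ₁ * y + c.γ₂ * t)
          + (c.C₁₂ + c.C₂₁) * t)) (c.α * (x - c.γ₁ * y + c.γ₂ * t) + (c.C₁₂ + c.C₂₁) * t) s := by
        simpa using (hasDerivAt_id s).mul_const
          (c.α * (x - c.γ₁ * y + c.γ₂ * t) + (c.C₁₂ + c.C₂₁) * t)
      have h3 := (h1.const_add θ₀).add h2
      have e : θ = fun s => θ₀ + (∫ q in (0 : ℝ)..ξ s, c.Q (c.rho q))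
          + s * (c.α * (x - c.γ₁ * y + c.γ₂ * t) + (c.C₁₂ + c.C₂₁) * t) := by
        funext s; simp only [hθ, phase, hξ]; ring
      rw [e]
      refine h3.congr_deriv ?_
      rw [hw, ← hc.γ₁_mul_α, hκ]; ring
    -- logarithmic derivative of `φ₁ φ̄₂`
    set m : ℝ → ℂ := fun s => κ * ((1 - 2 * c.rho (ξ s)) * c.rhoD (ξ s)
      / (2 * (c.rho (ξ s) * (1 - c.rho (ξ s))))) + I * (κ * (c.Q (c.rho (ξ s)) + c.α) + w) with hm
    have hpos : ∀ s, 0 < c.rho (ξ s) * (1 - c.rho (ξ s)) := fun s =>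
      mul_pos (hc.rho_pos hroots _) (sub_pos.2 (hc.rho_lt_one hroots _))
    have d1 : ∀ s, HasDerivAt (fun s => prodφ (Φ (s * x) (s * y) (s * t)))
        (m s * prodφ (Φ (s * x) (s * y) (s * t))) s := fun s => by
      refine (hasDerivAt_prodφ_curve (z := fun s => Φ (s * x) (s * y) (s * t))
        (fun s => hl _ _ _) (hflow x y t s)).congr_deriv ?_
      have hQ : (c.Q (c.rho (ξ s)) + c.α : ℂ) = c.K - c.K₂
          - (1 - 2 * c.rho (ξ s)) * c.Y (c.rho (ξ s)) / (2 * (c.rho (ξ s) * (1 - c.rho (ξ s)))) := by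
        exact_mod_cast congrArg (fun x : ℝ => (x : ℂ)) (hc.Q_add_α hroots (ξ s))
      have hp1 : c.phaseT 1 = c.phaseT 0 - (c.C₁₂ + c.C₂₁) := rfl
      have hb' : (c.b : ℂ) ≠ 0 := ofReal_ne_zero.2 hb
      have hn1 : (c.rho (ξ s) : ℂ) ≠ 0 := ofReal_ne_zero.2 (hc.rho_pos hroots _).ne'
      have hn2 : (1 - c.rho (ξ s) : ℂ) ≠ 0 := by
        exact_mod_cast (sub_pos.2 (hc.rho_lt_one hroots (ξ s))).ne'
      have hξs : c.xi x₀ (s * x) (s * y) (s * t) = ξ s := rfl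
      simp only [hm]
      rw [hu, hR, hQ, hw, hp1, hξs, ← hκ]
      push_cast
      field_simp
      ring
    have d2 : ∀ s, HasDerivAt (fun s => -(c.R₁ * c.R₂ * √(c.rho (ξ s) * (1 - c.rho (ξ s))) : ℝ)
          * cexp (I * (θ s : ℝ)))
        (m s * (-(c.R₁ * c.R₂ * √(c.rho (ξ s) * (1 - c.rho (ξ s))) : ℝ)
          * cexp (I * (θ s : ℝ)))) s := fun s => by
      have hr := (hc.hasDerivAt_rho (ξ s)).comp s (hξd s)
      refine (hasDerivAt_sqrt_mul_cexp (c.R₁ * c.R₂) hr (hθd s) (hpos s)).congr_deriv ?_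
      congr 1
      simp only [hm, Function.comp]
      push_cast
      ring
    have hne : ∀ s, -(c.R₁ * c.R₂ * √(c.rho (ξ s) * (1 - c.rho (ξ s))) : ℝ)
        * cexp (I * (θ s : ℝ)) ≠ 0 := fun s => by
      have := Real.sqrt_pos.2 (hpos s)
      refine mul_ne_zero (neg_ne_zero.2 (ofReal_ne_zero.2 ?_)) (exp_ne_zero _)
      positivity
    have hconst : ∀ s, HasDerivAt (fun s => prodφ (Φ (s * x) (s * y) (s * t))
        / (-(c.R₁ * c.R₂ * √(c.rho (ξ s) * (1 - c.rho (ξ s))) : ℝ) * cexp (I * (θ s : ℝ)))) 0 s :=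
      fun s => ((d1 s).div (d2 s) (hne s)).congr_deriv (by
        rw [div_eq_zero_iff]; left; ring)
    have h10 := is_const_of_deriv_eq_zero (fun s => (hconst s).differentiableAt)
      (fun s => (hconst s).deriv) 1 0
    have hξ0 : c.xi x₀ (0 * x) (0 * y) (0 * t) = -x₀ := by simp [xi]
    have hne0 := hne 0
    simp only [hξ, hθ, hξ0] at h10 hne0
    simp only [zero_mul] at h10 hne0
    rw [he, div_self hne0] at h10
    have h11 := (div_eq_one_iff_eq (hne 1)).1 (by simpa only [hξ, hθ, one_mul] using h10)
    simpa only [hξ, hθ, one_mul] using h11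
  refine ⟨fun x y t => (hl x y t).integrals, fun x y t => ?_, fun x y t => ?_, fun x y t => ?_,
    fun x y t => ?_⟩
  · rw [(hl x y t).φ₁_norm_sq, hR]
  · have hp := mul_pos (hc.rho_pos hroots (c.xi x₀ x y t))
      (sub_pos.2 (hc.rho_lt_one hroots (c.xi x₀ x y t)))
    have hq := Real.sqrt_pos.2 hp
    have hqq : (c.rho (c.xi x₀ x y t) * (1 - c.rho (c.xi x₀ x y t)) : ℂ)
        = (√(c.rho (c.xi x₀ x y t) * (1 - c.rho (c.xi x₀ x y t))) : ℂ) ^ 2 := by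
      exact_mod_cast congrArg (fun x : ℝ => (x : ℂ)) (Real.sq_sqrt hp.le).symm
    have hq0 : (√(c.rho (c.xi x₀ x y t) * (1 - c.rho (c.xi x₀ x y t))) : ℂ) ≠ 0 :=
      ofReal_ne_zero.2 hq.ne'
    have hb' : (c.b : ℂ) ≠ 0 := ofReal_ne_zero.2 hb
    have hbe : (c.R₁ : ℂ) ^ 2 - (c.R₂ : ℂ) ^ 2 = c.b := by rw [b]; push_cast; ring
    have hY : (2 * c.K - c.lam - c.mu - c.a + c.b) * c.rho (c.xi x₀ x y t)
        + (c.mu + c.a - c.K - c.G) = c.Y (c.rho (c.xi x₀ x y t)) := by rw [Y]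
    rw [hu, hE, uSol]
    simp only [hc.sqrtP_eq, hbe, hY]
    rw [hqq, ← phase]
    generalize c.Y (c.rho (c.xi x₀ x y t)) = η
    generalize c.rhoD (c.xi x₀ x y t) = σ
    push_cast
    field_simp
    linear_combination (-(c.R₁ * c.R₂ * σ : ℂ)) * I_sq
  · rw [(hl x y t).v₁_eq, hR, v₁Sol]
  · rw [(hl x y t).v₂_eq, hR, v₂Sol]

/-- The sign in front matches the branch `√P = -ρ'`: `i(Y - i√P) = -(ρ' - iY)`. -/
lemma OnLevel.prodφ_eq_polar (hc : c.Admissible) {Z : Fin 3 → Fin 2 → ℂ} (h : c.OnLevel Z) :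
    prodφ Z = -(c.R₁ * c.R₂ * √(c.rhoAt Z * (1 - c.rhoAt Z)) : ℝ)
      * cexp (I * (arg (-prodφ Z) : ℝ)) := by
  have hR₁ := hc.R₁_pos
  have hR₂ := hc.R₂_pos
  have hpos : 0 ≤ c.rhoAt Z * (1 - c.rhoAt Z) :=
    mul_nonneg OnLevel.rhoAt_nonneg (sub_nonneg.2 h.rhoAt_le_one)
  have hnorm : ‖-prodφ Z‖ = c.R₁ * c.R₂ * √(c.rhoAt Z * (1 - c.rhoAt Z)) := by
    rw [norm_neg, ← sq_eq_sq₀ (norm_nonneg _) (by positivity), mul_pow, Real.sq_sqrt hpos]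
    have : ((‖prodφ Z‖ ^ 2 : ℝ) : ℂ)
        = (((c.R₁ * c.R₂) ^ 2 * (c.rhoAt Z * (1 - c.rhoAt Z)) : ℝ) : ℂ) := by
      push_cast
      rw [ofReal_norm_sq, h.prodφ_mul_conj]
      ring
    exact_mod_cast this
  rw [← hnorm, neg_mul, mul_comm I, norm_mul_exp_arg_mul_I, neg_neg]

lemma exists_isExplicit (hc : c.Admissible) {Φ : ℝ → ℝ → ℝ → Fin 3 → Fin 2 → ℂ}
    (hΦ : IsSolution c.eig Φ) (h0 : c.IntegralsAt (Φ 0 0 0)) :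
    c.RootsInRange ∧ ∃ x₀ θ₀ : ℝ, c.IsExplicit Φ x₀ θ₀ := by
  have hl := onLevel_of_isSolution hc hΦ h0 0 0 0
  obtain ⟨hroots, h1, h2⟩ := hc.rootsInRange_of_nonneg OnLevel.rhoAt_nonneg hl.rhoAt_le_one
    hl.G_sub_nonneg hl.a_sub_G_add_nonneg (hl.sigAt_sq ▸ sq_nonneg _)
  obtain ⟨ξ₀, hρ, hσ⟩ := hc.exists_rho_eq h1 h2 hl.sigAt_sq
  -- `x₀ = -ξ₀` makes `ξ = ξ₀` at the origin, and `θ₀` compensates the integral of `Q` from 0 to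
  -- `ξ₀`.
  refine ⟨hroots, -ξ₀, arg (-prodφ (Φ 0 0 0)) - ∫ s in (0 : ℝ)..ξ₀, c.Q (c.rho s), ?_⟩
  refine isExplicit_of_initial hc hroots hΦ h0 (by simp [hρ]) (by simp [hσ]) ?_
  have hph : c.phase (-ξ₀) (arg (-prodφ (Φ 0 0 0)) - ∫ s in (0 : ℝ)..ξ₀, c.Q (c.rho s)) 0 0 0
      = arg (-prodφ (Φ 0 0 0)) := by
    simp [phase, xi]
  rw [hph, neg_neg, hρ]
  exact hl.prodφ_eq_polar hc

end DSParam

/-! ### Completeness and smoothness of flows. -/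

section ODE

variable {E : Type*} [NormedAddCommGroup E] [NormedSpace ℝ E]

/-- A bounded Lipschitz vector field is complete. -/
theorem exists_forall_hasDerivAt_of_lipschitzWith [CompleteSpace E] {V : E → E} {K L : NNReal}
    (hK : LipschitzWith K V) (hL : ∀ x, ‖V x‖ ≤ L) (x₀ : E) :
    ∃ γ : ℝ → E, γ 0 = x₀ ∧ ∀ t, HasDerivAt γ (V (γ t)) t := by
  have hloc : ∀ n : ℕ, ∃ γ : ℝ → E, γ 0 = x₀ ∧
      ∀ t ∈ Set.Ioo (-(n + 1 : ℝ)) (n + 1), HasDerivAt γ (V (γ t)) t := fun n => by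
    have h0 : (0 : ℝ) ∈ Set.Icc (-(n + 1 : ℝ)) (n + 1) := ⟨by linarith [n.cast_nonneg (α := ℝ)],
      by positivity⟩
    -- A global bound allows a ball of radius `L(n + 1)`, so the Picard–Lindelöf time restriction
    -- holds on every interval.
    have hP : IsPicardLindelof (fun _ => V) (⟨0, h0⟩ : Set.Icc (-(n + 1 : ℝ)) (n + 1)) x₀
        (L * (n + 1)) 0 L K :=
      IsPicardLindelof.of_time_independent (fun x _ => hL x) hK.lipschitzOnWith (by simp)
    obtain ⟨γ, h1, h2⟩ := hP.exists_eq_forall_mem_Icc_hasDerivWithinAt₀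
    exact ⟨γ, h1, fun t ht => (h2 t (Set.Ioo_subset_Icc_self ht)).hasDerivAt (Icc_mem_nhds ht.1 ht.2)⟩
  choose γ hγ0 hγ using hloc
  have hle : ∀ n m : ℕ, n ≤ m → ∀ s : ℝ, |s| < n + 1 → γ n s = γ m s := fun n m hnm s hs => by
    have hnm' : (n : ℝ) ≤ m := Nat.cast_le.2 hnm
    refine ODE_solution_unique_of_mem_Ioo (v := fun _ => V) (s := fun _ => Set.univ) (t₀ := 0)
      (fun _ _ => hK.lipschitzOnWith) ?_ (fun t ht => ⟨hγ n t ht, trivial⟩)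
      (fun t ht => ⟨hγ m t ⟨by linarith [ht.1], by linarith [ht.2]⟩, trivial⟩)
      ((hγ0 n).trans (hγ0 m).symm) (abs_lt.1 hs)
    have := n.cast_nonneg (α := ℝ)
    constructor <;> linarith
  have heq : ∀ n m : ℕ, ∀ s : ℝ, |s| < n + 1 → |s| < m + 1 → γ n s = γ m s := fun n m s h1 h2 => by
    rcases le_total n m with h | h
    · exact hle n m h s h1
    · exact (hle m n h s h2).symm
  have hceil : ∀ s : ℝ, |s| < ⌈|s|⌉₊ + 1 := fun s => (Nat.le_ceil _).trans_lt (lt_add_one _)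
  refine ⟨fun s => γ ⌈|s|⌉₊ s, hγ0 _, fun t => ?_⟩
  have ht := hceil t
  refine (hγ ⌈|t|⌉₊ t (abs_lt.1 ht)).congr_of_eventuallyEq ?_
  filter_upwards [(continuous_abs.tendsto t).eventually (gt_mem_nhds ht)] with s hs
  exact heq _ _ s (hceil s) hs

/-- Bootstrapping: the derivative `V ∘ γ` is as smooth as `γ` is already known to be. -/
theorem contDiff_of_hasDerivAt {V : E → E} (hV : ContDiff ℝ ∞ V) {γ : ℝ → E}
    (hγ : ∀ t, HasDerivAt γ (V (γ t)) t) : ContDiff ℝ ∞ γ := by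
  have hd : Differentiable ℝ γ := fun t => (hγ t).differentiableAt
  refine contDiff_infty.2 fun n => ?_
  induction n with
  | zero => exact contDiff_zero.2 hd.continuous
  | succ n ih =>
    rw [Nat.cast_succ, contDiff_succ_iff_deriv]
    refine ⟨hd, by simp, ?_⟩
    rw [show deriv γ = fun t => V (γ t) from funext fun t => (hγ t).deriv]
    exact (hV.of_le (by exact_mod_cast le_top)).comp ih

theorem ContDiff.complex_conj {f : E → ℂ} {n : WithTop ℕ∞} (hf : ContDiff ℝ n f) :
    ContDiff ℝ n fun x => conj (f x) :=
  Complex.conjCLE.contDiff.comp hf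

end ODE

/-! ### Global solutions of the `x`-system and its phase symmetry. -/

namespace DSSystem

open Complex

variable {Λ : Fin 2 → ℝ}

lemma contDiff_br {E : Type*} [NormedAddCommGroup E] [NormedSpace ℝ E] {n : WithTop ℕ∞}
    {Z : E → Fin 3 → Fin 2 → ℂ} (hZ : ContDiff ℝ n Z) (i j : Fin 3) (m : ℕ) :
    ContDiff ℝ n fun w => br Λ (Z w) i j m := by
  have h : ∀ j k, ContDiff ℝ n fun w => Z w j k := fun j k =>
    contDiff_pi.1 (contDiff_pi.1 hZ j) k
  exact ContDiff.sum fun k _ => ((h i k).complex_conj.mul contDiff_const).mul (h j k)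

lemma contDiff_fieldX : ContDiff ℝ ∞ (fieldX Λ) := by
  have h : ∀ j k, ContDiff ℝ ∞ fun Z : Fin 3 → Fin 2 → ℂ => Z j k := fun j k =>
    contDiff_pi.1 (contDiff_pi.1 contDiff_id j) k
  have hb : ∀ i j, ContDiff ℝ ∞ fun Z : Fin 3 → Fin 2 → ℂ => br Λ Z i j 0 := fun i j =>
    contDiff_br contDiff_id i j 0
  refine contDiff_pi.2 fun j => contDiff_pi.2 fun k => ?_
  fin_cases j
  · exact ((contDiff_const (c := I * Λ k)).mul (h 0 k)).add
      ((contDiff_const.mul (hb 2 0)).mul (h 2 k))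
  · exact ((contDiff_const (c := I * Λ k)).mul (h 1 k)).add
      ((contDiff_const.mul (hb 2 1)).mul (h 2 k))
  · exact ((contDiff_const.mul (hb 2 0).complex_conj).mul (h 0 k)).add
      ((contDiff_const.mul (hb 2 1).complex_conj).mul (h 1 k))

/-- The `x`-system has global solutions. -/
lemma exists_flow (Λ : Fin 2 → ℝ) (Z₀ : Fin 3 → Fin 2 → ℂ) :
    ∃ z : ℝ → Fin 3 → Fin 2 → ℂ, z 0 = Z₀ ∧ ∀ s, HasDerivAt z (fieldX Λ (z s)) s := by
  -- Conservation of the norms bounds every `|z s j k|²` by `2‖Z₀‖²`, so the solution of the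
  -- truncated system stays where the cut-off equals 1.
  let χ : ContDiffBump (0 : Fin 3 → Fin 2 → ℂ) :=
    ⟨2 * ‖Z₀‖ + 1, 2 * ‖Z₀‖ + 2, by positivity, by linarith⟩
  have hs : HasCompactSupport fun Z => χ Z • fieldX Λ Z := χ.hasCompactSupport.smul_right
  have hd : ContDiff ℝ ∞ fun Z => χ Z • fieldX Λ Z := χ.contDiff.smul contDiff_fieldX
  obtain ⟨K, hK⟩ := hd.lipschitzWith_of_hasCompactSupport hs (by simp)
  obtain ⟨L, hL⟩ := hs.exists_bound_of_continuous hd.continuous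
  obtain ⟨z, hz0, hz⟩ := exists_forall_hasDerivAt_of_lipschitzWith hK (L := L.toNNReal)
    (fun x => (hL x).trans (Real.le_coe_toNNReal L)) Z₀
  refine ⟨z, hz0, fun s => ?_⟩
  have hbr : ∀ j s, br Λ (z s) j j 0 = br Λ (z 0) j j 0 := fun j s => by
    have h : ∀ s, HasDerivAt (fun s => br Λ (z s) j j 0) 0 s := fun s => by
      refine (hasDerivAt_br (fun j k => hasDerivAt_pi.1 (hasDerivAt_pi.1 (hz s) j) k) j j 0).congr_deriv
        ?_
      -- The truncated field is the `x`-field with multiplier `χ (z s)` and no phases, so it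
      -- conserves the norms as well.
      rw [← brD_self (χ (z s)) 0 0 j]
      congr 1
      funext j k
      simp [flowField]
    exact is_const_of_deriv_eq_zero (fun s => (h s).differentiableAt) (fun s => (h s).deriv) s 0
  have hnorm : ‖z s‖ ≤ 2 * ‖Z₀‖ := by
    refine (pi_norm_le_iff_of_nonneg (by positivity)).2 fun j =>
      (pi_norm_le_iff_of_nonneg (by positivity)).2 fun k => ?_
    have h := hbr j s
    rw [hz0] at h
    simp only [br_two, pow_zero, mul_one] at h
    have h' : ‖z s j 0‖ ^ 2 + ‖z s j 1‖ ^ 2 = ‖Z₀ j 0‖ ^ 2 + ‖Z₀ j 1‖ ^ 2 := by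
      have : ((‖z s j 0‖ ^ 2 + ‖z s j 1‖ ^ 2 : ℝ) : ℂ) = ((‖Z₀ j 0‖ ^ 2 + ‖Z₀ j 1‖ ^ 2 : ℝ) : ℂ) := by
        push_cast [ofReal_norm_sq]
        linear_combination h
      exact_mod_cast this
    have b0 := (norm_le_pi_norm (Z₀ j) 0).trans (norm_le_pi_norm Z₀ j)
    have b1 := (norm_le_pi_norm (Z₀ j) 1).trans (norm_le_pi_norm Z₀ j)
    refine abs_le_of_sq_le_sq' ?_ (by positivity) |>.2
    have : ‖z s j k‖ ^ 2 ≤ ‖z s j 0‖ ^ 2 + ‖z s j 1‖ ^ 2 := by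
      fin_cases k
      · exact le_add_of_nonneg_right (by positivity)
      · exact le_add_of_nonneg_left (by positivity)
    have c0 := pow_le_pow_left₀ (norm_nonneg _) b0 2
    have c1 := pow_le_pow_left₀ (norm_nonneg _) b1 2
    nlinarith [sq_nonneg ‖Z₀‖]
  have h1 : χ (z s) = 1 := χ.one_of_mem_closedBall (by
    rw [mem_closedBall_zero_iff]; exact hnorm.trans (by simp [χ]))
  simpa [h1] using hz s

/-- `Z` with phases `d_j + e_k`. -/
def rotate (d : Fin 3 → ℝ) (e : Fin 2 → ℝ) (Z : Fin 3 → Fin 2 → ℂ) : Fin 3 → Fin 2 → ℂ :=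
  fun j k => cexp (I * (d j + e k : ℝ)) * Z j k

variable (d : Fin 3 → ℝ) (e : Fin 2 → ℝ) (Z : Fin 3 → Fin 2 → ℂ)

lemma conj_cexp_I_mul (x : ℝ) : conj (cexp (I * x)) = cexp (-(I * x)) := by
  rw [← exp_conj, map_mul, conj_I, conj_ofReal, neg_mul]

lemma br_rotate (i j : Fin 3) (m : ℕ) :
    br Λ (rotate d e Z) i j m = cexp (I * (d j - d i : ℝ)) * br Λ Z i j m := by
  have h : ∀ k, conj (rotate d e Z i k) * (Λ k : ℂ) ^ m * rotate d e Z j k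
      = cexp (I * (d j - d i : ℝ)) * (conj (Z i k) * (Λ k : ℂ) ^ m * Z j k) := fun k => by
    simp only [rotate, map_mul, conj_cexp_I_mul]
    rw [show cexp (I * (d j - d i : ℝ))
      = cexp (-(I * (d i + e k : ℝ))) * cexp (I * (d j + e k : ℝ)) by
        rw [← Complex.exp_add]; congr 1; push_cast; ring]
    ring
  simp only [br, h, Finset.mul_sum]

/-- The phases of `f` and `g` are exactly those that carry the phase of one `Φ_j` to that of
another, and the phases `e k` commute with `Λ`. -/
lemma fieldX_rotate : fieldX Λ (rotate d e Z) = rotate d e (fieldX Λ Z) := by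
  funext j k
  have h1 : ∀ x y : ℝ, cexp (I * x) * cexp (I * y) = cexp (I * (x + y : ℝ)) := fun x y => by
    rw [← Complex.exp_add]; congr 1; push_cast; ring
  have h2 : ∀ i j x, cexp (I * (d j - d i : ℝ)) * (cexp (I * (d i + e k : ℝ)) * x)
      = cexp (I * (d j + e k : ℝ)) * x := fun i j x => by
    rw [← mul_assoc, h1, show d j - d i + (d i + e k) = d j + e k by ring]
  fin_cases j
  · change I * Λ k * (cexp (I * (d 0 + e k : ℝ)) * Z 0 k)
        + I * br Λ (rotate d e Z) 2 0 0 * (cexp (I * (d 2 + e k : ℝ)) * Z 2 k)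
      = cexp (I * (d 0 + e k : ℝ)) * (I * Λ k * Z 0 k + I * br Λ Z 2 0 0 * Z 2 k)
    rw [br_rotate]
    linear_combination I * br Λ Z 2 0 0 * h2 2 0 (Z 2 k)
  · change I * Λ k * (cexp (I * (d 1 + e k : ℝ)) * Z 1 k)
        + I * br Λ (rotate d e Z) 2 1 0 * (cexp (I * (d 2 + e k : ℝ)) * Z 2 k)
      = cexp (I * (d 1 + e k : ℝ)) * (I * Λ k * Z 1 k + I * br Λ Z 2 1 0 * Z 2 k)
    rw [br_rotate]
    linear_combination I * br Λ Z 2 1 0 * h2 2 1 (Z 2 k)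
  · change I * conj (br Λ (rotate d e Z) 2 0 0) * (cexp (I * (d 0 + e k : ℝ)) * Z 0 k)
        + I * conj (br Λ (rotate d e Z) 2 1 0) * (cexp (I * (d 1 + e k : ℝ)) * Z 1 k)
      = cexp (I * (d 2 + e k : ℝ))
        * (I * conj (br Λ Z 2 0 0) * Z 0 k + I * conj (br Λ Z 2 1 0) * Z 1 k)
    rw [conj_br, conj_br, conj_br, conj_br, br_rotate, br_rotate]
    linear_combination I * br Λ Z 0 2 0 * h2 0 2 (Z 0 k) + I * br Λ Z 1 2 0 * h2 1 2 (Z 1 k)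

lemma norm_rotate (j : Fin 3) (k : Fin 2) : ‖rotate d e Z j k‖ = ‖Z j k‖ := by
  rw [rotate, norm_mul, mul_comm I, norm_exp_ofReal_mul_I, one_mul]

end DSSystem

/-! ### Existence: a point on the level set and the solution through it. -/

namespace DSParam

open Complex DSSystem

variable {c : DSParam}

namespace Admissible

variable (hc : c.Admissible) (hroots : c.RootsInRange)
include hc hroots

/-- In the `S`-form, `P(ρ₁) = 0` says that `S(ρ₁)` is twice the product of the four square roots up
to sign; the sign is put into `p₃`. Real data suffice at a turning point, where the cross term is
extremal. -/
lemma exists_real_data : ∃ s₁ s₂ f₃ p₃ : ℝ, s₁ ^ 2 = c.ρ₁ ∧ s₂ ^ 2 = 1 - c.ρ₁ ∧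
    f₃ ^ 2 = c.G - c.b * c.ρ₁ ∧ p₃ ^ 2 = c.a - c.G + c.b * c.ρ₁ ∧
    2 * s₁ * s₂ * f₃ * p₃ = c.S c.ρ₁ := by
  have hb := hc.b_pos
  have h0 := (hc.ρ₁_pos hroots).le
  have h1 : 0 ≤ 1 - c.ρ₁ := (sub_pos.2 (hc.ρ₁_lt_ρ₂.trans (hc.ρ₂_lt_one hroots))).le
  have h2 : 0 ≤ c.G - c.b * c.ρ₁ := by
    have := hc.ρ₁_lt_ρ₂.le.trans (hroots.2.trans (min_le_right _ _))
    rw [le_div_iff₀ hb] at this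
    linarith
  have h3 : 0 ≤ c.a - c.G + c.b * c.ρ₁ := by
    have := (le_max_right _ _).trans hroots.1
    rw [div_le_iff₀ hb] at this
    linarith
  have hP := hc.P_ρ₁
  rw [P_eq_sub_S_sq] at hP
  have hS : (2 * √c.ρ₁ * √(1 - c.ρ₁) * √(c.G - c.b * c.ρ₁) * √(c.a - c.G + c.b * c.ρ₁)) ^ 2
      = c.S c.ρ₁ ^ 2 := by
    simp only [mul_pow, Real.sq_sqrt h0, Real.sq_sqrt h1, Real.sq_sqrt h2, Real.sq_sqrt h3]
    linarith
  rcases sq_eq_sq_iff_eq_or_eq_neg.1 hS with h | h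
  · exact ⟨_, _, _, _, Real.sq_sqrt h0, Real.sq_sqrt h1, Real.sq_sqrt h2, Real.sq_sqrt h3, h⟩
  · exact ⟨_, _, _, -√(c.a - c.G + c.b * c.ρ₁), Real.sq_sqrt h0, Real.sq_sqrt h1,
      Real.sq_sqrt h2, by rw [neg_sq, Real.sq_sqrt h3], by linarith⟩

/-- There is a point with the prescribed integrals where `ρ = ρ₁`. -/
lemma exists_onLevel_rhoAt_eq : ∃ Z, c.OnLevel Z ∧ c.rhoAt Z = c.ρ₁ := by
  obtain ⟨s₁, s₂, f₃, p₃, e1, e2, e3, e4, e5⟩ := hc.exists_real_data hroots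
  have hR := hc.R₁_pos.ne'
  have c1 : (s₁ : ℂ) ^ 2 = c.ρ₁ := by exact_mod_cast congrArg ofReal e1
  have c2 : (s₂ : ℂ) ^ 2 = 1 - c.ρ₁ := by exact_mod_cast congrArg ofReal e2
  have c3 : (f₃ : ℂ) ^ 2 = c.G - c.b * c.ρ₁ := by exact_mod_cast congrArg ofReal e3
  have c4 : (p₃ : ℂ) ^ 2 = c.a - c.G + c.b * c.ρ₁ := by exact_mod_cast congrArg ofReal e4
  have c5 : 2 * (s₁ : ℂ) * s₂ * f₃ * p₃ = c.S c.ρ₁ := by exact_mod_cast congrArg ofReal e5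
  have cb : (c.b : ℂ) = (c.R₁ : ℂ) ^ 2 - (c.R₂ : ℂ) ^ 2 := OnLevel.b_eq
  -- `Φ₁/R₁` is a real unit vector, `Φ₂/R₂` its quarter turn, and `Φ₃ = (f₃, p₃)`; the value of `K`
  -- then amounts to the equation `c5` for `S(ρ₁)`.
  refine ⟨![![c.R₁ * s₁, c.R₁ * s₂], ![-(c.R₂ * s₂), c.R₂ * s₁], ![f₃, p₃]], hc.onLevel ?_ ?_, ?_⟩
  · simp [br_two]; ring
  · refine integralsAt_of_complex hR ?_ ?_ ?_ ?_ ?_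
    · simp [br_two]
      linear_combination (c.R₁ : ℂ) ^ 2 * (c1 + c2)
    · simp [br_two]
      linear_combination (c.R₂ : ℂ) ^ 2 * (c1 + c2)
    · simp [br_two]
      rw [a, ofReal_pow] at c4
      linear_combination c3 + c4
    · simp [Fin.sum_univ_three]
      linear_combination (c.R₁ : ℂ) ^ 2 * c1 + (c.R₂ : ℂ) ^ 2 * c2 + c3 - c.ρ₁ * cb
    · simp [br_two, eig]
      rw [S] at c5
      push_cast at c5
      linear_combination (c.R₁ : ℂ) ^ 2 * (c.lam * c1 + c.mu * c2 + f₃ ^ 2 * c1 + c.ρ₁ * c3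
        + p₃ ^ 2 * c2 + (1 - c.ρ₁) * c4 + c5)
  · simp [rhoAt, mul_pow, e1]
    field_simp

end Admissible

lemma OnLevel.rotate {Z : Fin 3 → Fin 2 → ℂ} (h : c.OnLevel Z) (d : Fin 3 → ℝ) (e : Fin 2 → ℝ) :
    c.OnLevel (rotate d e Z) where
  R₁_ne := h.R₁_ne
  R₂_ne := h.R₂_ne
  b_ne := h.b_ne
  orth := by rw [br_rotate, h.orth, mul_zero]
  integrals := by
    refine ⟨?_, ?_, ?_, ?_, ?_⟩
    · simpa only [norm_rotate] using h.integrals.R₁_eq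
    · simpa only [norm_rotate] using h.integrals.R₂_eq
    · simpa only [norm_rotate] using h.integrals.R₃_eq
    · simpa only [norm_rotate] using h.integrals.G_eq
    · rw [← h.integrals.K_eq]
      simp only [br_rotate, sub_self, ofReal_zero, mul_zero, Complex.exp_zero, one_mul]
      have : cexp (I * (d 2 - d 0 : ℝ)) * cexp (I * (d 0 - d 2 : ℝ)) = 1 := by
        rw [← Complex.exp_add, ← mul_add, ← ofReal_add]; simp
      congr 1
      linear_combination br c.eig Z 0 2 0 * br c.eig Z 2 0 0 * this

lemma hasDerivAt_rotate_comp {z : ℝ → Fin 3 → Fin 2 → ℂ}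
    (hz : ∀ s, HasDerivAt z (fieldX c.eig (z s)) s) {d : ℝ → Fin 3 → ℝ} {e : ℝ → Fin 2 → ℝ}
    {ξ : ℝ → ℝ} {s κ B : ℝ} {A : Fin 3 → ℝ} (hd : ∀ j, HasDerivAt (fun s => d s j) (A j) s)
    (he : ∀ k, HasDerivAt (fun s => e s k) (B * c.eig k) s) (hξ : HasDerivAt ξ κ s) :
    HasDerivAt (fun s => rotate (d s) (e s) (z (ξ s)))
      (flowField c.eig κ A B (rotate (d s) (e s) (z (ξ s)))) s := by
  refine hasDerivAt_pi.2 fun j => hasDerivAt_pi.2 fun k => ?_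
  have h1 := (((hd j).add (he k)).ofReal_comp.const_mul I).cexp
  have h2 := hasDerivAt_pi.1 (hasDerivAt_pi.1 ((hz (ξ s)).scomp s hξ) j) k
  refine (h1.mul h2).congr_deriv ?_
  simp only [flowField, fieldX_rotate, rotate, Pi.add_apply, Function.comp, Pi.smul_apply, real_smul]
  push_cast
  ring

/-- The phases of the solution. -/
def phases (c : DSParam) (δ y t : ℝ) : Fin 3 → ℝ :=
  fun j => ![δ, 0, 0] j + c.phaseY j * y + c.phaseT j * t

/-- Each field is a constant multiple of the `x`-field plus phase rotations at constant rates, and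
rotations commute with the `x`-field. So one solution of the `x`-system solves all three systems,
without any appeal to commuting flows. The free constant `δ` shifts the phase of `Φ₁` and will
realise `θ₀`. -/
lemma isSolution_rotate {z : ℝ → Fin 3 → Fin 2 → ℂ}
    (hz : ∀ s, HasDerivAt z (fieldX c.eig (z s)) s) (hl : ∀ s, c.OnLevel (z s)) (δ x₀ : ℝ) :
    IsSolution c.eig fun x y t =>
      rotate (c.phases δ y t) (fun k => c.phaseEig * t * c.eig k) (z (c.xi x₀ x y t)) := by
  have hlr : ∀ x y t : ℝ, c.OnLevel
      (rotate (c.phases δ y t) (fun k => c.phaseEig * t * c.eig k) (z (c.xi x₀ x y t))) :=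
    fun x y t => (hl _).rotate _ _
  have hzs := contDiff_of_hasDerivAt contDiff_fieldX hz
  refine ⟨?_, fun x y t => (hlr x y t).orth, fun x y t h => ?_, fun x y t => ?_, fun x y t => ?_,
    fun x y t => ?_⟩
  · refine contDiff_pi.2 fun j => contDiff_pi.2 fun k => ContDiff.mul ?_ ?_
    · refine (contDiff_const.mul (ofRealCLM.contDiff.comp (ContDiff.add ?_ ?_))).cexp
      · simp only [phases]; fun_prop
      · fun_prop
    · refine contDiff_pi.1 (contDiff_pi.1 (hzs.comp ?_) j) k
      simp only [xi]; fun_prop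
  · exact (hlr x y t).b_ne' (by rw [← (hlr x y t).br_sub, h, sub_self])
  · have h := (hlr x y t).field_eq_flowField 1 0 0
    simp only [one_smul, zero_smul, add_zero] at h
    rw [h]
    refine hasDerivAt_rotate_comp hz (fun j => ?_) (fun k => ?_) ?_
    · simpa using hasDerivAt_const x (c.phases δ y t j)
    · simpa using hasDerivAt_const x (c.phaseEig * t * c.eig k)
    · simp only [xi]
      simpa using (((hasDerivAt_id x).add_const (c.γ₁ * y)).add_const (c.γ₂ * t)).sub_const x₀
  · have h := (hlr x y t).field_eq_flowField 0 1 0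
    simp only [one_smul, zero_smul, zero_add, add_zero] at h
    rw [h]
    refine hasDerivAt_rotate_comp hz (fun j => ?_) (fun k => ?_) ?_
    · simp only [phases]
      simpa using (((hasDerivAt_id y).const_mul (c.phaseY j)).const_add
        ((![δ, 0, 0] : Fin 3 → ℝ) j)).add_const (c.phaseT j * t)
    · simpa using hasDerivAt_const y (c.phaseEig * t * c.eig k)
    · simp only [xi]
      simpa using ((((hasDerivAt_id y).const_mul c.γ₁).const_add x).add_const (c.γ₂ * t)).sub_const x₀
  · have h := (hlr x y t).field_eq_flowField 0 0 1
    simp only [one_smul, zero_smul, zero_add] at h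
    rw [h]
    refine hasDerivAt_rotate_comp (d := fun t => c.phases δ y t)
      (e := fun t k => c.phaseEig * t * c.eig k) (ξ := fun t => c.xi x₀ x y t) hz (fun j => ?_) (fun k => ?_) ?_
    · simp only [phases]
      simpa using ((hasDerivAt_id t).const_mul (c.phaseT j)).const_add
        ((![δ, 0, 0] : Fin 3 → ℝ) j + c.phaseY j * y)
    · simpa [mul_assoc] using ((hasDerivAt_id t).const_mul c.phaseEig).mul_const (c.eig k)
    · simp only [xi]
      simpa using (((hasDerivAt_id t).const_mul c.γ₂).const_add (x + c.γ₁ * y)).sub_const x₀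

/-- The explicit functions come from a solution. -/
lemma exists_isSolution_isExplicit (hc : c.Admissible) (hroots : c.RootsInRange) (x₀ θ₀ : ℝ) :
    ∃ Φ : ℝ → ℝ → ℝ → Fin 3 → Fin 2 → ℂ, IsSolution c.eig Φ ∧ c.IsExplicit Φ x₀ θ₀ := by
  obtain ⟨Z, hZ, hρ⟩ := hc.exists_onLevel_rhoAt_eq hroots
  obtain ⟨z, rfl, hz⟩ := exists_flow c.eig Z
  have hz' : ∀ s j k, HasDerivAt (fun s => z s j k) (flowField c.eig 1 0 0 (z s) j k) s :=
    fun s j k => by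
      simpa [flowField] using hasDerivAt_pi.1 (hasDerivAt_pi.1 (hz s) j) k
  have ho : ∀ s, br c.eig (z s) 0 1 0 = 0 := fun s => by
    have h : ∀ s, HasDerivAt (fun s => br c.eig (z s) 0 1 0) 0 s := fun s =>
      (hasDerivAt_br (hz' s) 0 1 0).congr_deriv (by rw [brD_orth]; simp)
    rw [is_const_of_deriv_eq_zero (fun s => (h s).differentiableAt) (fun s => (h s).deriv) s 0]
    exact hZ.orth
  have hl : ∀ s, c.OnLevel (z s) := fun s => hc.onLevel (ho s)
    (integralsAt_of_flow hZ.R₁_ne (fun s => ⟨1, 0, 0, hz' s⟩) ho hZ.integrals s)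
  -- The curve starts at the turning point `ρ₁`, exactly as `rho` does at 0, so the two run in step
  -- without a shift.
  have hσ : c.sigAt (z 0) = 0 := by
    have := hZ.sigAt_sq
    rwa [hρ, hc.P_ρ₁, sq_eq_zero_iff] at this
  have hode := hc.eq_rho_of_ode (κ := 1) (ξ₀ := 0) (fun s => hasDerivAt_rhoAt_curve hl (hz' s))
    (fun s => hasDerivAt_sigAt_curve hl (hz' s))
    (fun s => (hc.rootsInRange_of_nonneg OnLevel.rhoAt_nonneg (hl s).rhoAt_le_one
      (hl s).G_sub_nonneg (hl s).a_sub_G_add_nonneg ((hl s).sigAt_sq ▸ sq_nonneg _)).2)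
    (hρ.trans hc.rho_zero.symm) (hσ.trans hc.rhoD_zero.symm) (-x₀)
  simp only [one_mul, add_zero] at hode
  -- The rotation that gives `φ₁φ̄₂` the prescribed phase at the origin.
  set δ : ℝ := c.phase x₀ θ₀ 0 0 0 - arg (-prodφ (z (-x₀)))
  have hΦ := isSolution_rotate hz hl δ x₀
  refine ⟨_, hΦ, ?_⟩
  have hξ : c.xi x₀ 0 0 0 = -x₀ := by simp [xi]
  have hr : ∀ d e Z, c.rhoAt (rotate d e Z) = c.rhoAt Z := fun d e Z => by
    rw [rhoAt, norm_rotate, rhoAt]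
  have hp : prodφ (rotate (c.phases δ 0 0) (fun k => c.phaseEig * 0 * c.eig k) (z (-x₀)))
      = cexp (I * δ) * prodφ (z (-x₀)) := by
    simp [prodφ, rotate, phases]
    ring
  have hs : c.sigAt (rotate (c.phases δ 0 0) (fun k => c.phaseEig * 0 * c.eig k) (z (-x₀)))
      = c.sigAt (z (-x₀)) := by
    rw [sigAt, hp, ((hl _).rotate _ _).u_eq, cross, br_rotate, br_rotate, br_rotate, sigAt,
      (hl _).u_eq, cross]
    congr 2
    rw [map_mul, conj_cexp_I_mul]
    have e1 : cexp (I * (c.phases δ 0 0 0 - c.phases δ 0 0 1 : ℝ)) * cexp (-(I * δ)) = 1 := by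
      rw [← Complex.exp_add]; simp [phases]
    have e2 : cexp (I * (c.phases δ 0 0 2 - c.phases δ 0 0 1 : ℝ))
        * cexp (I * (c.phases δ 0 0 0 - c.phases δ 0 0 2 : ℝ)) * cexp (-(I * δ)) = 1 := by
      rw [← Complex.exp_add, ← Complex.exp_add]; simp [phases]
    linear_combination 2 * I / c.b * conj (prodφ (z (-x₀)))
      * (br c.eig (z (-x₀)) 1 0 1 * e1
        + br c.eig (z (-x₀)) 1 2 0 * br c.eig (z (-x₀)) 2 0 0 * e2)
  refine isExplicit_of_initial hc hroots hΦ ((hl _).rotate _ _).integrals ?_ ?_ ?_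
  · rw [hξ, hr, hode.1]
  · rw [hξ, hs, hode.2]
  · have hpol := (hl (-x₀)).prodφ_eq_polar hc
    have hexp : cexp (I * δ) * cexp (I * (arg (-prodφ (z (-x₀))) : ℝ))
        = cexp (I * (c.phase x₀ θ₀ 0 0 0 : ℝ)) := by
      rw [← Complex.exp_add]; congr 1; simp only [δ]; push_cast; ring
    rw [hξ, hp, ← hode.1]
    linear_combination cexp (I * δ) * hpol
      - (c.R₁ * c.R₂ * √(c.rhoAt (z (-x₀)) * (1 - c.rhoAt (z (-x₀)))) : ℝ) * hexp

end DSParam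

/-! ### The Davey–Stewartson I equation. -/

namespace DSParam

open Complex DSSystem

variable {c : DSParam}

namespace Admissible

variable (hc : c.Admissible)
include hc

/-- After all derivatives are expressed by `u` and `φ₁φ̄₂`, the DSI equation is a combination of
`φ₁φ̄₂`, `u` and `ρu`. This identity and the next two match the coefficients of these terms, in this
order. -/
lemma γ₂_dispersion : c.γ₂ = (1 + c.γ₁ ^ 2) * (c.b - (c.K - c.K₂))
    - 2 * (c.phaseY 0 - c.phaseY 1) * c.γ₁ := by
  have hb := hc.b_pos.ne'
  simp only [γ₂, γ₁, phaseY, K₂, b, Matrix.cons_val_zero, Matrix.cons_val_one] at *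
  field_simp
  ring

lemma C_dispersion : -c.γ₂ * c.b + (c.C₁₂ + c.C₂₁)
    = (1 + c.γ₁ ^ 2) * (-c.b ^ 2 - (c.lam - c.mu) * c.b)
      + 2 * (c.phaseY 0 - c.phaseY 1) * c.γ₁ * c.b - (c.phaseY 0 - c.phaseY 1) ^ 2
      + 8 * c.R₁ ^ 2 * c.R₂ ^ 2 / c.b ^ 2 * c.E
      + 4 * c.R₁ ^ 2 * (c.K - c.mu) + 4 * c.R₂ ^ 2 * (c.mu + c.a - c.K) := by
  have hb := hc.b_pos.ne'
  rw [OnLevel.C₁₂_add_C₂₁_eq, hc.γ₂_dispersion]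
  simp only [γ₁, phaseY, K₂, E, a, b, Matrix.cons_val_zero, Matrix.cons_val_one] at *
  field_simp
  ring

lemma ρ_dispersion : (1 + c.γ₁ ^ 2) * (2 * (c.lam - c.mu) * c.b)
    = 8 * c.R₁ ^ 2 * c.R₂ ^ 2 / c.b ^ 2 * (c.b * (c.lam - c.mu))
      + 4 * (c.R₁ ^ 2 - c.R₂ ^ 2) * (c.lam - c.mu) := by
  have hb := hc.b_pos.ne'
  simp only [γ₁, b] at *
  field_simp
  ring

/-- `v₁` carries the factor `R₁²` and `v₂` the factor `R₂²`. The factors `1 - γ₁` and `1 + γ₁`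
supply the missing one in the `R₁²R₂²` of `|u|²`. -/
lemma one_sub_γ₁ : 1 - c.γ₁ = -2 * c.R₂ ^ 2 / c.b := by
  have hb := hc.b_pos.ne'
  simp only [γ₁, b] at *
  field_simp
  ring

lemma one_add_γ₁ : 1 + c.γ₁ = 2 * c.R₁ ^ 2 / c.b := by
  have hb := hc.b_pos.ne'
  simp only [γ₁, b] at *
  field_simp
  ring

end Admissible

section Explicit

variable (hc : c.Admissible) {Φ : ℝ → ℝ → ℝ → Fin 3 → Fin 2 → ℂ} (hΦ : IsSolution c.eig Φ)
  {x₀ θ₀ : ℝ} (hE : c.IsExplicit Φ x₀ θ₀)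
include hc hΦ hE

lemma IsExplicit.onLevel (x y t : ℝ) : c.OnLevel (Φ x y t) :=
  hc.onLevel (hΦ.constraint x y t) (hE.integrals x y t)

omit hΦ in
lemma IsExplicit.rhoAt_eq (x y t : ℝ) : c.rhoAt (Φ x y t) = c.rho (c.xi x₀ x y t) := by
  rw [rhoAt, hE.rho_eq, mul_div_cancel_left₀ _ (ne_of_gt hc.R₁_sq_pos)]

/-- `u_x`. -/
def uX (c : DSParam) (Z : Fin 3 → Fin 2 → ℂ) : ℂ :=
  -I * c.b * u c.eig Z - 2 * (c.lam - c.mu) * prodφ Z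

/-- `(φ₁ φ̄₂)_x`. -/
def prodφX (c : DSParam) (Z : Fin 3 → Fin 2 → ℂ) : ℂ :=
  I * (c.K - c.K₂) * prodφ Z + c.b / 2 * (1 - 2 * c.rhoAt Z) * u c.eig Z

lemma IsExplicit.hasDerivAt_x (x y t : ℝ) :
    HasDerivAt (fun x => u c.eig (Φ x y t)) (c.uX (Φ x y t)) x ∧
    HasDerivAt (fun x => prodφ (Φ x y t)) (c.prodφX (Φ x y t)) x := by
  have hl := hE.onLevel hc hΦ
  have hz : ∀ j k, HasDerivAt (fun x => Φ x y t j k)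
      (flowField c.eig 1 0 0 (Φ x y t) j k) x := fun j k => by
    have h := (hl x y t).field_eq_flowField 1 0 0
    simp only [one_smul, zero_smul, add_zero, mul_zero, zero_mul] at h
    exact hasDerivAt_pi.1 (hasDerivAt_pi.1 ((hΦ.eq_x x y t).congr_deriv h) j) k
  refine ⟨(hasDerivAt_u_curve (fun x => hl x y t) hz).congr_deriv ?_,
    (hasDerivAt_prodφ_curve (fun x => hl x y t) hz).congr_deriv ?_⟩
  · simp [uX]
  · simp [prodφX]

lemma IsExplicit.hasDerivAt_y (x y t : ℝ) :
    HasDerivAt (fun y => u c.eig (Φ x y t))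
      (c.γ₁ * c.uX (Φ x y t) + I * (c.phaseY 0 - c.phaseY 1 : ℝ) * u c.eig (Φ x y t)) y ∧
    HasDerivAt (fun y => prodφ (Φ x y t))
      (c.γ₁ * c.prodφX (Φ x y t) + I * (c.phaseY 0 - c.phaseY 1 : ℝ) * prodφ (Φ x y t)) y := by
  have hl := hE.onLevel hc hΦ
  have hz : ∀ j k, HasDerivAt (fun y => Φ x y t j k)
      (flowField c.eig c.γ₁ c.phaseY 0 (Φ x y t) j k) y := fun j k => by
    have h := (hl x y t).field_eq_flowField 0 1 0
    simp only [one_smul, zero_smul, add_zero, zero_add, mul_zero, zero_mul, mul_one, one_mul] at h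
    exact hasDerivAt_pi.1 (hasDerivAt_pi.1 ((hΦ.eq_y x y t).congr_deriv h) j) k
  refine ⟨(hasDerivAt_u_curve (fun y => hl x y t) hz).congr_deriv ?_,
    (hasDerivAt_prodφ_curve (fun y => hl x y t) hz).congr_deriv ?_⟩
  · simp [uX]
  · simp [prodφX]

lemma IsExplicit.hasDerivAt_t (x y t : ℝ) :
    HasDerivAt (fun t => u c.eig (Φ x y t))
      (c.γ₂ * c.uX (Φ x y t) + I * (c.C₁₂ + c.C₂₁ : ℝ) * u c.eig (Φ x y t)) t := by
  have hl := hE.onLevel hc hΦ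
  have hz : ∀ j k, HasDerivAt (fun t => Φ x y t j k)
      (flowField c.eig c.γ₂ c.phaseT c.phaseEig (Φ x y t) j k) t := fun j k => by
    have h := (hl x y t).field_eq_flowField 0 0 1
    simp only [one_smul, zero_smul, add_zero, zero_add, mul_zero, zero_mul, mul_one, one_mul] at h
    exact hasDerivAt_pi.1 (hasDerivAt_pi.1 ((hΦ.eq_t x y t).congr_deriv h) j) k
  refine (hasDerivAt_u_curve (fun t => hl x y t) hz).congr_deriv ?_
  have hp1 : c.phaseT 1 = c.phaseT 0 - (c.C₁₂ + c.C₂₁) := rfl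
  rw [hp1, uX]
  push_cast
  ring

lemma IsExplicit.deriv_xx (x y t : ℝ) : deriv (fun s => deriv (fun r => u c.eig (Φ r y t)) s) x
    = -I * c.b * c.uX (Φ x y t) - 2 * (c.lam - c.mu) * c.prodφX (Φ x y t) := by
  have h := hE.hasDerivAt_x hc hΦ
  rw [show (fun s => deriv (fun r => u c.eig (Φ r y t)) s) = fun s => c.uX (Φ s y t) from
    funext fun s => (h s y t).1.deriv]
  exact (((h x y t).1.const_mul _).sub ((h x y t).2.const_mul _)).deriv

lemma IsExplicit.deriv_yy (x y t : ℝ) : deriv (fun s => deriv (fun r => u c.eig (Φ x r t)) s) y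
    = c.γ₁ ^ 2 * (-I * c.b * c.uX (Φ x y t) - 2 * (c.lam - c.mu) * c.prodφX (Φ x y t))
      + 2 * I * (c.phaseY 0 - c.phaseY 1 : ℝ) * c.γ₁ * c.uX (Φ x y t)
      - (c.phaseY 0 - c.phaseY 1 : ℝ) ^ 2 * u c.eig (Φ x y t) := by
  have h := hE.hasDerivAt_y hc hΦ
  rw [show (fun s => deriv (fun r => u c.eig (Φ x r t)) s) = fun s => c.γ₁ * c.uX (Φ x s t)
      + I * (c.phaseY 0 - c.phaseY 1 : ℝ) * u c.eig (Φ x s t) from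
    funext fun s => (h x s t).1.deriv]
  have hU : HasDerivAt (fun s => c.uX (Φ x s t)) _ y :=
    ((h x y t).1.const_mul (-I * c.b)).sub ((h x y t).2.const_mul (2 * (c.lam - c.mu) : ℂ))
  rw [((hU.const_mul (c.γ₁ : ℂ)).fun_add
    ((h x y t).1.const_mul (I * (c.phaseY 0 - c.phaseY 1 : ℝ)))).deriv]
  generalize c.phaseY 0 - c.phaseY 1 = w
  simp only [uX]
  linear_combination (w : ℂ) ^ 2 * u c.eig (Φ x y t) * I_sq

lemma IsExplicit.norm_sq_uSol (x y t : ℝ) : ‖c.uSol x₀ θ₀ x y t‖ ^ 2 = 4 * c.R₁ ^ 2 * c.R₂ ^ 2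
    / c.b ^ 2 * (c.E - c.b * (c.lam - c.mu) * c.rho (c.xi x₀ x y t)) := by
  rw [← hE.u_eq, (hE.onLevel hc hΦ x y t).u_norm_sq, hE.rhoAt_eq hc]

lemma IsExplicit.isDSISolution : IsDSISolution (c.uSol x₀ θ₀) (c.v₁Sol x₀) (c.v₂Sol x₀) := by
  have hl := hE.onLevel hc hΦ
  have hu : c.uSol x₀ θ₀ = fun x y t => u c.eig (Φ x y t) := by
    funext x y t; exact (hE.u_eq x y t).symm
  have hb := hc.b_pos.ne'
  have hρ : ∀ x y t : ℝ, HasDerivAt (fun s => c.rho (c.xi x₀ s y t)) (c.rhoD (c.xi x₀ x y t)) x ∧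
      HasDerivAt (fun s => c.rho (c.xi x₀ x s t)) (c.rhoD (c.xi x₀ x y t) * c.γ₁) y := by
    intro x y t
    have h1 : HasDerivAt (fun s => c.xi x₀ s y t) 1 x := by
      simp only [xi]
      simpa using (((hasDerivAt_id x).add_const (c.γ₁ * y)).add_const (c.γ₂ * t)).sub_const x₀
    have h2 : HasDerivAt (fun s => c.xi x₀ x s t) c.γ₁ y := by
      simp only [xi]
      simpa using ((((hasDerivAt_id y).const_mul c.γ₁).const_add x).add_const (c.γ₂ * t)).sub_const x₀
    exact ⟨((hc.hasDerivAt_rho _).comp x h1).congr_deriv (mul_one _), (hc.hasDerivAt_rho _).comp y h2⟩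
  have hn : ∀ x y t : ℝ, HasDerivAt (fun s => ‖c.uSol x₀ θ₀ s y t‖ ^ 2)
      (4 * c.R₁ ^ 2 * c.R₂ ^ 2 / c.b ^ 2
        * -(c.b * (c.lam - c.mu) * c.rhoD (c.xi x₀ x y t))) x := by
    intro x y t
    simp only [hE.norm_sq_uSol hc hΦ]
    exact (((hρ x y t).1.const_mul _).const_sub _).const_mul _
  refine ⟨?_, ?_, ?_, fun x y t => ?_, fun x y t => ?_, fun x y t => ?_⟩
  -- Smoothness is inherited from `Φ`: on the level set the denominator of `u` is the constant `b`.
  · have h : (fun w : ℝ × ℝ × ℝ => c.uSol x₀ θ₀ w.1 w.2.1 w.2.2) = fun w =>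
        2 * I * (br c.eig (Φ w.1 w.2.1 w.2.2) 1 0 1
          + br c.eig (Φ w.1 w.2.1 w.2.2) 1 2 0 * br c.eig (Φ w.1 w.2.1 w.2.2) 2 0 0) / c.b := by
      funext w; rw [← hE.u_eq, (hl _ _ _).u_eq, cross]
    rw [h]
    exact (contDiff_const.mul ((contDiff_br hΦ.smooth 1 0 1).add
      ((contDiff_br hΦ.smooth 1 2 0).mul (contDiff_br hΦ.smooth 2 0 0)))).div_const _
  · simp only [← hE.v₁_eq]
    exact contDiff_const.mul ((contDiff_br hΦ.smooth 2 0 0).norm_sq ℝ)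
  · simp only [← hE.v₂_eq]
    exact contDiff_const.mul ((contDiff_br hΦ.smooth 2 1 0).norm_sq ℝ)
  · have hnu : (‖c.uSol x₀ θ₀ x y t‖ : ℂ) ^ 2 = 4 * (c.R₁ : ℂ) ^ 2 * (c.R₂ : ℂ) ^ 2
        / (c.b : ℂ) ^ 2 * (c.E - c.b * (c.lam - c.mu) * c.rho (c.xi x₀ x y t)) := by
      exact_mod_cast congrArg ofReal (hE.norm_sq_uSol hc hΦ x y t)
    have k1 := congrArg ofReal hc.γ₂_dispersion
    have k2 := congrArg ofReal hc.C_dispersion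
    have k3 := congrArg ofReal hc.ρ_dispersion
    rw [hnu, hu]
    simp only []
    rw [(hE.hasDerivAt_t hc hΦ x y t).deriv, hE.deriv_xx hc hΦ, hE.deriv_yy hc hΦ]
    simp only [uX, prodφX, hE.rhoAt_eq hc, v₁Sol, v₂Sol]
    generalize c.phaseY 0 - c.phaseY 1 = w at *
    generalize c.C₁₂ + c.C₂₁ = C at *
    generalize u c.eig (Φ x y t) = U
    generalize prodφ (Φ x y t) = e
    generalize c.rho (c.xi x₀ x y t) = r
    push_cast at *
    linear_combination 2 * I * (c.lam - c.mu) * e * k1 + U * k2 - r * U * k3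
      + U * (c.γ₂ * c.b - C - (1 + c.γ₁ ^ 2) * c.b ^ 2 + 2 * w * c.γ₁ * c.b) * I_sq
  · simp only [v₁Sol]
    rw [(((((hρ x y t).1.const_mul _).add_const _).sub_const _).const_mul _).deriv,
      (((((hρ x y t).2.const_mul _).add_const _).sub_const _).const_mul _).deriv,
      (hn x y t).deriv]
    have := hc.one_sub_γ₁
    have e : 2 * c.R₁ ^ 2 * ((c.mu - c.lam) * c.rhoD (c.xi x₀ x y t))
        - 2 * c.R₁ ^ 2 * ((c.mu - c.lam) * (c.rhoD (c.xi x₀ x y t) * c.γ₁))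
        = 2 * c.R₁ ^ 2 * ((c.mu - c.lam) * c.rhoD (c.xi x₀ x y t)) * (1 - c.γ₁) := by ring
    rw [e, this]
    field_simp
    ring
  · simp only [v₂Sol]
    rw [((((((hρ x y t).1.const_mul _).sub_const _).add_const _).add_const _).const_mul _).deriv,
      ((((((hρ x y t).2.const_mul _).sub_const _).add_const _).add_const _).const_mul _).deriv,
      (hn x y t).deriv]
    have := hc.one_add_γ₁
    have e : 2 * c.R₂ ^ 2 * ((c.lam - c.mu) * c.rhoD (c.xi x₀ x y t))
        + 2 * c.R₂ ^ 2 * ((c.lam - c.mu) * (c.rhoD (c.xi x₀ x y t) * c.γ₁))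
        = 2 * c.R₂ ^ 2 * ((c.lam - c.mu) * c.rhoD (c.xi x₀ x y t)) * (1 + c.γ₁) := by ring
    rw [e, this]
    field_simp
    ring

end Explicit

end DSParam

/-! ### Periodicity, zeros and argument of `u`. -/

namespace DSParam

open Complex DSSystem

variable {c : DSParam}

/-- The periodic part of `∫ Q(ρ(ξ)) dξ`. -/
def phaseJ (c : DSParam) (ξ : ℝ) : ℝ := (∫ s in (0 : ℝ)..ξ, c.Q (c.rho s)) - c.A * ξ

/-- The coefficient of the exponential in `u`. -/
def amplitude (c : DSParam) (ξ : ℝ) : ℂ :=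
  I * c.R₁ * c.R₂ / ((c.R₁ : ℂ) ^ 2 - (c.R₂ : ℂ) ^ 2)
    * (1 / (√(c.rho ξ * (1 - c.rho ξ)) : ℂ))
    * ((c.Y (c.rho ξ) : ℂ) - I * (c.sqrtP ξ : ℂ))

lemma uSol_eq_amplitude (x₀ θ₀ x y t : ℝ) : c.uSol x₀ θ₀ x y t
    = c.amplitude (c.xi x₀ x y t) * cexp (I * (θ₀ + c.phaseJ (c.xi x₀ x y t)
      + ((c.A + c.α) * x + (c.A - c.α) * c.γ₁ * y)
      + (c.C₁₂ + c.C₂₁ + c.A * c.γ₂ + c.α * c.γ₂) * t - c.A * x₀ : ℝ)) := by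
  rw [uSol, amplitude]
  congr 4
  simp only [phaseJ, xi]
  ring

namespace Admissible

variable (hc : c.Admissible)
include hc

lemma periodic_amplitude : Function.Periodic c.amplitude (c.T / c.p) := fun ξ => by
  simp only [amplitude, hc.sqrtP_eq, hc.periodic_rho ξ, hc.periodic_rhoD ξ]

lemma periodic_phaseJ (h : c.RootsInRange) : Function.Periodic c.phaseJ (c.T / c.p) := fun ξ => by
  have hi : ∀ a b : ℝ, IntervalIntegrable (fun s => c.Q (c.rho s)) MeasureTheory.volume a b :=
    fun a b => (hc.continuous_Q_rho h).intervalIntegrable a b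
  have hper : Function.Periodic (fun s => c.Q (c.rho s)) (c.T / c.p) := fun s => by
    simp only [hc.periodic_rho s]
  have hT := hc.T_pos.ne'
  have hp := hc.p_pos.ne'
  have e := hper.intervalIntegral_add_eq ξ 0
  rw [zero_add] at e
  rw [phaseJ, phaseJ, ← intervalIntegral.integral_add_adjacent_intervals (hi 0 ξ) (hi _ _), e, A]
  field_simp
  ring

/-- When `γ₂τ` is a whole number of periods, the amplitude and the periodic part of the phase
return, and only the part of the phase linear in `t` is left. -/
lemma uSol_add_t (h : c.RootsInRange) {τ : ℝ} {n : ℤ} (hτ : c.γ₂ * τ = n * (c.T / c.p))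
    (x₀ θ₀ x y t : ℝ) : c.uSol x₀ θ₀ x y (t + τ) = c.uSol x₀ θ₀ x y t
      * cexp (((c.C₁₂ + c.C₂₁ + c.A * c.γ₂ + c.α * c.γ₂) * τ : ℝ) * I) := by
  have hξ : c.xi x₀ x y (t + τ) = c.xi x₀ x y t + n * (c.T / c.p) := by
    rw [← hτ]; simp only [xi]; ring
  rw [uSol_eq_amplitude, uSol_eq_amplitude, hξ, hc.periodic_amplitude.int_mul n,
    (hc.periodic_phaseJ h).int_mul n, mul_assoc (c.amplitude _), ← Complex.exp_add]
  congr 2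
  push_cast
  ring

lemma γ₁_pos : 0 < c.γ₁ := div_pos (add_pos hc.R₁_sq_pos hc.R₂_sq_pos) hc.b_pos

lemma exists_rho_eq_ρ₂ : ∃ ξ, c.rho ξ = c.ρ₂ ∧ c.rhoD ξ = 0 :=
  hc.exists_rho_eq hc.ρ₁_lt_ρ₂.le le_rfl (by rw [hc.P_ρ₂]; norm_num)

/-- `u` as a function of `x + γ₁y`, `(A + α)x + (A - α)γ₁y` and `t`. -/
lemma exists_periodic_form (h : c.RootsInRange) (x₀ θ₀ : ℝ) : ∃ F : ℝ → ℝ → ℝ → ℂ,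
    (∀ r s t : ℝ, F (r + c.T / c.p) s t = F r s t) ∧
    (∀ r s t : ℝ, F r (s + 2 * Real.pi) t = F r s t) ∧
    ∀ x y t : ℝ, c.uSol x₀ θ₀ x y t =
      F (x + c.γ₁ * y) ((c.A + c.α) * x + (c.A - c.α) * c.γ₁ * y) t := by
  refine ⟨fun r s t => c.amplitude (r + c.γ₂ * t - x₀) * cexp (I * (θ₀
    + c.phaseJ (r + c.γ₂ * t - x₀) + s
    + (c.C₁₂ + c.C₂₁ + c.A * c.γ₂ + c.α * c.γ₂) * t - c.A * x₀ : ℝ)), fun r s t => ?_,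
    fun r s t => ?_, fun x y t => ?_⟩
  · have e : r + c.T / c.p + c.γ₂ * t - x₀ = r + c.γ₂ * t - x₀ + c.T / c.p := by ring
    simp only [e, hc.periodic_amplitude _, hc.periodic_phaseJ h _]
  · simp only []
    congr 1
    refine Eq.trans ?_ (Complex.exp_periodic _)
    congr 1
    push_cast
    ring
  · rw [uSol_eq_amplitude, xi]

lemma exists_double_period (h : c.RootsInRange) (hα : c.α ≠ 0) (x₀ θ₀ : ℝ) :
    ∃ w₁ w₂ : ℝ × ℝ, LinearIndependent ℝ ![w₁, w₂] ∧ ∀ x y t : ℝ,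
      c.uSol x₀ θ₀ (x + w₁.1) (y + w₁.2) t = c.uSol x₀ θ₀ x y t ∧
      c.uSol x₀ θ₀ (x + w₂.1) (y + w₂.2) t = c.uSol x₀ θ₀ x y t := by
  obtain ⟨F, hF1, hF2, hF⟩ := hc.exists_periodic_form h x₀ θ₀
  have hγ := hc.γ₁_pos.ne'
  have hT := div_pos hc.T_pos hc.p_pos
  set τ := c.T / c.p
  -- The first vector raises `x + γ₁y` by `τ` and fixes the other linear form; the second fixes `x +
  -- γ₁y` and raises the other by `2π`. For `α ≠ 0` the two forms are independent.
  refine ⟨((τ - c.A * τ / c.α) / 2, (τ + c.A * τ / c.α) / 2 / c.γ₁),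
    (Real.pi / c.α, -Real.pi / c.α / c.γ₁), ?_, fun x y t => ⟨?_, ?_⟩⟩
  · rw [LinearIndependent.pair_iff]
    intro s r hsr
    have h1 := congrArg Prod.fst hsr
    have h2 := congrArg Prod.snd hsr
    simp only [Prod.smul_mk, Prod.mk_add_mk, smul_eq_mul, Prod.fst_zero, Prod.snd_zero] at h1 h2
    have h3 : s * τ = 0 := by
      have : s * τ = (s * ((τ - c.A * τ / c.α) / 2) + r * (Real.pi / c.α))
          + c.γ₁ * (s * ((τ + c.A * τ / c.α) / 2 / c.γ₁) + r * (-Real.pi / c.α / c.γ₁)) := by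
        field_simp; ring
      rw [this, h1, h2]; ring
    have hs : s = 0 := (mul_eq_zero.1 h3).resolve_right hT.ne'
    refine ⟨hs, ?_⟩
    rw [hs, zero_mul, zero_add] at h1
    exact (mul_eq_zero.1 h1).resolve_right (div_ne_zero Real.pi_ne_zero hα)
  · rw [hF, hF, ← hF1 (x + c.γ₁ * y)]
    congr 1
    · field_simp; ring
    · field_simp; ring
  · rw [hF, hF, ← hF2 (x + c.γ₁ * y)]
    congr 1
    · field_simp; ring
    · field_simp; ring

end Admissible

section Explicit

variable (hc : c.Admissible) (hroots : c.RootsInRange) {Φ : ℝ → ℝ → ℝ → Fin 3 → Fin 2 → ℂ}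
  (hΦ : IsSolution c.eig Φ) {x₀ θ₀ : ℝ} (hE : c.IsExplicit Φ x₀ θ₀)
include hc hΦ hE

/-- `|u|²` is a nonconstant affine function of `ρ`, so it cannot vanish both at `ρ₁` and at `ρ₂`. -/
lemma IsExplicit.exists_uSol_ne_zero : ∃ x, c.uSol x₀ θ₀ x 0 0 ≠ 0 := by
  by_contra! hzero
  obtain ⟨ξ, hξ, -⟩ := hc.exists_rho_eq_ρ₂
  have e : ∀ s, c.xi x₀ (s + x₀) 0 0 = s := fun s => by simp [xi]
  have h1 := hE.norm_sq_uSol hc hΦ (0 + x₀) 0 0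
  have h2 := hE.norm_sq_uSol hc hΦ (ξ + x₀) 0 0
  rw [hzero, e, hc.rho_zero] at h1
  rw [hzero, e, hξ] at h2
  have hk : 4 * c.R₁ ^ 2 * c.R₂ ^ 2 / c.b ^ 2 ≠ 0 := by
    have := hc.R₁_sq_pos
    have := hc.R₂_sq_pos
    have := hc.b_pos
    positivity
  have h3 := mul_left_cancel₀ hk (h1.symm.trans h2)
  have h4 := mul_left_cancel₀ (mul_pos hc.b_pos hc.lam_sub_mu_pos).ne' (sub_right_injective h3)
  exact hc.ρ₁_lt_ρ₂.ne h4

include hroots in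
lemma IsExplicit.periodic_t_iff :
    (∃ τ : ℝ, 0 < τ ∧ ∀ x y t : ℝ, c.uSol x₀ θ₀ x y (t + τ) = c.uSol x₀ θ₀ x y t) ↔
      c.γ₂ = 0 ∨ ∃ r : ℚ, (c.C₁₂ + c.C₂₁ + c.A * c.γ₂ + c.α * c.γ₂) * c.T
        / (2 * Real.pi * c.p * c.γ₂) = r := by
  have hT := hc.T_pos.ne'
  have hp := hc.p_pos.ne'
  have hpi := Real.pi_ne_zero
  have hadd := fun {τ : ℝ} {n : ℤ} (hτ : c.γ₂ * τ = n * (c.T / c.p)) =>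
    hc.uSol_add_t hroots hτ x₀ θ₀
  generalize hη : c.C₁₂ + c.C₂₁ + c.A * c.γ₂ + c.α * c.γ₂ = η at *
  constructor
  · rintro ⟨τ, hτ, hper⟩
    by_cases hγ : c.γ₂ = 0
    · exact Or.inl hγ
    right
    -- A `t`-period of `u` is one of `|u|²`, hence of `ρ`.
    have hrho : Function.Periodic c.rho (c.γ₂ * τ) := fun ξ => by
      have h1 := hE.norm_sq_uSol hc hΦ (ξ + x₀) 0 (0 + τ)
      have h2 := hE.norm_sq_uSol hc hΦ (ξ + x₀) 0 0
      rw [hper, h2] at h1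
      have hk : 4 * c.R₁ ^ 2 * c.R₂ ^ 2 / c.b ^ 2 ≠ 0 := by
        have := hc.R₁_sq_pos
        have := hc.R₂_sq_pos
        have := hc.b_pos
        positivity
      have h3 := mul_left_cancel₀ (mul_pos hc.b_pos hc.lam_sub_mu_pos).ne'
        (sub_right_injective (mul_left_cancel₀ hk h1))
      simp only [xi] at h3
      ring_nf at h3 ⊢
      exact h3.symm
    obtain ⟨n, hn⟩ := hc.exists_int_of_periodic_rho hrho
    have hn0 : (n : ℝ) ≠ 0 := fun h0 => by
      rw [h0, zero_mul] at hn
      exact mul_ne_zero two_ne_zero (mul_ne_zero hγ hτ.ne') hn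
    obtain ⟨x, hx⟩ := hE.exists_uSol_ne_zero hc hΦ
    -- Two periods are taken because `γ₂τ` is only known to be a multiple of `T/(2p)`. The factor 2
    -- does not affect rationality.
    have h2 := hadd (τ := 2 * τ) (n := n) (by rw [← hn]; ring) x 0 0
    rw [show (0 : ℝ) + 2 * τ = 0 + τ + τ by ring, hper, hper] at h2
    obtain ⟨m, hm⟩ := Complex.exp_eq_one_iff.1 (mul_left_cancel₀ hx (by rw [← h2, mul_one]))
    have hm' : η * (2 * τ) = m * (2 * Real.pi) := by
      have : ((η * (2 * τ) : ℝ) : ℂ) = ((m * (2 * Real.pi) : ℝ) : ℂ) := by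
        refine mul_right_cancel₀ I_ne_zero ?_
        rw [hm]; push_cast; ring
      exact_mod_cast this
    refine ⟨m / n, ?_⟩
    push_cast
    have hTe : c.T = 2 * (c.γ₂ * τ) * c.p / n := by
      rw [hn]; field_simp
    rw [hTe]
    field_simp
    linear_combination hm' / 2
  · intro hcases
    -- The natural candidates have the sign of `η` or of `γ₂`; a negative period may be reversed.
    suffices hne : ∃ τ : ℝ, τ ≠ 0 ∧ ∀ x y t : ℝ, c.uSol x₀ θ₀ x y (t + τ) = c.uSol x₀ θ₀ x y t by
      obtain ⟨τ, h0, hτ⟩ := hne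
      rcases h0.lt_or_gt with hlt | hgt
      · refine ⟨-τ, neg_pos.2 hlt, fun x y t => ?_⟩
        rw [← hτ x y (t + -τ), neg_add_cancel_right]
      · exact ⟨τ, hgt, hτ⟩
    by_cases hγ : c.γ₂ = 0
    · by_cases h0 : η = 0
      · refine ⟨1, one_ne_zero, fun x y t => ?_⟩
        rw [hadd (n := 0) (by simp [hγ]), h0]
        simp
      · refine ⟨2 * Real.pi / η, by positivity, fun x y t => ?_⟩
        rw [hadd (n := 0) (by simp [hγ]), mul_div_cancel₀ _ h0]
        push_cast
        rw [exp_two_pi_mul_I, mul_one]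
    · obtain ⟨r, hr⟩ := hcases.resolve_left hγ
      -- `ξ` advances by `r.den` periods `T/p`, and the remaining phase by `2π` times the numerator
      -- of `r`.
      refine ⟨r.den * (c.T / (c.p * c.γ₂)), ?_, fun x y t => ?_⟩
      · have := r.den_ne_zero
        positivity
      · rw [hadd (n := r.den) (by push_cast; field_simp)]
        have hw : η * (r.den * (c.T / (c.p * c.γ₂))) = r.num * (2 * Real.pi) := by
          have hrd : (r : ℝ) * r.den = r.num := by exact_mod_cast Rat.mul_den_eq_num r
          rw [← hrd, ← hr]
          field_simp
        rw [hw]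
        push_cast
        rw [mul_assoc, Complex.exp_int_mul_two_pi_mul_I, mul_one]

variable (hne : (2 * c.K - c.lam - c.mu - c.a + c.b) * c.E
  ≠ (c.K + c.G - c.mu - c.a) * (c.b * (c.lam - c.mu)))
include hne

omit hΦ hE in
-- Where this vanishes, `P = -Y²` while also `P = ρ'² ≥ 0`, so `Y = 0`. Two functions affine in `ρ`
-- then share a zero, and eliminating `ρ` gives the excluded relation.
lemma E_sub_ne_zero (ξ : ℝ) : c.E - c.b * (c.lam - c.mu) * c.rho ξ ≠ 0 := fun h0 => by
  have hP := hc.rhoD_sq ξ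
  rw [P_eq_sub_Y_sq, h0, mul_zero, zero_sub] at hP
  have hY : c.Y (c.rho ξ) = 0 := by
    have : c.Y (c.rho ξ) ^ 2 = 0 := le_antisymm (by nlinarith [sq_nonneg (c.rhoD ξ)]) (sq_nonneg _)
    exact pow_eq_zero_iff two_ne_zero |>.1 this
  rw [Y] at hY
  refine hne ?_
  linear_combination (2 * c.K - c.lam - c.mu - c.a + c.b) * h0 + c.b * (c.lam - c.mu) * hY

lemma IsExplicit.uSol_ne_zero (x y t : ℝ) : c.uSol x₀ θ₀ x y t ≠ 0 := fun h0 => by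
  have h := hE.norm_sq_uSol hc hΦ x y t
  have := hc.R₁_sq_pos
  have := hc.R₂_sq_pos
  have := hc.b_pos
  rw [h0, norm_zero, zero_pow two_ne_zero] at h
  exact mul_ne_zero (by positivity) (E_sub_ne_zero hc hne _) h.symm

/-- Divide `u_x = -ibu - 2(λ - μ)φ₁φ̄₂` by `u` and write `φ₁φ̄₂/u` as `φ₁φ̄₂ū/|u|²`, both parts of
which are known functions of `ρ` and `σ`. -/
lemma IsExplicit.im_deriv_div (x y t : ℝ) :
    (deriv (fun s => c.uSol x₀ θ₀ s y t) x / c.uSol x₀ θ₀ x y t).im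
      = -c.b - c.b * (c.lam - c.mu) * c.Y (c.rho (c.xi x₀ x y t))
        / (2 * (c.E - c.b * (c.lam - c.mu) * c.rho (c.xi x₀ x y t))) := by
  have hl := hE.onLevel hc hΦ x y t
  have hu0 := hE.uSol_ne_zero hc hΦ hne x y t
  have hn := E_sub_ne_zero hc hne (c.xi x₀ x y t)
  have hb := hl.b_ne'
  have h1 := hl.R₁_ne'
  have h2 := hl.R₂_ne'
  have hd : deriv (fun s => c.uSol x₀ θ₀ s y t) x = c.uX (Φ x y t) := by
    simp only [← hE.u_eq]
    exact (hE.hasDerivAt_x hc hΦ x y t).1.deriv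
  have hn' : (c.E - c.b * (c.lam - c.mu) * c.rho (c.xi x₀ x y t) : ℂ) ≠ 0 := by exact_mod_cast hn
  have e1 := hl.u_mul_conj
  have e2 := congrArg conj hl.u_mul_conj_prodφ
  rw [hE.rhoAt_eq hc] at e1 e2
  simp only [map_mul, map_sub, map_div₀, map_pow, conj_ofReal, conj_I, Complex.conj_conj] at e2
  rw [← hE.u_eq] at hu0
  have hcu : conj (u c.eig (Φ x y t)) ≠ 0 := (map_ne_zero _).2 hu0
  have key : c.uX (Φ x y t) / u c.eig (Φ x y t)
      = ((-(c.lam - c.mu) * c.b * c.sigAt (Φ x y t)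
          / (2 * (c.E - c.b * (c.lam - c.mu) * c.rho (c.xi x₀ x y t))) : ℝ) : ℂ)
        + ((-c.b - c.b * (c.lam - c.mu) * c.Y (c.rho (c.xi x₀ x y t))
        / (2 * (c.E - c.b * (c.lam - c.mu) * c.rho (c.xi x₀ x y t))) : ℝ) : ℂ) * I := by
    rw [div_eq_iff hu0]
    refine mul_right_cancel₀ hcu ?_
    rw [mul_assoc, e1, uX]
    rw [show (-I * c.b * u c.eig (Φ x y t) - 2 * (c.lam - c.mu) * prodφ (Φ x y t))
        * conj (u c.eig (Φ x y t)) = -I * c.b * (u c.eig (Φ x y t) * conj (u c.eig (Φ x y t)))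
          - 2 * (c.lam - c.mu) * (conj (u c.eig (Φ x y t)) * prodφ (Φ x y t)) by ring, e1, e2]
    push_cast
    field_simp
    ring
  rw [hd, ← hE.u_eq, key]
  simp only [add_im, mul_im, ofReal_im, ofReal_re, I_re, I_im]
  ring

/-- By `im_deriv_div` the quantity is a fractional linear function of `ρ`, and `hne` says that its
determinant is nonzero. So it takes different values at `ρ₁` and `ρ₂`, both of which `ρ` attains on
every line. -/
lemma IsExplicit.not_const_im (y t : ℝ) : ¬ ∃ κ : ℝ, ∀ x : ℝ,
    (deriv (fun s => c.uSol x₀ θ₀ s y t) x / c.uSol x₀ θ₀ x y t).im = κ := by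
  rintro ⟨κ, hκ⟩
  simp only [hE.im_deriv_div hc hΦ hne] at hκ
  obtain ⟨ξ, hξ, -⟩ := hc.exists_rho_eq_ρ₂
  have e : ∀ s, c.xi x₀ (s + x₀ - c.γ₁ * y - c.γ₂ * t) y t = s := fun s => by simp only [xi]; ring
  have h1 := hκ (0 + x₀ - c.γ₁ * y - c.γ₂ * t)
  have h2 := hκ (ξ + x₀ - c.γ₁ * y - c.γ₂ * t)
  have n1 := E_sub_ne_zero hc hne 0
  have n2 := E_sub_ne_zero hc hne ξ
  rw [e, hc.rho_zero] at h1
  rw [e, hξ] at h2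
  rw [hc.rho_zero] at n1
  rw [hξ] at n2
  have h3 := h1.trans h2.symm
  have hβ := (mul_pos hc.b_pos hc.lam_sub_mu_pos).ne'
  have h4 : c.Y c.ρ₁ * (c.E - c.b * (c.lam - c.mu) * c.ρ₂)
      = c.Y c.ρ₂ * (c.E - c.b * (c.lam - c.mu) * c.ρ₁) := by
    have h5 := sub_right_injective h3
    rw [div_eq_div_iff (mul_ne_zero two_ne_zero n1) (mul_ne_zero two_ne_zero n2)] at h5
    refine mul_left_cancel₀ (mul_ne_zero two_ne_zero hβ) ?_
    linear_combination h5
  have hρ : c.ρ₁ - c.ρ₂ ≠ 0 := sub_ne_zero.2 hc.ρ₁_lt_ρ₂.ne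
  refine hne (mul_left_cancel₀ hρ ?_)
  simp only [Y] at h4
  linear_combination h4

end Explicit

end DSParam

theorem mainTheorem6 (c : DSParam) (hc : c.Admissible) :
    -- every solution of the `N = 2` systems with these values of the integrals is explicit
    (∀ Φ : ℝ → ℝ → ℝ → Fin 3 → Fin 2 → ℂ,
      DSSystem.IsSolution c.eig Φ → c.IntegralsAt (Φ 0 0 0) →
        c.RootsInRange ∧ ∃ x₀ θ₀ : ℝ, c.IsExplicit Φ x₀ θ₀) ∧
    (c.RootsInRange →
      -- `T(k)` is the minimal positive period of `sn`
      IsLeast {τ : ℝ | 0 < τ ∧ Function.Periodic (jacobiSn c.k) τ} c.T ∧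
      -- `ρ` solves the elliptic equation and stays in `(0, 1)`
      (∀ ξ : ℝ, 0 < c.rho ξ ∧ c.rho ξ < 1 ∧ HasDerivAt c.rho (-c.sqrtP ξ) ξ ∧
        c.sqrtP ξ ^ 2 = c.P (c.rho ξ)) ∧
      ∀ x₀ θ₀ : ℝ,
        -- the explicit functions come from a solution of the systems
        (∃ Φ : ℝ → ℝ → ℝ → Fin 3 → Fin 2 → ℂ,
          DSSystem.IsSolution c.eig Φ ∧ c.IsExplicit Φ x₀ θ₀) ∧
        -- they are smooth on all of `ℝ³` and solve the DSI equation
        IsDSISolution (c.uSol x₀ θ₀) (c.v₁Sol x₀) (c.v₂Sol x₀) ∧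
        -- (1) `u` is periodic in `x + γ₁y` and in `(A + α)x + (A - α)γ₁y`
        (∃ F : ℝ → ℝ → ℝ → ℂ,
          (∀ r s t : ℝ, F (r + c.T / c.p) s t = F r s t) ∧
          (∀ r s t : ℝ, F r (s + 2 * Real.pi) t = F r s t) ∧
          ∀ x y t : ℝ, c.uSol x₀ θ₀ x y t =
            F (x + c.γ₁ * y) ((c.A + c.α) * x + (c.A - c.α) * c.γ₁ * y) t) ∧
        (c.α ≠ 0 → ∃ w₁ w₂ : ℝ × ℝ, LinearIndependent ℝ ![w₁, w₂] ∧
          ∀ x y t : ℝ,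
            c.uSol x₀ θ₀ (x + w₁.1) (y + w₁.2) t = c.uSol x₀ θ₀ x y t ∧
            c.uSol x₀ θ₀ (x + w₂.1) (y + w₂.2) t = c.uSol x₀ θ₀ x y t) ∧
        -- (2) periodicity in `t`
        ((∃ τ : ℝ, 0 < τ ∧ ∀ x y t : ℝ, c.uSol x₀ θ₀ x y (t + τ) = c.uSol x₀ θ₀ x y t) ↔
          c.γ₂ = 0 ∨ ∃ r : ℚ,
            (c.C₁₂ + c.C₂₁ + c.A * c.γ₂ + c.α * c.γ₂) * c.T
              / (2 * Real.pi * c.p * c.γ₂) = r) ∧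
        -- (3) `|u|²`, `v₁`, `v₂` are periodic functions of `x + γ₁y + γ₂t` only
        (∃ n V₁ V₂ : ℝ → ℝ,
          Function.Periodic n (c.T / c.p) ∧ Function.Periodic V₁ (c.T / c.p) ∧
          Function.Periodic V₂ (c.T / c.p) ∧
          ∀ x y t : ℝ,
            ‖c.uSol x₀ θ₀ x y t‖ ^ 2 = n (x + c.γ₁ * y + c.γ₂ * t) ∧
            c.v₁Sol x₀ x y t = V₁ (x + c.γ₁ * y + c.γ₂ * t) ∧
            c.v₂Sol x₀ x y t = V₂ (x + c.γ₁ * y + c.γ₂ * t)) ∧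
        -- (4) outside one exceptional relation, `(arg u)_x = Im (u_x / u)` is not constant
        ((2 * c.K - c.lam - c.mu - c.a + c.b) * c.E
            ≠ (c.K + c.G - c.mu - c.a) * (c.b * (c.lam - c.mu)) →
          (∀ x y t : ℝ, c.uSol x₀ θ₀ x y t ≠ 0) ∧
          ∀ y t : ℝ, ¬ ∃ κ : ℝ, ∀ x : ℝ,
            (deriv (fun s => c.uSol x₀ θ₀ s y t) x / c.uSol x₀ θ₀ x y t).im = κ)) := by
  refine ⟨fun Φ hΦ h0 => DSParam.exists_isExplicit hc hΦ h0, fun h => ⟨isLeast_snPeriod hc.k_sq_lt_one,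
    fun ξ => ⟨hc.rho_pos h ξ, hc.rho_lt_one h ξ, ?_, ?_⟩, fun x₀ θ₀ => ?_⟩⟩
  · rw [hc.sqrtP_eq, neg_neg]
    exact hc.hasDerivAt_rho ξ
  · rw [hc.sqrtP_eq, neg_sq, hc.rhoD_sq]
  obtain ⟨Φ, hΦ, hE⟩ := DSParam.exists_isSolution_isExplicit hc h x₀ θ₀
  have hper : ∀ s, c.rho (s + c.T / c.p - x₀) = c.rho (s - x₀) := fun s => by
    rw [add_sub_right_comm, hc.periodic_rho]
  refine ⟨⟨Φ, hΦ, hE⟩, hE.isDSISolution hc hΦ, hc.exists_periodic_form h x₀ θ₀,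
    fun hα => hc.exists_double_period h hα x₀ θ₀, hE.periodic_t_iff hc h hΦ,
    ⟨fun s => 4 * c.R₁ ^ 2 * c.R₂ ^ 2 / c.b ^ 2
        * (c.E - c.b * (c.lam - c.mu) * c.rho (s - x₀)),
      fun s => 2 * c.R₁ ^ 2 * ((c.mu - c.lam) * c.rho (s - x₀) + c.K - c.mu),
      fun s => 2 * c.R₂ ^ 2 * ((c.lam - c.mu) * c.rho (s - x₀) - c.K + c.mu + c.a),
      fun s => ?_, fun s => ?_, fun s => ?_,
      fun x y t => ⟨hE.norm_sq_uSol hc hΦ x y t, rfl, rfl⟩⟩,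
    fun hne => ⟨hE.uSol_ne_zero hc hΦ hne, hE.not_const_im hc hΦ hne⟩⟩ <;>
  simp only [hper]

end
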